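/- **Setting.** A *rectilinear drawing* of a plane graph is a planar drawing (vertices are distinct points, distinct edges meet only in common end-vertices) in which every edge is a horizontal or a vertical segment. A *rectilinear representation* $H$ is a class of shape-equivalent rectilinear drawings (same plane graph, same angles at the vertices), taken with a fixed orientation: for each edge $uv$ it is fixed whether $u$ lies to the left of, to the right of, above or below $v$; the members of the class are the *drawings of $H$*. $H$ is *convex* if every internal face is a rectangle and the external face is bounded by an orthoconvex polygon (every horizontal or vertical line meets the polygon in a single segment or not at all). A graph is *biconnected* if it is connected and any two distinct vertices are joined by two internally disjoint paths. The digraph $D_x$ is obtained from $H$ by contracting each maximal path of vertical edges into a node and orienting the horizontal edges from left to right; $c_x(u)$ is the node whose path contains the vertex $u$. $D_y$ and $c_y(u)$ are defined symmetrically (contract maximal horizontal paths, orient vertical edges upwards). An *$st$-ordering* of such an acyclic digraph $D$ is a linear order $v_1,\dots,v_m$ of its nodes with $i<j$ for each arc $(v_i,v_j)$. It is *good* if for all $1\le i<j\le m$ the subgraph of $D$ induced by $v_i,\dots,v_j$ has at most two connected components (ignoring arc directions) and, if it has exactly two, all nodes of one precede all nodes of the other. A drawing is *greedy* if for every ordered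 pair $(u,v)$ of vertices there is a path $u=w_0,\dots,w_k=v$ in the graph with $d(w_{i+1},v)<d(w_i,v)$ for $0\le i<k$, where $d$ is the Euclidean distance. A drawing of $H$ *respects* $\mathcal S_x$ and $\mathcal S_y$ if, for all vertices $u,w$, $u$ lies strictly to the left of $w$ if and only if $c_x(u)$ precedes $c_x(w)$ in $\mathcal S_x$, and $u$ lies strictly below $w$ if and only if $c_y(u)$ precedes $c_y(w)$ in $\mathcal S_y$. A *grid drawing* is one with integer vertex coordinates; its *area* is the width times the height of its bounding box. **Theorem.** There are an algorithm and a constant $C$ such that the following holds. Let $H$ be a convex rectilinear representation of a biconnected plane graph with $n$ vertices, and let $\mathcal S_x$ and $\mathcal S_y$ be good $st$-orderings of $D_x$ and $D_y$. On input $H,\mathcal S_x,\mathcal S_y$ the algorithm halts after at most $C n^2$ steps and outputs a greedy grid drawing of $H$ that respects $\mathcal S_x$ and $\mathcal S_y$ and has minimum area among all greedy grid drawings of $H$ that respect $\mathcal S_x$ and $\mathcal S_y$ (in particular, such a drawing exists). Running time is measured on a random access machine with integer cells whose operations are constants, reading and writing array cells, addition, subtraction and comparison, each at unit cost. The input consists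 of $n$, the neighbours of each vertex in the four directions, and, for each vertex $u$, the positions of $c_x(u)$ in $\mathcal S_x$ and of $c_y(u)$ in $\mathcal S_y$; the output consists of the coordinates of each vertex. -/

import Mathlib

namespace GreedyRect

/-! ### Rectilinear representations -/

/-- The Euclidean plane; coordinate `0` is the `x`-coordinate, coordinate `1` the `y`-coordinate. -/
abbrev Plane : Type := EuclideanSpace ℝ (Fin 2)

/-- The four axis-parallel directions. -/
inductive Dir : Type
  | east
  | north
  | west
  | south

/-- The opposite direction. -/
def Dir.opp : Dir → Dir
  | .east => .west
  | .north => .south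
  | .west => .east
  | .south => .north

/-- A graph in which every edge carries an orientation: `nbr u d = some v` says that there is an
edge `uv` that leaves `u` in direction `d`. Such data determine the clockwise order of the edges
around each vertex and the angle (a multiple of 90 degrees) between consecutive edges. -/
structure Shape (V : Type*) where
  nbr : V → Dir → Option V
  nbr_opp : ∀ u v d, nbr u d = some v ↔ nbr v d.opp = some u

namespace Shape

variable {V : Type*} (H : Shape V)

/-- The underlying graph. -/
def graph : SimpleGraph V where
  Adj u v := u ≠ v ∧ ∃ d, H.nbr u d = some v
  symm := ⟨fun u v h => ⟨h.1.symm, h.2.elim fun d hd => ⟨d.opp, (H.nbr_opp u v d).1 hd⟩⟩⟩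
  loopless := ⟨fun _ h => h.1 rfl⟩

/-- `pos` is a planar rectilinear drawing: distinct vertices are distinct points, every edge is the
straight segment between its end-vertices and leaves them in the prescribed directions, and two
different edges meet only in common end-vertices. -/
structure IsDrawing (pos : V → Plane) : Prop where
  injective : Function.Injective pos
  horizontal : ∀ u v, H.nbr u .east = some v → pos u 0 < pos v 0 ∧ pos u 1 = pos v 1
  vertical : ∀ u v, H.nbr u .north = some v → pos u 0 = pos v 0 ∧ pos u 1 < pos v 1
  crossing_free : ∀ u v u₁ v₁, H.graph.Adj u v → H.graph.Adj u₁ v₁ → s(u, v) ≠ s(u₁, v₁) →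
    ∀ p ∈ segment ℝ (pos u) (pos v) ∩ segment ℝ (pos u₁) (pos v₁),
      ∃ w, (w = u ∨ w = v) ∧ (w = u₁ ∨ w = v₁) ∧ p = pos w

/-- The set of points covered by the vertices and the edges in the placement `pos`. -/
def carrier (pos : V → Plane) : Set Plane :=
  Set.range pos ∪ {p | ∃ u v, H.graph.Adj u v ∧ p ∈ segment ℝ (pos u) (pos v)}

/-- The face containing the point `p` (for `p` not covered by the drawing): a connected component
of the complement of the drawing. Internal faces are the bounded ones. -/
def face (pos : V → Plane) (p : Plane) : Set Plane :=
  connectedComponentIn (H.carrier pos)ᶜ p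

/-- The closed region delimited by the boundary of the external face: everything that does not
belong to the unbounded face. -/
def region (pos : V → Plane) : Set Plane :=
  {p | p ∈ H.carrier pos ∨ Bornology.IsBounded (H.face pos p)}

/-- Every internal face is a rectangle, and the polygon bounding the external face is orthoconvex,
that is, each horizontal or vertical line meets it in a (possibly empty) segment. -/
structure IsConvexDrawing (pos : V → Plane) : Prop where
  isDrawing : H.IsDrawing pos
  internal_rectangle : ∀ p ∉ H.carrier pos, Bornology.IsBounded (H.face pos p) →
    ∃ a b c d : ℝ, H.face pos p = {q | (a < q 0 ∧ q 0 < b) ∧ (c < q 1 ∧ q 1 < d)}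
  external_orthoconvex : ∀ (i : Fin 2) (c : ℝ), Convex ℝ (H.region pos ∩ {q | q i = c})

end Shape

/-- A rectilinear representation with fixed orientation of the edges, i.e. a (nonempty) class of
shape-equivalent planar rectilinear drawings. Its drawings are the `pos` with
`H.IsDrawing pos`. -/
structure RectRep (V : Type*) extends Shape V where
  realizable : ∃ pos : V → Plane, toShape.IsDrawing pos

/-- Every two vertices are joined by two internally disjoint paths. -/
def IsBiconnected {V : Type*} (G : SimpleGraph V) : Prop :=
  G.Connected ∧ ∀ u v, u ≠ v → ∃ p q : G.Walk u v, p.IsPath ∧ q.IsPath ∧ p ≠ q ∧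
    ∀ w, w ∈ p.support → w ∈ q.support → w = u ∨ w = v

namespace RectRep

variable {V : Type*} (H : RectRep V)

/-- `H` is convex: internal faces are rectangles and the external face is bounded by an orthoconvex
polygon. Both properties only depend on the angles of `H`, hence are the same for all drawings. -/
def IsConvex : Prop := ∃ pos : V → Plane, H.IsConvexDrawing pos

/-- Two vertices are equivalent if they lie on the same maximal path of edges of direction `c`
(vertical for `c = north`, horizontal for `c = east`). -/
def pathSetoid (c : Dir) : Setoid V := Relation.EqvGen.setoid fun u v => H.nbr u c = some v

/-- The maximal paths of edges of direction `c`. -/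
abbrev PathNode (c : Dir) : Type _ := Quotient (H.pathSetoid c)

/-- The digraph obtained by contracting each maximal path of edges of direction `c` and orienting
the remaining edges in direction `a`. -/
def dag (c a : Dir) : Digraph (H.PathNode c) where
  Adj A B := ∃ u v, Quotient.mk _ u = A ∧ Quotient.mk _ v = B ∧ H.nbr u a = some v

/-- `D_x`: contract vertical paths, orient horizontal edges from left to right. -/
abbrev Dx : Digraph (H.PathNode .north) := H.dag .north .east

/-- `D_y`: contract horizontal paths, orient vertical edges upwards. -/
abbrev Dy : Digraph (H.PathNode .east) := H.dag .east .north

/-- The node `c_x(u)` of `D_x`. -/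
def cx (u : V) : H.PathNode .north := Quotient.mk _ u

/-- The node `c_y(u)` of `D_y`. -/
def cy (u : V) : H.PathNode .east := Quotient.mk _ u

end RectRep

/-! ### Good st-orderings -/

/-- A linear order of the nodes of `D` (given by the position of each node) such that every arc
goes from an earlier to a later node. -/
structure StOrdering {N : Type*} (D : Digraph N) where
  length : ℕ
  index : N ≃ Fin length
  increasing : ∀ a b, D.Adj a b → index a < index b

namespace StOrdering

variable {N : Type*} {D : Digraph N} (S : StOrdering D)

/-- The (undirected graph underlying the) subgraph of `D` induced by the nodes at positions
`i, …, j`. -/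
def strip (i j : Fin S.length) : SimpleGraph {a : N // i ≤ S.index a ∧ S.index a ≤ j} :=
  (SimpleGraph.fromRel D.Adj).induce {a : N | i ≤ S.index a ∧ S.index a ≤ j}

/-- Each strip has at most two connected components, and if it has exactly two, then all nodes of
one component precede those of the other. -/
def IsGood : Prop :=
  ∀ i j : Fin S.length, i < j →
    Nat.card (S.strip i j).ConnectedComponent ≤ 2 ∧
    (Nat.card (S.strip i j).ConnectedComponent = 2 →
      ∃ C₁ C₂ : (S.strip i j).ConnectedComponent, C₁ ≠ C₂ ∧
        ∀ a ∈ C₁.supp, ∀ b ∈ C₂.supp, S.index a < S.index b)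

end StOrdering

/-! ### Greedy drawings respecting given orderings -/

/-- For every ordered pair of vertices there is a distance-decreasing path. -/
def IsGreedy {V : Type*} (G : SimpleGraph V) (pos : V → Plane) : Prop :=
  ∀ u v, ∃ p : G.Walk u v, p.IsPath ∧
    ∀ i < p.length, dist (pos (p.getVert (i + 1))) (pos v) < dist (pos (p.getVert i)) (pos v)

/-- `u` lies to the left of (below) `w` iff `c_x(u)` precedes `c_x(w)` in `Sx`
(`c_y(u)` precedes `c_y(w)` in `Sy`). -/
def Respects {V : Type*} (H : RectRep V) (Sx : StOrdering H.Dx) (Sy : StOrdering H.Dy)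
    (pos : V → Plane) : Prop :=
  ∀ u w, (pos u 0 < pos w 0 ↔ Sx.index (H.cx u) < Sx.index (H.cx w)) ∧
    (pos u 1 < pos w 1 ↔ Sy.index (H.cy u) < Sy.index (H.cy w))

/-- The placement on the integer grid with the given coordinates. -/
noncomputable def gridPos {V : Type*} (X Y : V → ℤ) (v : V) : Plane := !₂[(X v : ℝ), (Y v : ℝ)]

/-- The integer coordinates `X`, `Y` define a greedy drawing of `H` respecting `Sx` and `Sy`. -/
def IsGreedyGridDrawing {V : Type*} (H : RectRep V) (Sx : StOrdering H.Dx) (Sy : StOrdering H.Dy)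
    (X Y : V → ℤ) : Prop :=
  H.IsDrawing (gridPos X Y) ∧ IsGreedy H.graph (gridPos X Y) ∧ Respects H Sx Sy (gridPos X Y)

/-- Area (width times height) of the bounding box of a grid placement of finitely many vertices. -/
noncomputable def area {V : Type*} (X Y : V → ℤ) : ℤ :=
  ((⨆ v, X v) - ⨅ v, X v) * ((⨆ v, Y v) - ⨅ v, Y v)

/-- `X`, `Y` is of minimum area among all greedy grid drawings of `H` respecting `Sx` and `Sy`. -/
def IsMinAreaGreedyGridDrawing {V : Type*} (H : RectRep V) (Sx : StOrdering H.Dx)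
    (Sy : StOrdering H.Dy) (X Y : V → ℤ) : Prop :=
  IsGreedyGridDrawing H Sx Sy X Y ∧
    ∀ X₁ Y₁ : V → ℤ, IsGreedyGridDrawing H Sx Sy X₁ Y₁ → area X Y ≤ area X₁ Y₁

/-! ### A random access machine with unit cost

The memory consists of arrays numbered by naturals (a program mentions only finitely many of them),
whose cells are addressed by integers and hold integers. The arithmetic operations are addition and
subtraction, the only test is the comparison of two integers. -/

namespace RAM

abbrev Store : Type := ℕ → ℤ → ℤ

/-- Constants, indirect reads `a[i]`, sums and differences. -/
inductive Expr : Type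
  | const (c : ℤ)
  | read (a : ℕ) (i : Expr)
  | add (e f : Expr)
  | sub (e f : Expr)

def Expr.eval (s : Store) : Expr → ℤ
  | .const c => c
  | .read a i => s a (i.eval s)
  | .add e f => e.eval s + f.eval s
  | .sub e f => e.eval s - f.eval s

/-- Each constant, memory access and arithmetic operation costs one step. -/
def Expr.cost : Expr → ℕ
  | .const _ => 1
  | .read _ i => i.cost + 1
  | .add e f => e.cost + f.cost + 1
  | .sub e f => e.cost + f.cost + 1

/-- Programs: `write a i e` is the assignment `a[i] := e`; `ifLe e f c d` runs `c` if `e ≤ f` and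
`d` otherwise; `whileLe e f c` repeats `c` as long as `e ≤ f`. -/
inductive Cmd : Type
  | skip
  | write (a : ℕ) (i e : Expr)
  | seq (c d : Cmd)
  | ifLe (e f : Expr) (c d : Cmd)
  | whileLe (e f : Expr) (c : Cmd)

/-- `Exec c s t s'`: started in memory `s`, the program `c` halts after `t` steps in memory
`s'`. -/
inductive Exec : Cmd → Store → ℕ → Store → Prop
  | skip (s : Store) : Exec .skip s 1 s
  | write (a : ℕ) (i e : Expr) (s : Store) :
      Exec (.write a i e) s (i.cost + e.cost + 1)
        (Function.update s a (Function.update (s a) (i.eval s) (e.eval s)))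
  | seq {c d : Cmd} {s s₁ s₂ : Store} {t₁ t₂ : ℕ} :
      Exec c s t₁ s₁ → Exec d s₁ t₂ s₂ → Exec (.seq c d) s (t₁ + t₂) s₂
  | if_true {e f : Expr} {c d : Cmd} {s s₁ : Store} {t : ℕ} :
      e.eval s ≤ f.eval s → Exec c s t s₁ →
        Exec (.ifLe e f c d) s (e.cost + f.cost + 1 + t) s₁
  | if_false {e f : Expr} {c d : Cmd} {s s₁ : Store} {t : ℕ} :
      ¬ e.eval s ≤ f.eval s → Exec d s t s₁ →
        Exec (.ifLe e f c d) s (e.cost + f.cost + 1 + t) s₁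
  | while_true {e f : Expr} {c : Cmd} {s s₁ s₂ : Store} {t₁ t₂ : ℕ} :
      e.eval s ≤ f.eval s → Exec c s t₁ s₁ → Exec (.whileLe e f c) s₁ t₂ s₂ →
        Exec (.whileLe e f c) s (e.cost + f.cost + 1 + t₁ + t₂) s₂
  | while_false {e f : Expr} {c : Cmd} {s : Store} :
      ¬ e.eval s ≤ f.eval s → Exec (.whileLe e f c) s (e.cost + f.cost + 1) s

end RAM

/-! ### Input and output of the algorithm -/

/-- Array with entries `f 0, …, f (n - 1)`; all other cells are `0`. -/
def cells {n : ℕ} (f : Fin n → ℤ) (i : ℤ) : ℤ :=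
  if h : i.toNat < n then (if 0 ≤ i then f ⟨i.toNat, h⟩ else 0) else 0

/-- Pointer to a vertex; `-1` for no vertex. -/
def pointer {n : ℕ} : Option (Fin n) → ℤ
  | some v => (v.val : ℤ)
  | none => -1

/-- The input: the number `n` of vertices in cell `0` of array `0`; for each vertex its right, upper,
left and lower neighbour in the arrays `1, 2, 3, 4`; for each vertex `v` the position of `c_x(v)` in
`Sx` and of `c_y(v)` in `Sy` in the arrays `5, 6`. All other cells are `0`. -/
def inputStore {n : ℕ} (H : RectRep (Fin n)) (Sx : StOrdering H.Dx) (Sy : StOrdering H.Dy) :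
    RAM.Store
  | 0 => fun i => if i = 0 then (n : ℤ) else 0
  | 1 => cells fun v => pointer (H.nbr v .east)
  | 2 => cells fun v => pointer (H.nbr v .north)
  | 3 => cells fun v => pointer (H.nbr v .west)
  | 4 => cells fun v => pointer (H.nbr v .south)
  | 5 => cells fun v => ((Sx.index (H.cx v)).val : ℤ)
  | 6 => cells fun v => ((Sy.index (H.cy v)).val : ℤ)
  | _ => fun _ => 0

/-- The output: the `x`- and `y`-coordinates of the vertices are read from the arrays `7` and `8`. -/
def outputX {n : ℕ} (s : RAM.Store) (v : Fin n) : ℤ := s 7 v.val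

def outputY {n : ℕ} (s : RAM.Store) (v : Fin n) : ℤ := s 8 v.val

end GreedyRect

open GreedyRect

/-! Call the maximal vertical paths columns and the maximal horizontal paths rows, numbered by the
two orderings. For consecutive columns k and k + 1 let ρ(k) be the nearest column joined to k by an
edge to the right, and l(k+1) the nearest column joined to k + 1 by an edge to the left. The heart
of the proof is that a drawing respecting good orderings is greedy exactly if, for every k, the gap
between columns k and k + 1 exceeds both the distance from k + 1 to ρ(k) and the distance from k to
l(k+1), and likewise for rows. This condition is `Adapted`; it treats the axes separately, so width
and height can be minimized independently.

Necessity (`gap_of_path`): a distance-decreasing path from column k to a vertex of column k + 1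
cannot step to the left while it is in column k, so it leaves that column by an edge to the right
whose far end is closer to the target column than k is. Sufficiency (`exists_closer`): if v comes
after u in both orderings, then some right or upper neighbour of u is closer to v. A neighbour that
does not pass v works. If the right neighbour passes v, then either the upper neighbour does not
pass it (`not_between`), or there is no upper neighbour, and goodness produces a column before v
with no nearer right neighbour than that of u, so that its gap condition makes the right neighbour
of u closer (`closer_right`). The geometric input consists of comparisons of columns and rows, by
sweeping through rectangular faces (`lt_of_right`) and walking through quadrants (`lt_or_lt`,
`corner`).

By integrality each gap must be at least 1 plus the larger of two sums of other gaps, namely those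
strictly between k + 1 and ρ(k) and those strictly between l(k+1) and k. Goodness makes this
dependence acyclic (`exists_independent`): two gaps that depend on each other would isolate the
columns between them from both ends of a strip. Hence a least solution exists. Recomputing all gaps
from the previous coordinates settles at least one further gap per round, so n rounds of linear time
suffice. Any placement with the same orders is planar (`isDrawing_of_adapted`), so the least
solution is a greedy drawing, and its width and height are both minimal. -/

namespace GreedyRect

open Relation Set

/-! ### Layouts and their symmetries -/

/-- Combinatorial and metric data of a rectilinear drawing: right and upper neighbours, coordinates
`x`, `y`, numbers `f`, `g` of the columns and rows, and the region covered by the drawing and its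
internal faces. -/
structure Layout (V : Type*) where
  E : V → V → Prop
  N : V → V → Prop
  x : V → ℝ
  y : V → ℝ
  f : V → ℤ
  g : V → ℤ
  reg : ℝ → ℝ → Prop

namespace Layout

variable {V : Type*}

/-- The point `(a, b)` lies on a vertex or a vertical edge of the column numbered `φ`. -/
def OnV (C : Layout V) (a b : ℝ) (φ : ℤ) : Prop :=
  ∃ u v, (u = v ∨ C.N u v) ∧ C.x u = a ∧ C.y u ≤ b ∧ b ≤ C.y v ∧ C.f u = φ

/-- The point `(a, b)` lies on a vertex or a horizontal edge of the row numbered `γ`. -/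
def OnH (C : Layout V) (a b : ℝ) (γ : ℤ) : Prop :=
  ∃ u v, (u = v ∨ C.E u v) ∧ C.y u = b ∧ C.x u ≤ a ∧ a ≤ C.x v ∧ C.g u = γ

/-- The point `(a, b)` is covered by the drawing. -/
def Car (C : Layout V) (a b : ℝ) : Prop := (∃ φ, C.OnV a b φ) ∨ ∃ γ, C.OnH a b γ

/-- The properties of a convex drawing that do not mention the topology of the plane. -/
structure Valid (C : Layout V) : Prop where
  E_x : ∀ {u v}, C.E u v → C.x u < C.x v
  E_y : ∀ {u v}, C.E u v → C.y u = C.y v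
  E_f : ∀ {u v}, C.E u v → C.f u < C.f v
  E_g : ∀ {u v}, C.E u v → C.g u = C.g v
  N_x : ∀ {u v}, C.N u v → C.x u = C.x v
  N_y : ∀ {u v}, C.N u v → C.y u < C.y v
  N_f : ∀ {u v}, C.N u v → C.f u = C.f v
  N_g : ∀ {u v}, C.N u v → C.g u < C.g v
  E_fun : ∀ {u v w}, C.E u v → C.E u w → v = w
  E_inj : ∀ {u v w}, C.E v u → C.E w u → v = w
  N_fun : ∀ {u v w}, C.N u v → C.N u w → v = w
  N_inj : ∀ {u v w}, C.N v u → C.N w u → v = w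
  inj : ∀ {u v}, C.x u = C.x v → C.y u = C.y v → u = v
  meet : ∀ {u w a b}, C.E u w → C.N a b → C.x u ≤ C.x a → C.x a ≤ C.x w → C.y a ≤ C.y u →
    C.y u ≤ C.y b → ∃ z, (z = u ∨ z = w) ∧ (z = a ∨ z = b)
  vtxV : ∀ {z a b}, C.N a b → C.x z = C.x a → C.y a ≤ C.y z → C.y z ≤ C.y b → z = a ∨ z = b
  vtxH : ∀ {z a b}, C.E a b → C.y z = C.y a → C.x a ≤ C.x z → C.x z ≤ C.x b → z = a ∨ z = b
  uniqV : ∀ {a b φ φ'}, C.OnV a b φ → C.OnV a b φ' → φ = φ'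
  uniqH : ∀ {a b γ γ'}, C.OnH a b γ → C.OnH a b γ' → γ = γ'
  col : ∀ {u v}, C.f u = C.f v → ReflTransGen C.N u v ∨ ReflTransGen C.N v u
  row : ∀ {u v}, C.g u = C.g v → ReflTransGen C.E u v ∨ ReflTransGen C.E v u
  conn : ∀ u v, ReflTransGen (fun a b => C.E a b ∨ C.E b a ∨ C.N a b ∨ C.N b a) u v
  convH : ∀ {a b c t}, C.reg a t → C.reg b t → a ≤ c → c ≤ b → C.reg c t
  convV : ∀ {a b c s}, C.reg s a → C.reg s b → a ≤ c → c ≤ b → C.reg s c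
  car_reg : ∀ {a b}, C.Car a b → C.reg a b
  rect : ∀ {p q}, C.reg p q → ¬ C.Car p q → ∃ a b c d, a < p ∧ p < b ∧ c < q ∧ q < d ∧
    (∀ s t, a < s → s < b → c < t → t < d → ¬ C.Car s t) ∧
    (∀ s t, a ≤ s → s ≤ b → c ≤ t → t ≤ d → (s = a ∨ s = b ∨ t = c ∨ t = d) → C.Car s t)

/-- Reflection at the diagonal. -/
def transpose (C : Layout V) : Layout V where
  E := C.N
  N := C.E
  x := C.y
  y := C.x
  f := C.g
  g := C.f
  reg a b := C.reg b a

/-- Reflection at the `y`-axis. -/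
def reflect (C : Layout V) : Layout V where
  E u v := C.E v u
  N := C.N
  x u := -C.x u
  y := C.y
  f u := -C.f u
  g := C.g
  reg a b := C.reg (-a) b

theorem transpose_onV (C : Layout V) (a b : ℝ) (φ : ℤ) : C.transpose.OnV a b φ ↔ C.OnH b a φ :=
  Iff.rfl

theorem transpose_car (C : Layout V) (a b : ℝ) : C.transpose.Car a b ↔ C.Car b a :=
  Or.comm

theorem reflect_onV {C : Layout V} (a b : ℝ) (φ : ℤ) :
    C.reflect.OnV a b φ ↔ C.OnV (-a) b (-φ) := by
  constructor
  · rintro ⟨u, v, h, h1, h2, h3, h4⟩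
    exact ⟨u, v, h, by simp [← h1, reflect], h2, h3, by simp [← h4, reflect]⟩
  · rintro ⟨u, v, h, h1, h2, h3, h4⟩
    exact ⟨u, v, h, by simp [h1, reflect], h2, h3, by simp [h4, reflect]⟩

theorem reflect_onH {C : Layout V} (hC : C.Valid) (a b : ℝ) (γ : ℤ) :
    C.reflect.OnH a b γ ↔ C.OnH (-a) b γ := by
  constructor
  · rintro ⟨u, v, h, h1, h2, h3, h4⟩
    simp only [reflect] at *
    rcases h with rfl | h
    · exact ⟨u, u, .inl rfl, h1, by linarith, by linarith, h4⟩
    · exact ⟨v, u, .inr h, (hC.E_y h).trans h1, by linarith, by linarith, (hC.E_g h).trans h4⟩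
  · rintro ⟨u, v, h, h1, h2, h3, h4⟩
    rcases h with rfl | h
    · exact ⟨u, u, .inl rfl, h1, by simp only [reflect]; linarith,
        by simp only [reflect]; linarith, h4⟩
    · exact ⟨v, u, .inr h, (hC.E_y h).symm.trans h1, by simp only [reflect]; linarith,
        by simp only [reflect]; linarith, (hC.E_g h).symm.trans h4⟩

theorem reflect_car {C : Layout V} (hC : C.Valid) (a b : ℝ) :
    C.reflect.Car a b ↔ C.Car (-a) b := by
  simp only [Car, reflect_onV, reflect_onH hC]
  refine or_congr ⟨fun ⟨φ, h⟩ => ⟨_, h⟩, fun ⟨φ, h⟩ => ⟨-φ, by simpa using h⟩⟩ Iff.rfl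

/-- Together with `Valid.reflect` this gives all symmetries of the square, so that each geometric
fact has to be proved for one side or one quadrant only. -/
theorem Valid.transpose {C : Layout V} (hC : C.Valid) : C.transpose.Valid where
  E_x := hC.N_y
  E_y := hC.N_x
  E_f := hC.N_g
  E_g := hC.N_f
  N_x := hC.E_y
  N_y := hC.E_x
  N_f := hC.E_g
  N_g := hC.E_f
  E_fun := hC.N_fun
  E_inj := hC.N_inj
  N_fun := hC.E_fun
  N_inj := hC.E_inj
  inj h h' := hC.inj h' h
  meet := fun {u w a b} hE hN h1 h2 h3 h4 => by
    obtain ⟨z, hz, hz'⟩ := hC.meet (u := a) (w := b) (a := u) (b := w) hN hE h3 h4 h1 h2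
    exact ⟨z, hz', hz⟩
  vtxV := hC.vtxH
  vtxH := hC.vtxV
  uniqV := hC.uniqH
  uniqH := hC.uniqV
  col := hC.row
  row := hC.col
  conn u v := ReflTransGen.mono (fun a b h => by simp only [Layout.transpose]; tauto) u v (hC.conn u v)
  convH := hC.convV
  convV := hC.convH
  car_reg h := hC.car_reg ((transpose_car C _ _).1 h)
  rect := fun {p q} h h' => by
    obtain ⟨a, b, c, d, h1, h2, h3, h4, h5, h6⟩ :=
      hC.rect (p := q) (q := p) h fun h'' => h' ((transpose_car C _ _).2 h'')
    refine ⟨c, d, a, b, h3, h4, h1, h2, fun s t i1 i2 i3 i4 i => ?_,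
      fun s t i1 i2 i3 i4 i => ?_⟩
    · exact h5 t s i3 i4 i1 i2 ((transpose_car C _ _).1 i)
    · exact (transpose_car C _ _).2 (h6 t s i3 i4 i1 i2 (by tauto))

theorem Valid.reflect {C : Layout V} (hC : C.Valid) : C.reflect.Valid where
  E_x h := neg_lt_neg (hC.E_x h)
  E_y h := (hC.E_y h).symm
  E_f h := neg_lt_neg (hC.E_f h)
  E_g h := (hC.E_g h).symm
  N_x h := by simp only [Layout.reflect]; rw [hC.N_x h]
  N_y := hC.N_y
  N_f h := by simp only [Layout.reflect]; rw [hC.N_f h]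
  N_g := hC.N_g
  E_fun := hC.E_inj
  E_inj := hC.E_fun
  N_fun := hC.N_fun
  N_inj := hC.N_inj
  inj h h' := hC.inj (neg_injective h) h'
  meet := fun {u w a b} hE hN h1 h2 h3 h4 => by
    simp only [Layout.reflect, neg_le_neg_iff] at *
    obtain ⟨z, hz, hz'⟩ := hC.meet hE hN h2 h1 (by rwa [hC.E_y hE]) (by rwa [hC.E_y hE])
    exact ⟨z, hz.symm, hz'⟩
  vtxV h h1 h2 h3 := hC.vtxV h (neg_injective h1) h2 h3
  vtxH := fun {z a b} h h1 h2 h3 => by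
    simp only [Layout.reflect, neg_le_neg_iff] at *
    exact (hC.vtxH h (h1.trans (hC.E_y h).symm) h3 h2).symm
  uniqV h h' := neg_injective (hC.uniqV ((reflect_onV _ _ _).1 h) ((reflect_onV _ _ _).1 h'))
  uniqH h h' := hC.uniqH ((reflect_onH hC _ _ _).1 h) ((reflect_onH hC _ _ _).1 h')
  col h := hC.col (neg_injective h)
  row h := (hC.row h).symm.imp reflTransGen_swap.2 reflTransGen_swap.2
  conn u v := ReflTransGen.mono (fun a b h => by simp only [Layout.reflect]; tauto) u v (hC.conn u v)
  convH h h' h1 h2 := hC.convH h' h (neg_le_neg h2) (neg_le_neg h1)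
  convV h h' h1 h2 := hC.convV h h' h1 h2
  car_reg h := hC.car_reg ((reflect_car hC _ _).1 h)
  rect := fun {p q} h h' => by
    obtain ⟨a, b, c, d, h1, h2, h3, h4, h5, h6⟩ :=
      hC.rect (p := -p) (q := q) h fun h'' => h' ((reflect_car hC _ _).2 h'')
    refine ⟨-b, -a, c, d, by linarith, by linarith, h3, h4, fun s t i1 i2 i3 i4 i => ?_,
      fun s t i1 i2 i3 i4 i => ?_⟩
    · exact h5 (-s) t (by linarith) (by linarith) i3 i4 ((reflect_car hC _ _).1 i)
    · refine (reflect_car hC _ _).2 (h6 (-s) t (by linarith) (by linarith) i3 i4 ?_)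
      rcases i with rfl | rfl | rfl | rfl <;> simp

theorem onV_vertex (C : Layout V) (u : V) : C.OnV (C.x u) (C.y u) (C.f u) :=
  ⟨u, u, .inl rfl, rfl, le_rfl, le_rfl, rfl⟩

theorem onH_vertex (C : Layout V) (u : V) : C.OnH (C.x u) (C.y u) (C.g u) :=
  ⟨u, u, .inl rfl, rfl, le_rfl, le_rfl, rfl⟩

theorem car_vertex (C : Layout V) (u : V) : C.Car (C.x u) (C.y u) := .inl ⟨_, C.onV_vertex u⟩

end Layout
end GreedyRect

/-! ### Rectangular faces and columns that see each other -/

namespace GreedyRect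

open Relation Set

namespace Layout

variable {V : Type*} {C : Layout V}

theorem onV_edge (C : Layout V) {u v : V} (h : C.N u v) {t : ℝ} (h1 : C.y u ≤ t)
    (h2 : t ≤ C.y v) : C.OnV (C.x u) t (C.f u) :=
  ⟨u, v, .inr h, rfl, h1, h2, rfl⟩

theorem onH_edge (C : Layout V) {u v : V} (h : C.E u v) {t : ℝ} (h1 : C.x u ≤ t)
    (h2 : t ≤ C.x v) : C.OnH t (C.y u) (C.g u) :=
  ⟨u, v, .inr h, rfl, h1, h2, rfl⟩

/-- A point on a column and on a row is a vertex. -/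
theorem Valid.exists_vertex (hC : C.Valid) {a b : ℝ} {φ γ : ℤ} (hV : C.OnV a b φ)
    (hH : C.OnH a b γ) : ∃ z, C.x z = a ∧ C.y z = b ∧ C.f z = φ ∧ C.g z = γ := by
  have key : ∃ z, C.x z = a ∧ C.y z = b := by
    obtain ⟨p, q, hpq, h1, h2, h3, h4⟩ := hV
    obtain ⟨u, v, huv, i1, i2, i3, i4⟩ := hH
    rcases hpq with rfl | hpq
    · exact ⟨p, h1, le_antisymm h2 h3⟩
    rcases huv with rfl | huv
    · exact ⟨u, le_antisymm i2 i3, i1⟩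
    obtain ⟨z, hz, hz'⟩ := hC.meet huv hpq (by rwa [h1]) (by rwa [h1]) (by rwa [i1]) (by rwa [i1])
    refine ⟨z, ?_, ?_⟩
    · rcases hz' with rfl | rfl
      · exact h1
      · rw [← hC.N_x hpq, h1]
    · rcases hz with rfl | rfl
      · exact i1
      · rw [← hC.E_y huv, i1]
  obtain ⟨z, rfl, rfl⟩ := key
  exact ⟨z, rfl, rfl, hC.uniqV (C.onV_vertex z) hV, hC.uniqH (C.onH_vertex z) hH⟩

/-- The left side of an empty box whose boundary is covered belongs to a single column. -/
theorem Valid.left_side [Finite V] (hC : C.Valid) {a b c d : ℝ} (hab : a < b) (hcd : c < d)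
    (hin : ∀ s t, a < s → s < b → c < t → t < d → ¬ C.Car s t)
    (hbd : ∀ t, c ≤ t → t ≤ d → C.Car a t) : ∃ φ, ∀ t, c ≤ t → t ≤ d → C.OnV a t φ := by
  have h1 : ∀ t, c < t → t < d → ∃ φ, C.OnV a t φ := by
    intro t ht ht'
    rcases hbd t ht.le ht'.le with h | ⟨γ, u, v, huv, i1, i2, i3, i4⟩
    · exact h
    rcases huv with rfl | huv
    · exact ⟨_, u, u, .inl rfl, le_antisymm i2 i3, i1.le, i1.ge, rfl⟩
    rcases i3.eq_or_lt with rfl | i3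
    · exact ⟨_, v, v, .inl rfl, rfl, by rw [← hC.E_y huv, i1], by rw [← hC.E_y huv, i1], rfl⟩
    -- A horizontal edge that does not end on the line would continue into the box, which is empty.
    · exfalso
      refine hin (min (C.x v) ((a + b) / 2)) t (lt_min i3 (by linarith))
        ((min_le_right _ _).trans_lt (by linarith)) ht ht' (.inr ⟨_, i1 ▸ C.onH_edge huv ?_ ?_⟩)
      · exact le_min (i2.trans i3.le) (by linarith)
      · exact min_le_left _ _
  obtain ⟨φ, hφ⟩ := h1 ((c + d) / 2) (by linarith) (by linarith)
  refine ⟨φ, ?_⟩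
  -- The part of the side on columns with a given property is a finite union of closed intervals.
  -- Points of different columns are distinct, so connectedness leaves a single column on the open
  -- side; the corners follow by closure.
  have hcl : ∀ Q : V → Prop, IsClosed {t | ∃ u v, ((u = v ∨ C.N u v) ∧ C.x u = a ∧ Q u) ∧
      t ∈ Icc (C.y u) (C.y v)} := by
    intro Q
    have : {t | ∃ u v, ((u = v ∨ C.N u v) ∧ C.x u = a ∧ Q u) ∧ t ∈ Icc (C.y u) (C.y v)} =
      ⋃ u, ⋃ v, ⋃ _ : (u = v ∨ C.N u v) ∧ C.x u = a ∧ Q u, Icc (C.y u) (C.y v) := by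
      ext t; simp only [mem_ofPred_eq, mem_iUnion, exists_prop]
    rw [this]
    exact isClosed_iUnion_of_finite fun u => isClosed_iUnion_of_finite fun v =>
      isClosed_iUnion_of_finite fun _ => isClosed_Icc
  have hsub : Ioo c d ⊆ {t | ∃ u v, ((u = v ∨ C.N u v) ∧ C.x u = a ∧ C.f u = φ) ∧
      t ∈ Icc (C.y u) (C.y v)} := by
    intro t ht
    by_contra hcon
    have hun : Ioo c d ⊆ {t | ∃ u v, ((u = v ∨ C.N u v) ∧ C.x u = a ∧ C.f u = φ) ∧
      t ∈ Icc (C.y u) (C.y v)} ∪ {t | ∃ u v, ((u = v ∨ C.N u v) ∧ C.x u = a ∧ C.f u ≠ φ) ∧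
      t ∈ Icc (C.y u) (C.y v)} := by
      intro s hs
      obtain ⟨ψ, u, v, h, h2, h3, h4, h5⟩ := h1 s hs.1 hs.2
      by_cases hψ : C.f u = φ
      · exact .inl ⟨u, v, ⟨h, h2, hψ⟩, h3, h4⟩
      · exact .inr ⟨u, v, ⟨h, h2, hψ⟩, h3, h4⟩
    have := isPreconnected_closed_iff.1 (isPreconnected_Ioo (a := c) (b := d)) _ _ (hcl _) (hcl _) hun
    obtain ⟨s, hs, ⟨u, v, ⟨h, h2, h5⟩, h3, h4⟩, ⟨u', v', ⟨h', h2', h5'⟩, h3', h4'⟩⟩ := this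
      (by
        obtain ⟨u, v, h, h2, h3, h4, h5⟩ := hφ
        exact ⟨(c + d) / 2, ⟨by linarith, by linarith⟩, u, v, ⟨h, h2, h5⟩, h3, h4⟩)
      ⟨t, ht, (hun ht).resolve_left hcon⟩
    exact h5' ((hC.uniqV ⟨u', v', h', h2', h3', h4', rfl⟩ ⟨u, v, h, h2, h3, h4, h5⟩))
  intro t ht ht'
  have := closure_minimal hsub (hcl _)
  rw [closure_Ioo hcd.ne] at this
  obtain ⟨u, v, ⟨h, h2, h5⟩, h3, h4⟩ := this ⟨ht, ht'⟩
  exact ⟨u, v, h, h2, h3, h4, h5⟩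

/-- A point of the region that is not covered lies in an empty box whose sides belong to columns
and rows and whose corners are vertices. -/
theorem Valid.box [Finite V] (hC : C.Valid) {p q : ℝ} (hr : C.reg p q) (hcar : ¬ C.Car p q) :
    ∃ z₀ z₁ z₂ z₃, C.x z₀ < p ∧ p < C.x z₃ ∧ C.y z₀ < q ∧ q < C.y z₃ ∧
      C.x z₂ = C.x z₀ ∧ C.x z₁ = C.x z₃ ∧ C.y z₁ = C.y z₀ ∧ C.y z₂ = C.y z₃ ∧
      C.f z₂ = C.f z₀ ∧ C.f z₁ = C.f z₃ ∧ C.g z₁ = C.g z₀ ∧ C.g z₂ = C.g z₃ ∧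
      (∀ s t, C.x z₀ < s → s < C.x z₃ → C.y z₀ < t → t < C.y z₃ → ¬ C.Car s t) ∧
      (∀ t, C.y z₀ ≤ t → t ≤ C.y z₃ → C.OnV (C.x z₀) t (C.f z₀) ∧ C.OnV (C.x z₃) t (C.f z₃)) ∧
      (∀ s, C.x z₀ ≤ s → s ≤ C.x z₃ → C.OnH s (C.y z₀) (C.g z₀) ∧ C.OnH s (C.y z₃) (C.g z₃)) := by
  obtain ⟨a, b, c, d, h1, h2, h3, h4, hin, hbd⟩ := hC.rect hr hcar
  have hab := h1.trans h2
  have hcd := h3.trans h4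
  obtain ⟨φ₀, hφ₀⟩ := hC.left_side hab hcd hin
    fun t ht ht' => hbd a t le_rfl hab.le ht ht' (by simp)
  -- The other three sides are left sides after a symmetry. Reflection negates the numbers, whence
  -- the signs of `φ₁` and `γ₁`.
  obtain ⟨γ₀, hγ₀⟩ := hC.transpose.left_side hcd hab
    (fun s t i1 i2 i3 i4 i => hin t s i3 i4 i1 i2 ((transpose_car C _ _).1 i))
    fun t ht ht' => (transpose_car C _ _).2 (hbd t c ht ht' le_rfl hcd.le (by simp))
  obtain ⟨φ₁, hφ₁⟩ := hC.reflect.left_side (a := -b) (b := -a) (by linarith) hcd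
    (fun s t i1 i2 i3 i4 i => hin (-s) t (by linarith) (by linarith) i3 i4
      ((reflect_car hC _ _).1 i))
    fun t ht ht' => (reflect_car hC _ _).2 (hbd (- -b) t (by linarith) (by linarith) ht ht'
      (by simp))
  obtain ⟨γ₁, hγ₁⟩ := hC.transpose.reflect.left_side (a := -d) (b := -c) (by linarith) hab
    (fun s t i1 i2 i3 i4 i => hin t (-s) i3 i4 (by linarith) (by linarith)
      ((transpose_car C _ _).1 ((reflect_car hC.transpose _ _).1 i)))
    fun t ht ht' => (reflect_car hC.transpose _ _).2 ((transpose_car C _ _).2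
      (hbd t (- -d) ht ht' (by linarith) (by linarith) (by simp)))
  replace hφ₁ : ∀ t, c ≤ t → t ≤ d → C.OnV b t (-φ₁) := fun t ht ht' => by
    simpa using (reflect_onV _ _ _).1 (hφ₁ t ht ht')
  replace hγ₁ : ∀ s, a ≤ s → s ≤ b → C.OnH s d (-γ₁) := fun t ht ht' => by
    simpa using (transpose_onV C _ _ _).1 ((reflect_onV _ _ _).1 (hγ₁ t ht ht'))
  replace hγ₀ : ∀ s, a ≤ s → s ≤ b → C.OnH s c γ₀ := hγ₀
  obtain ⟨z₀, x0, y0, f0, g0⟩ := hC.exists_vertex (hφ₀ c le_rfl hcd.le) (hγ₀ a le_rfl hab.le)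
  obtain ⟨z₁, x1, y1, f1, g1⟩ := hC.exists_vertex (hφ₁ c le_rfl hcd.le) (hγ₀ b hab.le le_rfl)
  obtain ⟨z₂, x2, y2, f2, g2⟩ := hC.exists_vertex (hφ₀ d hcd.le le_rfl) (hγ₁ a le_rfl hab.le)
  obtain ⟨z₃, x3, y3, f3, g3⟩ := hC.exists_vertex (hφ₁ d hcd.le le_rfl) (hγ₁ b hab.le le_rfl)
  refine ⟨z₀, z₁, z₂, z₃, ?_⟩
  rw [x0, x1, x2, x3, y0, y1, y2, y3, f0, f1, f2, f3, g0, g1, g2, g3]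
  exact ⟨h1, h2, h3, h4, rfl, rfl, rfl, rfl, rfl, rfl, rfl, rfl, hin,
    fun t h h' => ⟨hφ₀ t h h', hφ₁ t h h'⟩, fun t h h' => ⟨hγ₀ t h h', hγ₁ t h h'⟩⟩

theorem Valid.chain_x (hC : C.Valid) {u v : V} (h : ReflTransGen C.E u v) :
    C.x u ≤ C.x v ∧ C.f u ≤ C.f v ∧ C.y u = C.y v ∧ C.g u = C.g v := by
  induction h with
  | refl => simp
  | tail _ h ih =>
    exact ⟨ih.1.trans (hC.E_x h).le, ih.2.1.trans (hC.E_f h).le, ih.2.2.1.trans (hC.E_y h),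
      ih.2.2.2.trans (hC.E_g h)⟩

/-- In a row, a vertex that has another vertex to its right has a right neighbour. -/
theorem Valid.row_step (hC : C.Valid) {u v : V} (hg : C.g u = C.g v) (hx : C.x u < C.x v) :
    ∃ w, C.E u w ∧ ReflTransGen C.E w v := by
  rcases hC.row hg with h | h
  · rcases h.cases_head with rfl | ⟨w, h, h'⟩
    · exact absurd hx (lt_irrefl _)
    · exact ⟨w, h, h'⟩
  · exact absurd (hC.chain_x h).1 (not_le.2 hx)

theorem Valid.row_step_f (hC : C.Valid) {u v : V} (hg : C.g u = C.g v) (hf : C.f u < C.f v) :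
    ∃ w, C.E u w ∧ ReflTransGen C.E w v := by
  rcases hC.row hg with h | h
  · rcases h.cases_head with rfl | ⟨w, h, h'⟩
    · exact absurd hf (lt_irrefl _)
    · exact ⟨w, h, h'⟩
  · exact absurd (hC.chain_x h).2.1 (not_le.2 hf)

theorem Valid.row_lt (hC : C.Valid) {u v : V} (hg : C.g u = C.g v) (hx : C.x u < C.x v) :
    C.f u < C.f v := by
  obtain ⟨w, h, h'⟩ := hC.row_step hg hx
  exact (hC.E_f h).trans_le (hC.chain_x h').2.1

/-- If a point of a column sees a point of another column to its right, the columns are ordered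
accordingly, and the left one has a right neighbour. -/
theorem Valid.lt_of_right [Finite V] (hC : C.Valid) {a a' t : ℝ} {φ φ' : ℤ} (h : C.OnV a t φ)
    (h' : C.OnV a' t φ') (haa' : a < a') : φ < φ' ∧ ∃ z w, C.f z = φ ∧ C.E z w := by
  classical
  have := Fintype.ofFinite V
  induction hn : (Finset.univ.filter fun z => a < C.x z ∧ C.x z ≤ a').card
    using Nat.strong_induction_on generalizing a φ with
  | _ n ih =>
  -- Sweeping to the right at height `t`, one reaches a later column at a vertex abscissa `s ≤ a'`;
  -- the induction is on the number of vertices whose abscissa lies between.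
  have step : ∃ s ψ, a < s ∧ s ≤ a' ∧ (∃ z, C.x z = s) ∧ C.OnV s t ψ ∧ φ < ψ ∧
      ∃ z w, C.f z = φ ∧ C.E z w := by
    have hne : (Finset.univ.filter fun z => a < C.x z).Nonempty := by
      obtain ⟨u, -, -, h1, -⟩ := h'
      exact ⟨u, by simpa [h1] using haa'⟩
    obtain ⟨m, hm, hmin⟩ := Finset.exists_min_image _ C.x hne
    simp only [Finset.mem_filter, Finset.mem_univ, true_and] at hm hmin
    have hma' : C.x m ≤ a' := by
      obtain ⟨u, -, -, h1, -⟩ := h'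
      exact h1 ▸ hmin u (by rwa [h1])
    have hreg : C.reg ((a + C.x m) / 2) t :=
      hC.convH (hC.car_reg (.inl ⟨_, h⟩)) (hC.car_reg (.inl ⟨_, h'⟩)) (by linarith) (by linarith)
    have hnx : ∀ z, C.x z < C.x m → C.x z ≤ a := fun z hz => by
      by_contra hc
      exact absurd (hmin z (not_le.1 hc)) (not_le.2 hz)
    -- No vertex abscissa lies strictly between `a` and `C.x m`. If the midpoint is covered, it lies
    -- on a horizontal edge, which starts at the column at `a` and cannot jump over the column at
    -- `a'`.
    by_cases hcar : C.Car ((a + C.x m) / 2) t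
    · rcases hcar with ⟨ψ, u, v, -, h1, -⟩ | ⟨γ, u, w, huw, i1, i2, i3, i4⟩
      · exact absurd (hnx u (by linarith)) (by linarith)
      have hu : C.x u ≤ a := hnx u (by linarith)
      rcases huw with rfl | huw
      · linarith
      have hw : C.x m ≤ C.x w := hmin w (by linarith)
      have hua : C.x u = a ∧ C.f u = φ := by
        obtain ⟨z, j1, j2, j3, j4⟩ := hC.exists_vertex h (i1 ▸ C.onH_edge huw hu (by linarith))
        rcases hC.vtxH huw (j2.trans i1.symm) (by linarith) (by linarith) with rfl | rfl
        · exact ⟨j1, j3⟩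
        · linarith
      have hwa : C.x w ≤ a' := by
        by_contra hc
        obtain ⟨z, j1, j2, j3, j4⟩ := hC.exists_vertex h'
          (i1 ▸ C.onH_edge huw (by linarith) (by linarith))
        rcases hC.vtxH huw (j2.trans i1.symm) (by linarith) (by linarith) with rfl | rfl <;>
          linarith
      refine ⟨C.x w, C.f w, by linarith, hwa, ⟨w, rfl⟩, ?_, hua.2 ▸ hC.E_f huw, u, w, hua.2, huw⟩
      have := C.onV_vertex w
      rwa [← hC.E_y huw, i1] at this
    -- Otherwise the midpoint lies in a rectangular face. Its left side belongs to the column `φ`,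
    -- and its bottom row leads to the column of its right side.
    · obtain ⟨z₀, z₁, z₂, z₃, h1, h2, h3, h4, e1, e2, e3, e4, e5, e6, e7, e8, hin, hlr, hbt⟩ :=
        hC.box hreg hcar
      have ha : C.x z₀ = a := by
        refine le_antisymm (hnx _ (by linarith)) ?_
        by_contra hc
        exact hin a t (not_le.1 hc) (by linarith) h3 h4 (.inl ⟨_, h⟩)
      have ha' : C.x z₃ ≤ a' := by
        by_contra hc
        exact hin a' t (by linarith) (not_le.1 hc) h3 h4 (.inl ⟨_, h'⟩)
      have hφ : C.f z₀ = φ := hC.uniqV (ha ▸ (hlr t h3.le h4.le).1) h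
      obtain ⟨w, hw, -⟩ := hC.row_step e7.symm (by linarith)
      have := hC.row_lt e7.symm (by linarith)
      exact ⟨C.x z₃, C.f z₃, by linarith, ha', ⟨z₃, rfl⟩, (hlr t h3.le h4.le).2, by
        rwa [← hφ, ← e6], z₀, w, hφ, hw⟩
  obtain ⟨s, ψ, hs, hs', ⟨z, hz⟩, hon, hlt, hE⟩ := step
  refine ⟨?_, hE⟩
  rcases hs'.eq_or_lt with rfl | hs'
  · rwa [← hC.uniqV hon h']
  · refine hlt.trans (ih _ ?_ hon hs' rfl).1
    rw [← hn]
    refine Finset.card_lt_card (Finset.ssubset_iff_of_subset ?_ |>.2 ⟨z, ?_, ?_⟩)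
    · intro v
      simp only [Finset.mem_filter, Finset.mem_univ, true_and]
      exact fun hv => ⟨hs.trans hv.1, hv.2⟩
    · simp [hz, hs, hs'.le]
    · simp [hz]

end Layout
end GreedyRect

/-! ### Relative position of vertices and the two orderings -/

namespace GreedyRect

open Relation Set

namespace Layout

variable {V : Type*} {C : Layout V}

/-- Induction for walks along which `h` increases: they terminate because there are finitely many
vertices. -/
theorem climb [Finite V] (h : V → ℝ) {P : V → Prop}
    (step : ∀ u, (∀ u', h u < h u' → P u') → P u) (u : V) : P u :=
  (@Finite.wellFounded_of_trans_of_irrefl V _ (fun a b => h b < h a)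
    ⟨fun _ _ _ h1 h2 => h2.trans h1⟩ ⟨fun _ => lt_irrefl _⟩).induction u step

/-- A distance below which there is no vertex coordinate just above a given one. -/
theorem exists_gap [Finite V] (h : V → ℝ) (a : ℝ) : ∃ ε > 0, ∀ z, h z ≤ a ∨ a + ε ≤ h z := by
  classical
  have := Fintype.ofFinite V
  by_cases hne : (Finset.univ.filter fun z => a < h z).Nonempty
  · obtain ⟨m, hm, hmin⟩ := Finset.exists_min_image _ h hne
    simp only [Finset.mem_filter, Finset.mem_univ, true_and] at hm hmin
    refine ⟨h m - a, by linarith, fun z => ?_⟩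
    rcases le_or_gt (h z) a with hz | hz
    · exact .inl hz
    · exact .inr (by linarith [hmin z hz])
  · refine ⟨1, one_pos, fun z => .inl ?_⟩
    by_contra hz
    exact hne ⟨z, by simpa using hz⟩

/-- A vertex from which a vertical edge starts upwards, detected slightly above it. -/
theorem Valid.exists_N (hC : C.Valid) {t : V} {ε b : ℝ}
    (hε : ∀ z, C.y z ≤ C.y t ∨ C.y t + ε ≤ C.y z) {φ : ℤ} (h : C.OnV (C.x t) b φ)
    (hb : C.y t < b) (hb' : b < C.y t + ε) : ∃ v, C.N t v := by
  obtain ⟨u, v, huv, h1, h2, h3, -⟩ := h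
  have hu : C.y u ≤ C.y t := (hε u).resolve_right (by linarith)
  rcases huv with rfl | huv
  · linarith
  rcases hC.vtxV huv h1.symm hu (by linarith) with rfl | rfl
  · exact ⟨v, huv⟩
  · linarith

theorem Valid.exists_E (hC : C.Valid) {t : V} {ε a : ℝ}
    (hε : ∀ z, C.x z ≤ C.x t ∨ C.x t + ε ≤ C.x z) {φ : ℤ} (h : C.OnH a (C.y t) φ)
    (ha : C.x t < a) (ha' : a < C.x t + ε) : ∃ v, C.E t v :=
  hC.transpose.exists_N (t := t) hε ((transpose_onV C _ _ _).2 h) ha ha'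

/-- Above a vertex without upper and right neighbour there is only the external face. -/
theorem Valid.not_reg_above [Finite V] (hC : C.Valid) {t : V} (hN : ∀ v, ¬ C.N t v)
    (hE : ∀ v, ¬ C.E t v) {b : ℝ} (hb : C.y t < b) : ¬ C.reg (C.x t) b := by
  intro hr
  obtain ⟨ε, hε, hεx⟩ := exists_gap C.x (C.x t)
  obtain ⟨η, hη, hηy⟩ := exists_gap C.y (C.y t)
  have hc1 : C.y t < min (C.y t + η / 2) b := lt_min (by linarith) hb
  have hc2 : min (C.y t + η / 2) b < C.y t + η := (min_le_left _ _).trans_lt (by linarith)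
  set c := min (C.y t + η / 2) b
  have hr' : C.reg (C.x t) c :=
    hC.convV (hC.car_reg (C.car_vertex t)) hr hc1.le (min_le_right _ _)
  have hcar : ¬ C.Car (C.x t) c := by
    rintro (⟨φ, h⟩ | ⟨γ, u, v, -, h1, -⟩)
    · obtain ⟨v, hv⟩ := hC.exists_N hηy h hc1 hc2
      exact hN v hv
    · rcases hηy u with h | h <;> linarith
  -- The face just above `t` would be a box whose bottom side contains `t` in its relative interior,
  -- and that side would leave `t` by a right edge.
  obtain ⟨z₀, z₁, z₂, z₃, h1, h2, h3, h4, e1, e2, e3, e4, e5, e6, e7, e8, hin, hlr, hbt⟩ :=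
    hC.box hr' hcar
  have hz : C.y z₀ = C.y t := by
    refine le_antisymm ((hηy z₀).resolve_right (by linarith)) ?_
    by_contra h
    exact hin _ _ h1 h2 (not_le.1 h) (by linarith) (C.car_vertex t)
  have hz3 : C.x t + ε ≤ C.x z₃ := (hεx z₃).resolve_left (by linarith)
  obtain ⟨v, hv⟩ := hC.exists_E hεx (hz ▸ (hbt (C.x t + ε / 2) (by linarith) (by linarith)).1)
    (by linarith) (by linarith)
  exact hE v hv

theorem Valid.not_reg_right [Finite V] (hC : C.Valid) {t : V} (hN : ∀ v, ¬ C.N t v)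
    (hE : ∀ v, ¬ C.E t v) {a : ℝ} (ha : C.x t < a) : ¬ C.reg a (C.y t) :=
  hC.transpose.not_reg_above (t := t) hE hN ha

/-- No vertex lies above and to the right of a vertex without upper and right neighbour. -/
theorem Valid.corner [Finite V] (hC : C.Valid) {t : V} (hN : ∀ v, ¬ C.N t v)
    (hE : ∀ v, ¬ C.E t v) {v : V} (hvt : v ≠ t) : ¬ (C.x t ≤ C.x v ∧ C.y t ≤ C.y v) := by
  rintro ⟨hx, hy⟩
  rcases hx.eq_or_lt with hx | hx
  · rcases hy.eq_or_lt with hy | hy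
    · exact hvt (hC.inj hx.symm hy.symm)
    · exact hC.not_reg_above hN hE hy (hx ▸ hC.car_reg (C.car_vertex v))
  rcases hy.eq_or_lt with hy | hy
  · exact hC.not_reg_right hN hE hx (hy ▸ hC.car_reg (C.car_vertex v))
  -- The graph is connected, but a path from `v` to `t` cannot leave the open quadrant: it would
  -- cross one of the two rays that start at `t`, which lie outside the region.
  have key : ∀ z, ReflTransGen (fun a b => C.E a b ∨ C.E b a ∨ C.N a b ∨ C.N b a) v z →
      C.x t < C.x z ∧ C.y t < C.y z := by
    intro z hz
    induction hz with
    | refl => exact ⟨hx, hy⟩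
    | @tail a b _ h ih =>
      rcases h with h | h | h | h
      · exact ⟨ih.1.trans (hC.E_x h), hC.E_y h ▸ ih.2⟩
      · have hb : C.y t < C.y b := (hC.E_y h).symm ▸ ih.2
        refine ⟨?_, hb⟩
        by_contra hc
        exact hC.not_reg_above hN hE hb
          (hC.car_reg (.inr ⟨_, C.onH_edge h (not_lt.1 hc) ih.1.le⟩))
      · exact ⟨hC.N_x h ▸ ih.1, ih.2.trans (hC.N_y h)⟩
      · have hb : C.x t < C.x b := (hC.N_x h).symm ▸ ih.1
        refine ⟨hb, ?_⟩
        by_contra hc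
        exact hC.not_reg_right hN hE hb
          (hC.car_reg (.inl ⟨_, C.onV_edge h (not_lt.1 hc) ih.2.le⟩))
  exact lt_irrefl _ (key t (hC.conn v t)).1

/-- If `v` lies above and to the right of `u`, its column or its row comes later. -/
theorem Valid.lt_or_lt [Finite V] (hC : C.Valid) {u v : V} (hx : C.x u < C.x v)
    (hy : C.y u < C.y v) : C.f u < C.f v ∨ C.g u < C.g v := by
  revert hx hy
  -- Walk from `u` upwards or to the right; `corner` shows that the walk is not stuck before passing
  -- `v`. An edge that passes `v` runs to the left of `v` or below it, and `lt_of_right` compares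
  -- the two.
  refine climb (fun u => C.x u + C.y u) (P := fun u => C.x u < C.x v → C.y u < C.y v →
    C.f u < C.f v ∨ C.g u < C.g v) (fun u ih hx hy => ?_) u
  by_cases hN : ∀ w, ¬ C.N u w
  · by_cases hE : ∀ w, ¬ C.E u w
    · exact absurd ⟨hx.le, hy.le⟩ (hC.corner hN hE fun h => hx.ne (by rw [h]))
    · push Not at hE
      obtain ⟨w, hw⟩ := hE
      rcases lt_or_ge (C.x w) (C.x v) with h | h
      · have := ih w (by linarith [hC.E_x hw, hC.E_y hw]) h (hC.E_y hw ▸ hy)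
        rw [hC.E_g hw]
        exact this.imp_left (hC.E_f hw).trans
      · exact .inr (hC.transpose.lt_of_right ((transpose_onV C _ _ _).2 (C.onH_edge hw hx.le h))
          (C.onH_vertex v) hy).1
  · push Not at hN
    obtain ⟨w, hw⟩ := hN
    rcases lt_or_ge (C.y w) (C.y v) with h | h
    · have := ih w (by linarith [hC.N_x hw, hC.N_y hw]) (hC.N_x hw ▸ hx) h
      rw [hC.N_f hw]
      exact this.imp_right (hC.N_g hw).trans
    · exact .inl (hC.lt_of_right (C.onV_edge hw hy.le h) (C.onV_vertex v) hx).1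

/-- If `v` lies above and to the left of `u`, its column comes earlier or its row later. -/
theorem Valid.gt_or_lt [Finite V] (hC : C.Valid) {u v : V} (hx : C.x v < C.x u)
    (hy : C.y u < C.y v) : C.f v < C.f u ∨ C.g u < C.g v := by
  have := hC.reflect.lt_or_lt (u := u) (v := v) (neg_lt_neg hx) hy
  exact this.imp_left neg_lt_neg_iff.1

theorem Valid.eq_or_lt [Finite V] (hC : C.Valid) {u v : V} (hx : C.x v ≤ C.x u)
    (hy : C.y v ≤ C.y u) : v = u ∨ C.f v < C.f u ∨ C.g v < C.g u := by
  rcases hx.eq_or_lt with hx | hx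
  · rcases hy.eq_or_lt with hy | hy
    · exact .inl (hC.inj hx hy)
    · exact .inr (.inr (hC.transpose.lt_of_right (C.onH_vertex v) (hx ▸ C.onH_vertex u) hy).1)
  · rcases hy.eq_or_lt with hy | hy
    · exact .inr (.inl (hC.lt_of_right (C.onV_vertex v) (hy ▸ C.onV_vertex u) hx).1)
    · exact .inr (hC.lt_or_lt hx hy)

/-- A column above and to the left of a vertex `t` without upper and right neighbour precedes the
column of `t`. -/
theorem Valid.lt_of_corner [Finite V] (hC : C.Valid) {t v : V} (hN : ∀ v, ¬ C.N t v)
    (hE : ∀ v, ¬ C.E t v) (hx : C.x v < C.x t) (hy : C.y t < C.y v) : C.f v < C.f t := by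
  revert hx hy
  -- Walk from `v` downwards or to the right. A vertical edge that passes `t` sees it on its right;
  -- a horizontal edge passing above `t` would cover a point outside the region; a dead end
  -- contradicts `corner` for the opposite quadrant.
  refine climb (fun v => C.x v - C.y v) (P := fun v => C.x v < C.x t → C.y t < C.y v →
    C.f v < C.f t) (fun v ih hx hy => ?_) v
  by_cases hS : ∃ w, C.N w v
  · obtain ⟨w, hw⟩ := hS
    rcases lt_or_ge (C.y t) (C.y w) with h | h
    · rw [← hC.N_f hw]
      exact ih w (by linarith [hC.N_x hw, hC.N_y hw]) (hC.N_x hw ▸ hx) h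
    · rw [← hC.N_f hw]
      exact (hC.lt_of_right (C.onV_edge hw h hy.le) (C.onV_vertex t) (hC.N_x hw ▸ hx)).1
  · by_cases hE' : ∃ w, C.E v w
    · obtain ⟨w, hw⟩ := hE'
      rcases lt_or_ge (C.x w) (C.x t) with h | h
      · exact (hC.E_f hw).trans
          (ih w (by linarith [hC.E_x hw, hC.E_y hw]) h (hC.E_y hw ▸ hy))
      · exact absurd (hC.car_reg (.inr ⟨_, C.onH_edge hw hx.le h⟩)) (hC.not_reg_above hN hE hy)
    · push Not at hS hE'
      exact absurd ⟨neg_le_neg hy.le, hx.le⟩ (hC.transpose.reflect.corner (t := v) (v := t) hE' hS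
        fun h => hx.ne (by rw [h]))

/-- No vertex comes later in both orders than a vertex without upper and right neighbour. -/
theorem Valid.not_later [Finite V] (hC : C.Valid) {t v : V} (hN : ∀ v, ¬ C.N t v)
    (hE : ∀ v, ¬ C.E t v) (hf : C.f t < C.f v) : C.g v ≤ C.g t := by
  by_contra! hg
  have hvt : v ≠ t := fun h => hf.ne (by rw [h])
  rcases lt_or_ge (C.x v) (C.x t) with hx | hx
  · rcases lt_or_ge (C.y t) (C.y v) with hy | hy
    · exact absurd (hC.lt_of_corner hN hE hx hy) hf.not_gt
    · rcases hC.eq_or_lt hx.le hy with h | h | h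
      · exact hvt h
      · exact absurd h hf.not_gt
      · exact absurd h hg.not_gt
  · rcases lt_or_ge (C.y v) (C.y t) with hy | hy
    · rcases hx.eq_or_lt with hx | hx
      · rcases hC.eq_or_lt hx.ge hy.le with h | h | h
        · exact hvt h
        · exact absurd h hf.not_gt
        · exact absurd h hg.not_gt
      · exact absurd (hC.transpose.lt_of_corner (t := t) (v := v) hE hN hy hx) hg.not_gt
    · exact hC.corner hN hE hvt ⟨hx, hy⟩

/-- A column without edges to the right is the last one. -/
theorem Valid.exists_right [Finite V] (hC : C.Valid) {k v : V} (hkv : C.f k < C.f v) :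
    ∃ z w, C.f z = C.f k ∧ C.E z w := by
  by_contra! hno
  have top : ∃ t, ReflTransGen C.N k t ∧ ∀ w, ¬ C.N t w := by
    refine climb C.y (P := fun k => ∃ t, ReflTransGen C.N k t ∧ ∀ w, ¬ C.N t w)
      (fun k ih => ?_) k
    by_cases h : ∀ w, ¬ C.N k w
    · exact ⟨k, .refl, h⟩
    · push Not at h
      obtain ⟨w, hw⟩ := h
      obtain ⟨t, ht, h⟩ := ih w (hC.N_y hw)
      exact ⟨t, ht.head hw, h⟩
  have bot : ∃ s, ReflTransGen C.N s k ∧ ∀ w, ¬ C.N w s := by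
    refine climb (fun v => -C.y v) (P := fun k => ∃ t, ReflTransGen C.N t k ∧ ∀ w, ¬ C.N w t)
      (fun k ih => ?_) k
    by_cases h : ∀ w, ¬ C.N w k
    · exact ⟨k, .refl, h⟩
    · push Not at h
      obtain ⟨w, hw⟩ := h
      obtain ⟨t, ht, h⟩ := ih w (neg_lt_neg (hC.N_y hw))
      exact ⟨t, ht.tail hw, h⟩
  obtain ⟨t, hkt, ht⟩ := top
  obtain ⟨s, hsk, hs⟩ := bot
  obtain ⟨i1, i2, i3, i4⟩ := hC.transpose.chain_x hkt
  obtain ⟨j1, j2, j3, j4⟩ := hC.transpose.chain_x hsk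
  change C.x s = C.x k at j3
  change C.x k = C.x t at i3
  change C.f s = C.f k at j4
  change C.f k = C.f t at i4
  have htE : ∀ w, ¬ C.E t w := fun w => hno t w i4.symm
  have hsE : ∀ w, ¬ C.E s w := fun w => hno s w j4
  have hvt : v ≠ t := fun h => hkv.ne (by rw [h, i4])
  have hvs : v ≠ s := fun h => hkv.ne (by rw [h, j4])
  -- If `v` is above the top `t` or below the bottom `s` of the column, the corner lemmas apply
  -- there. Otherwise the column has a point at the height of `v`, and a column that sees another
  -- one to its right has an edge to the right.
  rcases lt_or_ge (C.y t) (C.y v) with hy | hy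
  · rcases lt_or_ge (C.x v) (C.x t) with hx | hx
    · have := hC.lt_of_corner ht htE hx hy
      lia
    · exact hC.corner ht htE hvt ⟨hx, hy.le⟩
  rcases lt_or_ge (C.y v) (C.y s) with hy' | hy'
  · have hV := hC.transpose.reflect.transpose
    rcases lt_or_ge (C.x v) (C.x s) with hx | hx
    · have : C.f v < C.f s := hV.lt_of_corner (t := s) (v := v) hs hsE hx (neg_lt_neg hy')
      lia
    · exact hV.corner (t := s) hs hsE hvs ⟨hx, neg_le_neg hy'.le⟩
  have hcol : ∀ {a b : V}, ReflTransGen C.N a b → ∀ y, C.y a ≤ y → y ≤ C.y b →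
      C.OnV (C.x a) y (C.f a) := by
    intro a b h
    induction h with
    | refl => exact fun y h1 h2 => le_antisymm h1 h2 ▸ C.onV_vertex a
    | @tail b c hab h ih =>
      intro y h1 h2
      rcases le_or_gt y (C.y b) with h3 | h3
      · exact ih y h1 h3
      · obtain ⟨-, -, e1, e2⟩ := hC.transpose.chain_x hab
        change C.x a = C.x b at e1
        change C.f a = C.f b at e2
        rw [e1, e2]
        exact C.onV_edge h h3.le h2
  have hon := hcol (hsk.trans hkt) _ hy' hy
  rcases lt_trichotomy (C.x v) (C.x s) with hx | hx | hx
  · have := (hC.lt_of_right (C.onV_vertex v) hon hx).1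
    lia
  · have := hC.uniqV (hx ▸ C.onV_vertex v) hon
    lia
  · obtain ⟨z, w, hz, hw⟩ := (hC.lt_of_right hon (C.onV_vertex v) hx).2
    exact hno z w (hz.trans j4) hw

/-- An edge of a row and an edge of a column that cross with respect to the orders `f` and `g` have
a common end-vertex. -/
theorem Valid.exists_common [Finite V] (hC : C.Valid) {u w a b : V} (hE : C.E u w) (hN : C.N a b)
    (h1 : C.f u ≤ C.f a) (h2 : C.f a ≤ C.f w) (h3 : C.g a ≤ C.g u) (h4 : C.g u ≤ C.g b) :
    ∃ z, (z = u ∨ z = w) ∧ (z = a ∨ z = b) := by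
  -- A crossing in the orders is a crossing in the drawing: any other relative position of the two
  -- edges would force a strict inequality against one of the hypotheses. It then remains to apply
  -- planarity of the drawing.
  have key : ∀ {C : Layout V} {u w a b : V}, C.Valid → C.E u w → C.N a b → C.f u ≤ C.f a →
      C.g a ≤ C.g u → C.g u ≤ C.g b → C.x u ≤ C.x a := by
    intro C u w a b hC hE hN h1 h3 h4
    by_contra! hx
    have hx' := (hC.N_x hN).symm.trans_lt hx
    have hf := hC.N_f hN
    rcases lt_or_ge (C.y u) (C.y a) with hy | hy
    · rcases hC.gt_or_lt hx hy with h | h <;> lia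
    rcases lt_or_ge (C.y b) (C.y u) with hy' | hy'
    · rcases hC.lt_or_lt hx' hy' with h | h <;> lia
    · have := (hC.lt_of_right (C.onV_edge hN hy hy') (C.onV_vertex u) hx).1
      lia
  have k1 := key hC hE hN h1 h3 h4
  have k2 : -C.x w ≤ -C.x a := key hC.reflect hE hN (neg_le_neg h2)
    (show C.g a ≤ C.g w by rwa [← hC.E_g hE]) (show C.g w ≤ C.g b by rwa [← hC.E_g hE])
  have hE' := (C.onH_edge hE k1 (neg_le_neg_iff.1 k2))
  refine hC.meet hE hN k1 (neg_le_neg_iff.1 k2) ?_ ?_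
  · by_contra! hy
    have := (hC.transpose.lt_of_right ((transpose_onV C _ _ _).2 hE') (C.onH_vertex a) hy).1
    lia
  · by_contra! hy
    have := (hC.transpose.lt_of_right (C.transpose.onV_vertex b)
      ((transpose_onV C _ _ _).2 (hC.N_x hN ▸ hE')) hy).1
    change C.g b < C.g u at this
    lia

/-- The corner between a right and an upper edge belongs to an internal face, which then is a box,
or to the external face. -/
theorem Valid.corner_box [Finite V] (hC : C.Valid) {u w u' : V} (hE : C.E u w) (hN : C.N u u') :
    (∃ z₁ z₂ z₃, C.x u < C.x z₃ ∧ C.y u < C.y z₃ ∧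
      C.x z₂ = C.x u ∧ C.x z₁ = C.x z₃ ∧ C.y z₁ = C.y u ∧ C.y z₂ = C.y z₃ ∧
      C.f z₂ = C.f u ∧ C.f z₁ = C.f z₃ ∧ C.g z₁ = C.g u ∧ C.g z₂ = C.g z₃ ∧
      (∀ s t, C.x u < s → s < C.x z₃ → C.y u < t → t < C.y z₃ → ¬ C.Car s t) ∧
      (∀ t, C.y u ≤ t → t ≤ C.y z₃ → C.OnV (C.x z₃) t (C.f z₃)) ∧
      (∀ s, C.x u ≤ s → s ≤ C.x z₃ → C.OnH s (C.y z₃) (C.g z₃))) ∨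
    ∃ ε > 0, ∃ η > 0, ¬ C.reg (C.x u + ε) (C.y u + η) ∧
      (∀ z, C.x u < C.x z → C.x u + ε ≤ C.x z) ∧ ∀ z, C.y u < C.y z → C.y u + η ≤ C.y z := by
  obtain ⟨ε, hε, hεx⟩ := exists_gap C.x (C.x u)
  obtain ⟨η, hη, hηy⟩ := exists_gap C.y (C.y u)
  by_cases hr : C.reg (C.x u + ε / 2) (C.y u + η / 2)
  · left
    have hcar : ¬ C.Car (C.x u + ε / 2) (C.y u + η / 2) := by
      rintro (⟨φ, a, b, -, h1, -⟩ | ⟨γ, a, b, -, h1, -⟩)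
      · rcases hεx a with h | h <;> linarith
      · rcases hηy a with h | h <;> linarith
    obtain ⟨z₀, z₁, z₂, z₃, h1, h2, h3, h4, e1, e2, e3, e4, e5, e6, e7, e8, hin, hlr, hbt⟩ :=
      hC.box hr hcar
    have hx0 := (hεx z₀).resolve_right (by linarith)
    have hy0 := (hηy z₀).resolve_right (by linarith)
    have hz : z₀ = u := by
      refine hC.inj (le_antisymm hx0 ?_) (le_antisymm hy0 ?_)
      · by_contra! h
        have := (hηy u').resolve_left (not_le.2 (hC.N_y hN))
        exact hin _ _ h (by linarith) h3 h4
          (.inl ⟨_, C.onV_edge hN (by linarith) (by linarith)⟩)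
      · by_contra! h
        have := (hεx w).resolve_left (not_le.2 (hC.E_x hE))
        exact hin _ _ h1 h2 h (by linarith)
          (.inr ⟨_, C.onH_edge hE (by linarith) (by linarith)⟩)
    subst hz
    exact ⟨z₁, z₂, z₃, by linarith, by linarith, e1, e2, e3, e4, e5, e6, e7, e8, hin,
      fun t h h' => (hlr t h h').2, fun s h h' => (hbt s h h').2⟩
  · right
    refine ⟨ε / 2, by linarith, η / 2, by linarith, hr, fun z hz => ?_, fun z hz => ?_⟩
    · linarith [(hεx z).resolve_left (not_le.2 hz)]
    · linarith [(hηy z).resolve_left (not_le.2 hz)]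

/-- If the corner between a right and an upper edge of `u` belongs to the external face, no vertex
lies above and to the right of `u`. -/
theorem Valid.not_above_right [Finite V] (hC : C.Valid) {u w u' v : V} (hE : C.E u w)
    (hN : C.N u u') {ε η : ℝ} (hε : 0 < ε) (hη : 0 < η)
    (hr : ¬ C.reg (C.x u + ε) (C.y u + η))
    (hεx : ∀ z, C.x u < C.x z → C.x u + ε ≤ C.x z)
    (hηy : ∀ z, C.y u < C.y z → C.y u + η ≤ C.y z) (hx : C.x u < C.x v) : C.y v ≤ C.y u := by
  by_contra! hy
  have left : C.reg (C.x u) (C.y u + η) := hC.car_reg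
    (.inl ⟨_, C.onV_edge hN (by linarith) (hηy _ (hC.N_y hN))⟩)
  -- Follow the row of `u` to the right until an edge passes below `v`. An upper edge on the way, or
  -- the vertical segment below `v`, would by horizontal convexity put the corner at `u` into the
  -- region.
  have key : ∀ r, C.y r = C.y u → C.x u < C.x r → C.x r < C.x v → False := by
    refine climb C.x fun r ih h1 h2 h3 => ?_
    by_cases hrN : ∃ s, C.N r s
    · obtain ⟨s, hs⟩ := hrN
      exact hr (hC.convH left (hC.car_reg (.inl ⟨_, C.onV_edge hs (by linarith)
        (hηy s (by linarith [hC.N_y hs]))⟩)) (by linarith) (hεx _ h2))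
    by_cases hrE : ∃ s, C.E r s
    · obtain ⟨s, hs⟩ := hrE
      rcases lt_or_ge (C.x s) (C.x v) with h | h
      · exact ih s (hC.E_x hs) ((hC.E_y hs).symm.trans h1) (h2.trans (hC.E_x hs)) h
      · refine hr (hC.convH left (b := C.x v) (hC.convV (hC.car_reg (.inr ⟨_, C.onH_edge hs h3.le h⟩))
          (hC.car_reg (C.car_vertex v)) ?_ ?_) (by linarith) (hεx _ hx))
        · linarith
        · exact hηy _ hy
    · push Not at hrN hrE
      exact hC.corner hrN hrE (v := v) (fun h => h3.ne (by rw [h])) ⟨h3.le, by linarith⟩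
  rcases lt_or_ge (C.x w) (C.x v) with h | h
  · exact key w (hC.E_y hE).symm (hC.E_x hE) h
  · exact hr (hC.convH left (b := C.x v) (hC.convV (hC.car_reg (.inr ⟨_, C.onH_edge hE hx.le h⟩))
      (hC.car_reg (C.car_vertex v)) (by linarith) (hηy _ hy)) (by linarith) (hεx _ hx))

/-- A vertex `v` that comes later than `u` in both orders does not come before both the right and
the upper neighbour of `u`. -/
theorem Valid.not_between [Finite V] (hC : C.Valid) {u w u' v : V} (hE : C.E u w)
    (hN : C.N u u') (h1 : C.f u < C.f v) (h2 : C.f v < C.f w) (h3 : C.g u < C.g v) :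
    C.g u' ≤ C.g v := by
  by_contra! h4
  -- The order inequalities place `v` geometrically to the right of `u`, and by transposition above
  -- it.
  have key : ∀ {C : Layout V} {u w u' v : V}, C.Valid → C.E u w → C.N u u' → C.f u < C.f v →
      C.f v < C.f w → C.g u < C.g v → C.g v < C.g u' → C.x u < C.x v := by
    intro C u w u' v hC hE hN h1 h2 h3 h4
    by_contra! hx
    have hN' := hC.N_f hN
    rcases le_or_gt (C.y v) (C.y u) with hy | hy
    · rcases hC.eq_or_lt hx hy with h | h | h
      · exact h1.ne (by rw [h])
      · lia
      · lia
    rcases le_or_gt (C.y v) (C.y u') with hy' | hy'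
    · have hon := C.onV_edge hN hy.le hy'
      rcases hx.eq_or_lt with hx | hx
      · have := hC.uniqV hon (hx ▸ C.onV_vertex v)
        lia
      · have := (hC.lt_of_right (C.onV_vertex v) hon hx).1
        lia
    · rcases hx.eq_or_lt with hx | hx
      · have hx' : C.x u' = C.x v := by rw [← hC.N_x hN, hx]
        have := (hC.transpose.lt_of_right (C.onH_vertex u') (hx' ▸ C.onH_vertex v) hy').1
        change C.g u' < C.g v at this
        lia
      · rcases hC.gt_or_lt (hC.N_x hN ▸ hx) hy' with h | h <;> lia
  have hx := key hC hE hN h1 h2 h3 h4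
  have hy : C.y u < C.y v := key hC.transpose hN hE h3 h4 h1 h2
  rcases hC.corner_box hE hN with ⟨z₁, z₂, z₃, i1, i2, e1, e2, e3, e4, e5, e6, e7, e8, hin, hr, ht⟩ |
    ⟨ε, hε, η, hη, hr, hεx, hηy⟩
  -- The face at `u` reaches at least to the column of `w` and to the row of `u'`. As `v` is not
  -- inside it, `v` lies on or beyond its right or upper side and so comes after one of them.
  · have hw : C.f w ≤ C.f z₃ := by
      obtain ⟨w', hw', hc⟩ := hC.row_step e7.symm (by linarith)
      rw [← e6, hC.E_fun hE hw']
      exact (hC.chain_x hc).2.1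
    have hu' : C.g u' ≤ C.g z₃ := by
      obtain ⟨w', hw', hc⟩ := hC.transpose.row_step (u := u) (v := z₂) e5.symm
        (show C.y u < C.y z₂ by linarith)
      rw [← e8, hC.N_fun hN hw']
      exact (hC.transpose.chain_x hc).2.1
    rcases lt_or_ge (C.y v) (C.y z₃) with hy' | hy'
    · rcases lt_or_ge (C.x v) (C.x z₃) with hx' | hx'
      · exact hin _ _ hx hx' hy hy' (C.car_vertex v)
      · have hon := hr _ hy.le hy'.le
        rcases hx'.eq_or_lt with hx' | hx'
        · have := hC.uniqV hon (hx' ▸ C.onV_vertex v)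
          lia
        · have := (hC.lt_of_right hon (C.onV_vertex v) hx').1
          lia
    · rcases le_or_gt (C.x v) (C.x z₃) with hx' | hx'
      · have hon := ht _ hx.le hx'
        rcases hy'.eq_or_lt with hy' | hy'
        · have := hC.uniqH hon (hy' ▸ C.onH_vertex v)
          lia
        · have := (hC.transpose.lt_of_right ((transpose_onV C _ _ _).2 hon)
            (C.onH_vertex v) hy').1
          change C.g z₃ < C.g v at this
          lia
      · rcases hC.eq_or_lt hx'.le hy' with h | h | h
        · rw [h] at hw; lia
        · lia
        · lia
  · exact absurd (hC.not_above_right hE hN hε hη hr hεx hηy hx) (not_le.2 hy)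

end Layout
end GreedyRect

/-! ### From drawings in the plane to layouts -/

namespace GreedyRect

open Relation Set

theorem mem_segment_of_eq {i j : Fin 2} (hij : i ≠ j) {P Q p : Plane} (hj : P j = Q j)
    (hi : P i ≤ Q i) : p ∈ segment ℝ P Q ↔ p j = P j ∧ P i ≤ p i ∧ p i ≤ Q i := by
  constructor
  · rintro ⟨a, b, ha, hb, hab, rfl⟩
    obtain rfl : a = 1 - b := by linarith
    simp only [PiLp.add_apply, PiLp.smul_apply, smul_eq_mul, ← hj]
    refine ⟨by ring, ?_, ?_⟩ <;> nlinarith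
  · rintro ⟨h1, h2, h3⟩
    rcases hi.eq_or_lt with hi | hi
    · have : p = P := by
        ext k
        rcases (by lia : k = i ∨ k = j) with rfl | rfl
        · linarith
        · exact h1
      exact this ▸ left_mem_segment ℝ P Q
    · have hpos : 0 < Q i - P i := sub_pos.2 hi
      refine ⟨1 - (p i - P i) / (Q i - P i), (p i - P i) / (Q i - P i), ?_, ?_, by ring, ?_⟩
      · rw [sub_nonneg, div_le_one hpos]; linarith
      · exact div_nonneg (by linarith) hpos.le
      · ext k
        simp only [PiLp.add_apply, PiLp.smul_apply, smul_eq_mul]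
        rcases (by lia : k = i ∨ k = j) with rfl | rfl
        · field_simp
          ring
        · rw [h1, ← hj]; ring

theorem isClosed_segment_plane (P Q : Plane) : IsClosed (segment ℝ P Q) := by
  rw [segment_eq_image_lineMap]
  exact (isCompact_Icc.image AffineMap.lineMap_continuous).isClosed

theorem Shape.isClosed_carrier {V : Type*} [Finite V] (H : Shape V) (pos : V → Plane) :
    IsClosed (H.carrier pos) := by
  refine (finite_range pos).isClosed.union ?_
  have : {p | ∃ u v, H.graph.Adj u v ∧ p ∈ segment ℝ (pos u) (pos v)} =
      ⋃ u, ⋃ v, ⋃ _ : H.graph.Adj u v, segment ℝ (pos u) (pos v) := by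
    ext p; simp
  rw [this]
  exact isClosed_iUnion_of_finite fun u => isClosed_iUnion_of_finite fun v =>
    isClosed_iUnion_of_finite fun _ => isClosed_segment_plane _ _

/-- The boundary of a face that is an open box is covered by the drawing. -/
theorem mem_of_mem_boundary {K : Set Plane} (hK : IsClosed K) {p : Plane} {a b c d : ℝ}
    (hab : a < b) (hcd : c < d)
    (hF : connectedComponentIn Kᶜ p = {q | (a < q 0 ∧ q 0 < b) ∧ (c < q 1 ∧ q 1 < d)})
    {q : Plane} (h0 : a ≤ q 0) (h1 : q 0 ≤ b) (h2 : c ≤ q 1) (h3 : q 1 ≤ d)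
    (h : q 0 = a ∨ q 0 = b ∨ q 1 = c ∨ q 1 = d) : q ∈ K := by
  -- An uncovered boundary point has an uncovered ball around it. This ball contains points of the
  -- segment to the centre `m` of the box, so the boundary point would belong to the same face,
  -- which is the open box.
  by_contra hq
  obtain ⟨r, hr, hball⟩ := Metric.isOpen_iff.1 hK.isOpen_compl q hq
  set m : Plane := !₂[(a + b) / 2, (c + d) / 2] with hm
  have ht : Filter.Tendsto (fun θ : ℝ => AffineMap.lineMap q m θ) (nhdsWithin 0 (Ioi 0)) (nhds q) :=
    ((AffineMap.lineMap_continuous (p := q) (q := m) (R := ℝ)).tendsto' 0 q (by simp)).mono_left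
      nhdsWithin_le_nhds
  have hev := (ht.eventually (Metric.ball_mem_nhds q hr)).and
    (Ioo_mem_nhdsGT (zero_lt_one' ℝ))
  obtain ⟨θ, hθ, hθ0, hθ1⟩ := hev.exists
  set z := AffineMap.lineMap q m θ with hz
  have hz0 : z 0 = (1 - θ) * q 0 + θ * ((a + b) / 2) := by
    simp [hz, AffineMap.lineMap_apply, hm]; ring
  have hz1 : z 1 = (1 - θ) * q 1 + θ * ((c + d) / 2) := by
    simp [hz, AffineMap.lineMap_apply, hm]; ring
  have hzF : z ∈ connectedComponentIn Kᶜ p := by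
    rw [hF]
    refine ⟨⟨?_, ?_⟩, ?_, ?_⟩ <;> simp only [hz0, hz1] <;> nlinarith
  have : q ∈ connectedComponentIn Kᶜ p := by
    rw [connectedComponentIn_eq hzF]
    exact (convex_ball q r).isPreconnected.subset_connectedComponentIn hθ hball
      (Metric.mem_ball_self hr)
  rw [hF] at this
  obtain ⟨⟨i1, i2⟩, i3, i4⟩ := this
  rcases h with h | h | h | h <;> linarith

/-- With unique successors and predecessors there is no branching, so each class is a chain. This
turns the quotients that define columns and rows into paths. -/
theorem total_of_eqvGen {V : Type*} {r : V → V → Prop} (hf : ∀ {u v w}, r u v → r u w → v = w)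
    (hi : ∀ {u v w}, r v u → r w u → v = w) {u v : V} (h : EqvGen r u v) :
    ReflTransGen r u v ∨ ReflTransGen r v u := by
  have fwd : ∀ {a b c}, ReflTransGen r a b → ReflTransGen r a c →
      ReflTransGen r b c ∨ ReflTransGen r c b := fun h h' =>
    ReflTransGen.total_of_right_unique (fun _ _ _ => hf) h h'
  have bwd : ∀ {a b c}, ReflTransGen r b a → ReflTransGen r c a →
      ReflTransGen r b c ∨ ReflTransGen r c b := fun h h' =>
    (ReflTransGen.total_of_right_unique (r := Function.swap r) (fun _ _ _ => hi)
      (reflTransGen_swap.2 h) (reflTransGen_swap.2 h')).symm.imp reflTransGen_swap.1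
        reflTransGen_swap.1
  induction h with
  | rel _ _ h => exact .inl (.single h)
  | refl => exact .inl .refl
  | symm _ _ _ ih => exact ih.symm
  | trans a b c _ _ ih ih' =>
    rcases ih with h | h <;> rcases ih' with h' | h'
    · exact .inl (h.trans h')
    · exact bwd h h'
    · exact fwd h h'
    · exact .inr (h'.trans h)

section layout

variable {V : Type*} (H : RectRep V) (Sx : StOrdering H.Dx) (Sy : StOrdering H.Dy)
  (pos : V → Plane)

/-- The layout of a drawing with columns and rows numbered by two orderings. -/
def layout : Layout V where
  E u v := H.nbr u .east = some v
  N u v := H.nbr u .north = some v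
  x v := pos v 0
  y v := pos v 1
  f v := (Sx.index (H.cx v)).val
  g v := (Sy.index (H.cy v)).val
  reg a b := !₂[a, b] ∈ H.region pos

variable {H Sx Sy pos}

theorem adj_iff (hd : H.IsDrawing pos) (u v : V) : H.graph.Adj u v ↔
    H.nbr u .east = some v ∨ H.nbr v .east = some u ∨ H.nbr u .north = some v ∨
      H.nbr v .north = some u := by
  constructor
  · rintro ⟨-, d, h⟩
    cases d
    · exact .inl h
    · exact .inr (.inr (.inl h))
    · exact .inr (.inl ((H.nbr_opp u v _).1 h))
    · exact .inr (.inr (.inr ((H.nbr_opp u v _).1 h)))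
  · have hE : ∀ u v, H.nbr u .east = some v → H.graph.Adj u v := fun u v h =>
      ⟨fun e => (hd.horizontal u v h).1.ne (by rw [e]), _, h⟩
    have hN : ∀ u v, H.nbr u .north = some v → H.graph.Adj u v := fun u v h =>
      ⟨fun e => (hd.vertical u v h).2.ne (by rw [e]), _, h⟩
    rintro (h | h | h | h)
    · exact hE _ _ h
    · exact (hE _ _ h).symm
    · exact hN _ _ h
    · exact (hN _ _ h).symm

theorem mem_segment_east (hd : H.IsDrawing pos) {u v : V} (h : H.nbr u .east = some v)
    (p : Plane) : p ∈ segment ℝ (pos u) (pos v) ↔ p 1 = pos u 1 ∧ pos u 0 ≤ p 0 ∧ p 0 ≤ pos v 0 :=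
  mem_segment_of_eq (by decide) (hd.horizontal u v h).2 (hd.horizontal u v h).1.le

theorem mem_segment_north (hd : H.IsDrawing pos) {u v : V} (h : H.nbr u .north = some v)
    (p : Plane) : p ∈ segment ℝ (pos u) (pos v) ↔ p 0 = pos u 0 ∧ pos u 1 ≤ p 1 ∧ p 1 ≤ pos v 1 :=
  mem_segment_of_eq (by decide) (hd.vertical u v h).1 (hd.vertical u v h).2.le

theorem layout_car (hd : H.IsDrawing pos) (a b : ℝ) :
    (layout H Sx Sy pos).Car a b ↔ !₂[a, b] ∈ H.carrier pos := by
  constructor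
  · rintro (⟨φ, u, v, huv, h1, h2, h3, -⟩ | ⟨φ, u, v, huv, h1, h2, h3, -⟩)
    · rcases huv with rfl | huv
      · left
        exact ⟨u, by ext i; fin_cases i; exacts [h1, le_antisymm h2 h3]⟩
      · right
        exact ⟨u, v, (adj_iff hd u v).2 (by tauto),
          (mem_segment_north hd huv _).2 ⟨h1.symm, h2, h3⟩⟩
    · rcases huv with rfl | huv
      · left
        exact ⟨u, by ext i; fin_cases i; exacts [le_antisymm h2 h3, h1]⟩
      · right
        exact ⟨u, v, (adj_iff hd u v).2 (by tauto),
          (mem_segment_east hd huv _).2 ⟨h1.symm, h2, h3⟩⟩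
  · rintro (⟨u, hu⟩ | ⟨u, v, huv, hp⟩)
    · have := (layout H Sx Sy pos).car_vertex u
      simpa [layout, hu] using this
    · have hE : ∀ u v, H.nbr u .east = some v → !₂[a, b] ∈ segment ℝ (pos u) (pos v) →
          (layout H Sx Sy pos).Car a b := fun u v huv h => by
        obtain ⟨h1, h2, h3⟩ := (mem_segment_east hd huv _).1 h
        exact .inr ⟨_, u, v, .inr huv, h1.symm, h2, h3, rfl⟩
      have hN : ∀ u v, H.nbr u .north = some v → !₂[a, b] ∈ segment ℝ (pos u) (pos v) →
          (layout H Sx Sy pos).Car a b := fun u v huv h => by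
        obtain ⟨h1, h2, h3⟩ := (mem_segment_north hd huv _).1 h
        exact .inl ⟨_, u, v, .inr huv, h1.symm, h2, h3, rfl⟩
      rcases (adj_iff hd u v).1 huv with h | h | h | h
      · exact hE _ _ h hp
      · exact hE _ _ h (segment_symm ℝ (pos u) (pos v) ▸ hp)
      · exact hN _ _ h hp
      · exact hN _ _ h (segment_symm ℝ (pos u) (pos v) ▸ hp)

/-- The condition on crossings speaks of pairs of edges only; connectivity supplies an edge at `z`
to which it can be applied. -/
theorem eq_endpoint (hd : H.IsDrawing pos) (hconn : H.graph.Connected) {u v z : V}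
    (huv : H.graph.Adj u v) (hz : pos z ∈ segment ℝ (pos u) (pos v)) : z = u ∨ z = v := by
  have : Nontrivial V := ⟨u, v, huv.ne⟩
  obtain ⟨z', hz'⟩ := hconn.preconnected.exists_adj_of_nontrivial z
  by_cases hs : s(u, v) = s(z, z')
  · rcases Sym2.eq_iff.1 hs with h | h
    · exact .inl h.1.symm
    · exact .inr h.2.symm
  · obtain ⟨w, hw, -, h⟩ := hd.crossing_free u v z z' huv hz' hs (pos z)
      ⟨hz, left_mem_segment ℝ _ _⟩
    rw [hd.injective h]
    exact hw

theorem common_endpoint (hd : H.IsDrawing pos) {u v u' v' : V} (huv : H.graph.Adj u v)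
    (huv' : H.graph.Adj u' v') {p : Plane} (h : p ∈ segment ℝ (pos u) (pos v))
    (h' : p ∈ segment ℝ (pos u') (pos v')) :
    ∃ w, (w = u ∨ w = v) ∧ (w = u' ∨ w = v') := by
  by_cases hs : s(u, v) = s(u', v')
  · rcases Sym2.eq_iff.1 hs with h | h
    · exact ⟨u, by tauto⟩
    · exact ⟨u, by tauto⟩
  · obtain ⟨w, hw, hw', -⟩ := hd.crossing_free u v u' v' huv huv' hs p ⟨h, h'⟩
    exact ⟨w, hw, hw'⟩

/-- From here on, faces and the region enter only through the axioms of a layout. The orderings need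
not be good for this. -/
theorem layout_valid [Finite V] (hc : H.IsConvexDrawing pos) (hconn : H.graph.Connected) :
    (layout H Sx Sy pos).Valid := by
  have hd := hc.isDrawing
  have E_fun : ∀ {u v w : V}, H.nbr u .east = some v → H.nbr u .east = some w → v = w :=
    fun h h' => Option.some_injective _ (h.symm.trans h')
  have N_fun : ∀ {u v w : V}, H.nbr u .north = some v → H.nbr u .north = some w → v = w :=
    fun h h' => Option.some_injective _ (h.symm.trans h')
  have E_inj : ∀ {u v w : V}, H.nbr v .east = some u → H.nbr w .east = some u → v = w :=
    fun h h' => Option.some_injective _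
      (((H.nbr_opp _ _ _).1 h).symm.trans ((H.nbr_opp _ _ _).1 h'))
  have N_inj : ∀ {u v w : V}, H.nbr v .north = some u → H.nbr w .north = some u → v = w :=
    fun h h' => Option.some_injective _
      (((H.nbr_opp _ _ _).1 h).symm.trans ((H.nbr_opp _ _ _).1 h'))
  have E_g : ∀ {u v : V}, H.nbr u .east = some v → H.cy u = H.cy v := fun h =>
    Quotient.sound (EqvGen.rel _ _ h)
  have N_f : ∀ {u v : V}, H.nbr u .north = some v → H.cx u = H.cx v := fun h =>
    Quotient.sound (EqvGen.rel _ _ h)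
  have adjE : ∀ {u v : V}, H.nbr u .east = some v → H.graph.Adj u v := fun h =>
    (adj_iff hd _ _).2 (.inl h)
  have adjN : ∀ {u v : V}, H.nbr u .north = some v → H.graph.Adj u v := fun h =>
    (adj_iff hd _ _).2 (.inr (.inr (.inl h)))
  have vtxV : ∀ {z a b : V}, H.nbr a .north = some b → pos z 0 = pos a 0 → pos a 1 ≤ pos z 1 →
      pos z 1 ≤ pos b 1 → z = a ∨ z = b := fun h h1 h2 h3 =>
    eq_endpoint hd hconn (adjN h) ((mem_segment_north hd h _).2 ⟨h1, h2, h3⟩)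
  have vtxH : ∀ {z a b : V}, H.nbr a .east = some b → pos z 1 = pos a 1 → pos a 0 ≤ pos z 0 →
      pos z 0 ≤ pos b 0 → z = a ∨ z = b := fun h h1 h2 h3 =>
    eq_endpoint hd hconn (adjE h) ((mem_segment_east hd h _).2 ⟨h1, h2, h3⟩)
  have inj : ∀ {u v : V}, pos u 0 = pos v 0 → pos u 1 = pos v 1 → u = v := fun h h' =>
    hd.injective (by ext i; fin_cases i; exacts [h, h'])
  refine
    { E_x := fun h => (hd.horizontal _ _ h).1
      E_y := fun h => (hd.horizontal _ _ h).2
      E_f := fun {u v} h => Int.ofNat_lt.2 (Sx.increasing _ _ ⟨u, v, rfl, rfl, h⟩)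
      E_g := fun h => by simp only [layout, E_g h]
      N_x := fun h => (hd.vertical _ _ h).1
      N_y := fun h => (hd.vertical _ _ h).2
      N_f := fun h => by simp only [layout, N_f h]
      N_g := fun {u v} h => Int.ofNat_lt.2 (Sy.increasing _ _ ⟨u, v, rfl, rfl, h⟩)
      E_fun := E_fun, E_inj := E_inj, N_fun := N_fun, N_inj := N_inj
      inj := inj
      vtxV := vtxV
      vtxH := vtxH
      meet := ?_, uniqV := ?_, uniqH := ?_, col := ?_, row := ?_, conn := ?_, convH := ?_
      convV := ?_, car_reg := ?_, rect := ?_ }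
  · intro u w a b hE hN h1 h2 h3 h4
    exact common_endpoint hd (adjE hE) (adjN hN) (p := !₂[pos a 0, pos u 1])
      ((mem_segment_east hd hE _).2 ⟨rfl, h1, h2⟩) ((mem_segment_north hd hN _).2 ⟨rfl, h3, h4⟩)
  · rintro a b φ φ' ⟨u, v, huv, h1, h2, h3, rfl⟩ ⟨u', v', huv', h1', h2', h3', rfl⟩
    have key : ∃ w, (w = u ∨ w = v) ∧ (w = u' ∨ w = v') := by
      rcases huv with rfl | huv
      · rcases huv' with rfl | huv'
        · exact ⟨u, .inl rfl, .inl (inj (h1.trans h1'.symm) (le_antisymm (h2.trans h3') (h2'.trans h3)))⟩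
        · exact ⟨u, .inl rfl, vtxV huv' (h1.trans h1'.symm) (h2'.trans h3) (h2.trans h3')⟩
      · rcases huv' with rfl | huv'
        · exact ⟨u', vtxV huv (h1'.trans h1.symm) (h2.trans h3') (h2'.trans h3), .inl rfl⟩
        · exact common_endpoint hd (adjN huv) (adjN huv') (p := !₂[a, b])
            ((mem_segment_north hd huv _).2 ⟨h1.symm, h2, h3⟩)
            ((mem_segment_north hd huv' _).2 ⟨h1'.symm, h2', h3'⟩)
    have e : H.cx u = H.cx v := huv.elim (fun h => by rw [h]) N_f
    have e' : H.cx u' = H.cx v' := huv'.elim (fun h => by rw [h]) N_f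
    obtain ⟨w, hw, hw'⟩ := key
    have i : H.cx w = H.cx u := hw.elim (fun h => by rw [h]) fun h => by rw [h, e]
    have i' : H.cx w = H.cx u' := hw'.elim (fun h => by rw [h]) fun h => by rw [h, e']
    simp only [layout, ← i, ← i']
  · rintro a b φ φ' ⟨u, v, huv, h1, h2, h3, rfl⟩ ⟨u', v', huv', h1', h2', h3', rfl⟩
    have key : ∃ w, (w = u ∨ w = v) ∧ (w = u' ∨ w = v') := by
      rcases huv with rfl | huv
      · rcases huv' with rfl | huv'
        · exact ⟨u, .inl rfl, .inl (inj (le_antisymm (h2.trans h3') (h2'.trans h3)) (h1.trans h1'.symm))⟩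
        · exact ⟨u, .inl rfl, vtxH huv' (h1.trans h1'.symm) (h2'.trans h3) (h2.trans h3')⟩
      · rcases huv' with rfl | huv'
        · exact ⟨u', vtxH huv (h1'.trans h1.symm) (h2.trans h3') (h2'.trans h3), .inl rfl⟩
        · exact common_endpoint hd (adjE huv) (adjE huv') (p := !₂[a, b])
            ((mem_segment_east hd huv _).2 ⟨h1.symm, h2, h3⟩)
            ((mem_segment_east hd huv' _).2 ⟨h1'.symm, h2', h3'⟩)
    have e : H.cy u = H.cy v := huv.elim (fun h => by rw [h]) E_g
    have e' : H.cy u' = H.cy v' := huv'.elim (fun h => by rw [h]) E_g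
    obtain ⟨w, hw, hw'⟩ := key
    have i : H.cy w = H.cy u := hw.elim (fun h => by rw [h]) fun h => by rw [h, e]
    have i' : H.cy w = H.cy u' := hw'.elim (fun h => by rw [h]) fun h => by rw [h, e']
    simp only [layout, ← i, ← i']
  · intro u v h
    have h' : H.cx u = H.cx v := Sx.index.injective (Fin.ext (Int.ofNat_inj.1 h))
    exact total_of_eqvGen (r := fun u v => H.nbr u .north = some v) N_fun N_inj (Quotient.exact h')
  · intro u v h
    have h' : H.cy u = H.cy v := Sy.index.injective (Fin.ext (Int.ofNat_inj.1 h))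
    exact total_of_eqvGen (r := fun u v => H.nbr u .east = some v) E_fun E_inj (Quotient.exact h')
  · intro u v
    exact ReflTransGen.mono (fun a b h => (adj_iff hd a b).1 h) u v
      ((SimpleGraph.reachable_iff_reflTransGen u v).1 (hconn.preconnected u v))
  · intro a b c t ha hb h1 h2
    refine ((hc.external_orthoconvex 1 t).segment_subset ⟨ha, rfl⟩ ⟨hb, rfl⟩
      ((mem_segment_of_eq (i := 0) (j := 1) (P := !₂[a, t]) (Q := !₂[b, t]) (p := !₂[c, t])
        (by decide) rfl (h1.trans h2)).2 ⟨rfl, h1, h2⟩)).1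
  · intro a b c s ha hb h1 h2
    refine ((hc.external_orthoconvex 0 s).segment_subset ⟨ha, rfl⟩ ⟨hb, rfl⟩
      ((mem_segment_of_eq (i := 1) (j := 0) (P := !₂[s, a]) (Q := !₂[s, b]) (p := !₂[s, c])
        (by decide) rfl (h1.trans h2)).2 ⟨rfl, h1, h2⟩)).1
  · intro a b h
    exact .inl ((layout_car hd a b).1 h)
  · intro p q hr hcar
    rw [layout_car hd] at hcar
    obtain ⟨a, b, c, d, hF⟩ := hc.internal_rectangle _ hcar (hr.resolve_left hcar)
    have hp : !₂[p, q] ∈ H.face pos !₂[p, q] := mem_connectedComponentIn hcar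
    rw [hF] at hp
    obtain ⟨⟨h1, h2⟩, h3, h4⟩ := hp
    refine ⟨a, b, c, d, h1, h2, h3, h4, fun s t i1 i2 i3 i4 i => ?_,
      fun s t i1 i2 i3 i4 i => ?_⟩
    · rw [layout_car hd] at i
      have : !₂[s, t] ∈ H.face pos !₂[p, q] := by rw [hF]; exact ⟨⟨i1, i2⟩, i3, i4⟩
      exact connectedComponentIn_subset _ _ this i
    · rw [layout_car hd]
      exact mem_of_mem_boundary (H.isClosed_carrier pos) (h1.trans h2) (h3.trans h4) hF i1 i2 i3 i4 i

end layout

end GreedyRect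

/-! ### The gap condition is necessary and sufficient -/

namespace GreedyRect

open Relation Set

/-- Coordinates `X` of columns numbered by `f` such that, for consecutive columns, the gap between
them exceeds the distance that the nearest neighbours of one of them have to the other one; the
numbering satisfies a connectivity condition on its strips. -/
structure Adapted {V : Type*} (E : V → V → Prop) (f X : V → ℤ) : Prop where
  mono : ∀ u v, X u < X v ↔ f u < f v
  contig : ∀ u v k, f u ≤ k → k ≤ f v → ∃ z, f z = k
  good : ∀ p q i a b j, f p ≤ i → i < a → a ≤ b → b < j → j ≤ f q →
    ∃ u w, E u w ∧ i ≤ f u ∧ f w ≤ j ∧ ((a ≤ f u ∧ f u ≤ b) ↔ ¬ (a ≤ f w ∧ f w ≤ b))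
  right : ∀ a b, f b = f a + 1 → ∃ z w, f z = f a ∧ E z w ∧ X w - X b < X b - X a
  left : ∀ a b, f b = f a + 1 → ∃ z w, f w = f b ∧ E z w ∧ X a - X z < X b - X a

namespace Adapted

variable {V : Type*} {E : V → V → Prop} {f X : V → ℤ}

theorem le_iff (h : Adapted E f X) (u v : V) : X u ≤ X v ↔ f u ≤ f v := by
  rw [← not_lt, ← not_lt, h.mono]

theorem eq_iff (h : Adapted E f X) (u v : V) : X u = X v ↔ f u = f v := by
  simp only [le_antisymm_iff, h.le_iff]

theorem reflect (h : Adapted E f X) :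
    Adapted (fun u v => E v u) (fun v => -f v) (fun v => -X v) where
  mono u v := by simp only [neg_lt_neg_iff, h.mono]
  contig u v k h1 h2 := by
    obtain ⟨z, hz⟩ := h.contig v u (-k) (by lia) (by lia)
    exact ⟨z, by lia⟩
  good p q i a b j h1 h2 h3 h4 h5 := by
    obtain ⟨u, w, i1, i2, i3, i4⟩ := h.good q p (-j) (-b) (-a) (-i) (by lia) (by lia) (by lia)
      (by lia) (by lia)
    exact ⟨w, u, i1, by lia, by lia, by lia⟩
  right a b hab := by
    obtain ⟨z, w, h1, h2, h3⟩ := h.left b a (by lia)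
    exact ⟨w, z, by lia, h2, by lia⟩
  left a b hab := by
    obtain ⟨z, w, h1, h2, h3⟩ := h.right b a (by lia)
    exact ⟨w, z, by lia, h2, by lia⟩

end Adapted

namespace Layout

variable {V : Type*} {C : Layout V}

theorem Valid.injective_of (hC : C.Valid) {u v : V} (hf : C.f u = C.f v) (hg : C.g u = C.g v) :
    u = v := by
  rcases hC.row hg with h | h <;> rcases h.cases_head with h | ⟨w, h, h'⟩
  · exact h
  · have := hC.E_f h
    have := (hC.chain_x h').2.1
    lia
  · exact h.symm
  · have := hC.E_f h
    have := (hC.chain_x h').2.1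
    lia

theorem exists_step_across {N : V → V → Prop} {g : V → ℤ} {γ : ℤ} {s t : V}
    (h : ReflTransGen N s t) (hs : g s ≤ γ) (ht : γ < g t) :
    ∃ a b, ReflTransGen N s a ∧ N a b ∧ g a ≤ γ ∧ γ < g b := by
  induction h with
  | refl => lia
  | @tail a b h hab ih =>
    rcases le_or_gt (g a) γ with h' | h'
    · exact ⟨a, b, h, hab, h', ht⟩
    · exact ih h'

/-- A column between the end-vertices of a horizontal edge is above or below that edge. -/
theorem Valid.column_side [Finite V] (hC : C.Valid) {u w s t : V} (hE : C.E u w)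
    (hst : C.f s = C.f t) (h1 : C.f u < C.f s) (h2 : C.f s < C.f w) (ht : C.g u < C.g t) :
    C.g u < C.g s := by
  by_contra! hs
  have hch : ReflTransGen C.N s t := by
    refine (hC.col hst).resolve_right fun h => ?_
    have : C.g t ≤ C.g s := (hC.transpose.chain_x h).2.1
    lia
  -- A column with vertices on both sides would cross the edge at a common end-vertex, but its
  -- number differs from those of `u` and `w`.
  obtain ⟨a, b, hsa, hab, ha, hb⟩ := exists_step_across hch hs ht
  have hfa : C.f s = C.f a := (hC.transpose.chain_x hsa).2.2.2
  obtain ⟨z, hz, hz'⟩ := hC.exists_common hE hab (by lia) (by lia) ha hb.le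
  have hfb := hC.N_f hab
  rcases hz with rfl | rfl <;> rcases hz' with rfl | rfl <;> lia

/-- If `u` has no upper neighbour, its right neighbour is closer to any vertex above the edge
joining them. -/
theorem Valid.closer_right [Finite V] (hC : C.Valid) {X : V → ℤ} (hX : Adapted C.E C.f X)
    {u v w : V} (hE : C.E u w) (hN : ∀ z, ¬ C.N u z) (h1 : C.f u < C.f v)
    (h3 : C.g u < C.g v) : X w - X v < X v - X u := by
  -- `A k`: column `k` has a vertex above the row of `u`. The column of `u` does not, since `u` has
  -- no upper neighbour; the column of `v` does.
  set A : ℤ → Prop := fun k => ∃ z, C.f z = k ∧ C.g u < C.g z with hA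
  have hAu : ¬ A (C.f u) := by
    rintro ⟨z, hz, hz'⟩
    obtain ⟨w, hw, -⟩ := hC.transpose.row_step_f (u := u) (v := z) hz.symm hz'
    exact hN w hw
  have hcol : ∀ z, C.f u < C.f z → C.f z < C.f w → A (C.f z) → C.g u < C.g z := by
    rintro z i1 i2 ⟨t, ht, ht'⟩
    exact hC.column_side hE ht.symm i1 i2 ht'
  obtain ⟨k, ⟨hk1, hk2, hk3⟩, hkmax⟩ := Int.exists_greatest_of_bdd
    (P := fun k => C.f u ≤ k ∧ k < C.f v ∧ ¬ A k) ⟨C.f v, fun z hz => hz.2.1.le⟩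
    ⟨C.f u, le_rfl, h1, hAu⟩
  -- With `k` the last column before `v` that fails `A`, suppose `c` is the next failing one before
  -- `w`. Goodness gives an edge leaving the block between `k` and `c` inside the strip. Its end in
  -- the block lies above the row of `u`, hence so does its end in column `k` or `c`.
  have hbetween : ∀ c, k < c → c < C.f w → A c := by
    by_contra! hcon
    obtain ⟨c₀, hc₀⟩ := hcon
    obtain ⟨c, ⟨hc1, hc2, hc3⟩, hcmin⟩ := Int.exists_least_of_bdd
      (P := fun c => k < c ∧ c < C.f w ∧ ¬ A c) ⟨k, fun z hz => hz.1.le⟩ ⟨c₀, hc₀⟩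
    have hcv : C.f v < c := by
      by_contra! hcv
      rcases hcv.eq_or_lt with rfl | hcv
      · exact hc3 ⟨v, rfl, h3⟩
      · have := hkmax c ⟨by lia, hcv, hc3⟩
        lia
    have hAin : ∀ c', k < c' → c' < c → A c' := fun c' i1 i2 => by
      by_contra hn
      have := hcmin c' ⟨i1, by lia, hn⟩
      lia
    obtain ⟨z, z', hz, i1, i2, i3⟩ := hX.good u w k (k + 1) (c - 1) c hk1 (by lia) (by lia)
      (by lia) hc2.le
    have hzf := hC.E_f hz
    have hzg := hC.E_g hz
    by_cases hin : k + 1 ≤ C.f z ∧ C.f z ≤ c - 1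
    · have := hcol z (by lia) (by lia) (hAin _ (by lia) (by lia))
      exact hc3 ⟨z', by lia, by lia⟩
    · have := hcol z' (by lia) (by lia) (hAin _ (by lia) (by lia))
      exact hk3 ⟨z, by lia, by lia⟩
  obtain ⟨a, ha⟩ := hX.contig u v k hk1 hk2.le
  obtain ⟨b, hb⟩ := hX.contig u v (k + 1) (by lia) (by lia)
  obtain ⟨z, w', hz, hzw, hlt⟩ := hX.right a b (by lia)
  -- By the same argument, an edge from column `k` to the right cannot end before the column of `w`.
  -- So the gap after `k`, which lies between `u` and `v`, exceeds the distance from column `k + 1`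
  -- to `w`, and hence that from `v` to `w`.
  have hw' : C.f w ≤ C.f w' := by
    by_contra! hlt'
    have hzf := hC.E_f hzw
    have := hcol w' (by lia) hlt' (hbetween _ (by lia) hlt')
    have hzg := hC.E_g hzw
    exact hk3 ⟨z, by lia, by lia⟩
  have j1 := (hX.le_iff w w').2 hw'
  have j2 := (hX.le_iff b v).2 (by lia)
  have j3 := (hX.le_iff u a).2 (by lia)
  lia

/-- `w` is a neighbour of `u` that is closer to `v` in the placement `X`, `Y`. -/
def Closer (C : Layout V) (X Y : V → ℤ) (v u w : V) : Prop :=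
  (C.E u w ∨ C.E w u ∨ C.N u w ∨ C.N w u) ∧
    (X w - X v) ^ 2 + (Y w - Y v) ^ 2 < (X u - X v) ^ 2 + (Y u - Y v) ^ 2

theorem Closer.transpose {X Y : V → ℤ} {v u w : V} (h : C.transpose.Closer Y X v u w) :
    C.Closer X Y v u w :=
  ⟨by have := h.1; simp only [Layout.transpose] at this; tauto, by have := h.2; lia⟩

theorem Closer.reflect {X Y : V → ℤ} {v u w : V}
    (h : C.reflect.Closer (fun v => -X v) Y v u w) : C.Closer X Y v u w :=
  ⟨by have := h.1; simp only [Layout.reflect] at this; tauto, by have := h.2; grind⟩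

theorem closer_reflect {X Y : V → ℤ} {v u w : V} (h : C.Closer X Y v u w) :
    C.reflect.Closer (fun v => -X v) Y v u w :=
  ⟨by have := h.1; simp only [Layout.reflect]; tauto, by have := h.2; grind⟩

theorem closer_transpose {X Y : V → ℤ} {v u w : V} (h : C.Closer X Y v u w) :
    C.transpose.Closer Y X v u w :=
  ⟨by have := h.1; simp only [Layout.transpose]; tauto, by have := h.2; lia⟩

theorem Valid.closer_of_lt (hC : C.Valid) {X Y : V → ℤ} (hX : Adapted C.E C.f X)
    (hY : Adapted C.N C.g Y) {u v w : V} (hE : C.E u w) (h : X w - X v < X v - X u) :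
    C.Closer X Y v u w := by
  refine ⟨.inl hE, ?_⟩
  rw [(hY.eq_iff u w).2 (hC.E_g hE)]
  nlinarith [(hX.mono u w).2 (hC.E_f hE)]

/-- A step that does not pass `v` is always good. If the right neighbour passes `v`, an upper
neighbour does not (`not_between`); if only one of the two neighbours exists and it passes `v`, the
gap condition applies (`closer_right`); one of them exists by `not_later`. -/
theorem Valid.exists_closer_of_le [Finite V] (hC : C.Valid) {X Y : V → ℤ}
    (hX : Adapted C.E C.f X) (hY : Adapted C.N C.g Y) {u v : V} (huv : u ≠ v)
    (hf : C.f u ≤ C.f v) (hg : C.g u ≤ C.g v) : ∃ w, C.Closer X Y v u w := by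
  have key : ∀ {C : Layout V} {X Y : V → ℤ}, C.Valid → Adapted C.E C.f X → Adapted C.N C.g Y →
      C.f u < C.f v → C.g u = C.g v → ∃ w, C.Closer X Y v u w := by
    intro C X Y hC hX hY hf hg
    obtain ⟨w, hw, hc⟩ := hC.row_step_f hg hf
    have h1 := (hX.le_iff w v).2 (hC.chain_x hc).2.1
    have h2 := (hX.mono u v).2 hf
    exact ⟨w, hC.closer_of_lt hX hY hw (by lia)⟩
  rcases hf.eq_or_lt with hf | hf
  · rcases hg.eq_or_lt with hg | hg
    · exact absurd (hC.injective_of hf hg) huv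
    · obtain ⟨w, hw⟩ := key hC.transpose hY hX hg hf
      exact ⟨w, hw.transpose⟩
  rcases hg.eq_or_lt with hg | hg
  · exact key hC hX hY hf hg
  have h2 := (hX.mono u v).2 hf
  have h2' := (hY.mono u v).2 hg
  by_cases hE : ∃ w, C.E u w
  · obtain ⟨w, hw⟩ := hE
    rcases le_or_gt (C.f w) (C.f v) with h | h
    · have h1 := (hX.le_iff w v).2 h
      exact ⟨w, hC.closer_of_lt hX hY hw (by lia)⟩
    by_cases hN : ∃ z, C.N u z
    · obtain ⟨z, hz⟩ := hN
      have h1 := (hY.le_iff z v).2 (hC.not_between hw hz hf h hg)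
      exact ⟨z, (hC.transpose.closer_of_lt hY hX hz (by lia)).transpose⟩
    · push Not at hN
      exact ⟨w, hC.closer_of_lt hX hY hw (hC.closer_right hX hw hN hf hg)⟩
  · push Not at hE
    by_cases hN : ∃ z, C.N u z
    · obtain ⟨z, hz⟩ := hN
      rcases le_or_gt (C.g z) (C.g v) with h | h
      · have h1 := (hY.le_iff z v).2 h
        exact ⟨z, (hC.transpose.closer_of_lt hY hX hz (by lia)).transpose⟩
      · exact ⟨z, (hC.transpose.closer_of_lt hY hX hz
          (hC.transpose.closer_right hY hz hE hg hf)).transpose⟩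
    · push Not at hN
      exact absurd (hC.not_later hN hE hf) (not_le.2 hg)

theorem Valid.exists_closer [Finite V] (hC : C.Valid) {X Y : V → ℤ}
    (hX : Adapted C.E C.f X) (hY : Adapted C.N C.g Y) {u v : V} (huv : u ≠ v) :
    ∃ w, C.Closer X Y v u w := by
  have key : ∀ {C : Layout V} {X Y : V → ℤ}, C.Valid → Adapted C.E C.f X → Adapted C.N C.g Y →
      C.g u ≤ C.g v → ∃ w, C.Closer X Y v u w := by
    intro C X Y hC hX hY hg
    rcases le_total (C.f u) (C.f v) with hf | hf
    · exact hC.exists_closer_of_le hX hY huv hf hg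
    · obtain ⟨w, hw⟩ := hC.reflect.exists_closer_of_le hX.reflect hY huv
        (neg_le_neg hf) hg
      exact ⟨w, hw.reflect⟩
  rcases le_total (C.g u) (C.g v) with hg | hg
  · exact key hC hX hY hg
  · obtain ⟨w, hw⟩ := key (Y := fun v => -Y v) hC.transpose.reflect.transpose hX
      hY.reflect (neg_le_neg hg)
    exact ⟨w, (Closer.reflect (C := C.transpose) (X := Y) (Y := X) (closer_transpose hw)).transpose⟩

/-- If a path whose vertices get closer to `b` leaves the column before that of `b`, the gap between
the two columns is large. -/
theorem Valid.gap_of_path (hC : C.Valid) {X Y : V → ℤ} (hX : ∀ u v, X u < X v ↔ C.f u < C.f v)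
    (hY : ∀ u v, Y u < Y v ↔ C.g u < C.g v) {a b : V} (hab : C.f b = C.f a + 1)
    (h : ReflTransGen (C.Closer X Y b) a b) :
    ∃ z w, C.f z = C.f a ∧ C.E z w ∧ X w - X b < X b - X a := by
  have eqX : ∀ {u v}, C.f u = C.f v → X u = X v := fun {u v} h => by
    have := hX u v; have := hX v u; lia
  have eqY : ∀ {u v}, C.g u = C.g v → Y u = Y v := fun {u v} h => by
    have := hY u v; have := hY v u; lia
  -- Vertical steps stay in the column and a step to the left would increase the distance, so the
  -- first horizontal step of the path goes to the right.
  have key : ∀ z, ReflTransGen (C.Closer X Y b) z b → C.f z = C.f a →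
      ∃ z w, C.f z = C.f a ∧ C.E z w ∧ X w - X b < X b - X a := by
    intro z hz
    induction hz using ReflTransGen.head_induction_on with
    | refl => lia
    | @head z w hzw _ ih =>
      intro hza
      have hXz := eqX hza
      have hXb := (hX z b).2 (by lia)
      obtain ⟨h | h | h | h, hlt⟩ := hzw
      · have := (hX z w).2 (hC.E_f h)
        rw [eqY (hC.E_g h)] at hlt
        exact ⟨z, w, hza, h, by nlinarith⟩
      · have := (hX w z).2 (hC.E_f h)
        rw [eqY (hC.E_g h)] at hlt
        nlinarith
      · exact ih (by rw [← hC.N_f h, hza])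
      · exact ih (by rw [hC.N_f h, hza])
  exact key a h rfl

section planarity

variable {X Y : V → ℤ}

theorem Valid.meet_of_row (hC : C.Valid) (hX : Adapted C.E C.f X) (hY : Adapted C.N C.g Y)
    {u w u' w' : V} (hE : C.E u w) (hE' : C.E u' w') (hne : u ≠ u') {p : ℝ} (hg : Y u = Y u')
    (h1 : X u ≤ p) (h2 : p ≤ X w) (h1' : X u' ≤ p) (h2' : p ≤ X w') :
    ∃ z, (z = u ∨ z = w) ∧ (z = u' ∨ z = w') ∧ X z = p ∧ Y z = Y u := by
  have key : ∀ {u w u' w' : V}, C.E u w → u ≠ u' → Y u = Y u' → p ≤ X w → X u' ≤ p →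
      ReflTransGen C.E u u' → w = u' ∧ X w = p := by
    intro u w u' w' hE hne hg h2 h1' hch
    obtain h | ⟨t, ht, hc⟩ := hch.cases_head
    · exact absurd h hne
    · obtain rfl := hC.E_fun hE ht
      have i1 : (X w : ℝ) ≤ X u' := by exact_mod_cast (hX.le_iff w u').2 (hC.chain_x hc).2.1
      have i2 : (X w : ℝ) = X u' := le_antisymm i1 (h1'.trans h2)
      refine ⟨hC.injective_of ((hX.eq_iff _ _).1 (by exact_mod_cast i2)) (hC.chain_x hc).2.2.2, ?_⟩
      exact le_antisymm (i1.trans h1') h2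
  rcases hC.row ((hY.eq_iff _ _).1 hg) with h | h
  · obtain ⟨rfl, hp⟩ := key (w' := w') hE hne hg h2 h1' h
    exact ⟨w, .inr rfl, .inl rfl, hp, hg.symm⟩
  · obtain ⟨rfl, hp⟩ := key (w' := w) hE' hne.symm hg.symm h2' h1 h
    exact ⟨w', .inl rfl, .inr rfl, hp, rfl⟩

theorem Valid.meet_of_cross [Finite V] (hC : C.Valid) (hX : Adapted C.E C.f X)
    (hY : Adapted C.N C.g Y) {u w a b : V} (hE : C.E u w) (hN : C.N a b)
    (h1 : X u ≤ X a) (h2 : X a ≤ X w) (h3 : Y a ≤ Y u) (h4 : Y u ≤ Y b) :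
    ∃ z, (z = u ∨ z = w) ∧ (z = a ∨ z = b) ∧ X z = X a ∧ Y z = Y u := by
  obtain ⟨z, hz, hz'⟩ := hC.exists_common hE hN ((hX.le_iff _ _).1 h1) ((hX.le_iff _ _).1 h2)
    ((hY.le_iff _ _).1 h3) ((hY.le_iff _ _).1 h4)
  refine ⟨z, hz, hz', (hX.eq_iff _ _).2 ?_, (hY.eq_iff _ _).2 ?_⟩
  · rcases hz' with rfl | rfl
    · rfl
    · exact (hC.N_f hN).symm
  · rcases hz with rfl | rfl
    · rfl
    · exact (hC.E_g hE).symm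

end planarity

end Layout
end GreedyRect

/-! ### Good orderings, greedy paths and planarity of new placements -/

namespace GreedyRect

open Relation Set

/-- Goodness in the form used throughout: no block strictly inside a strip is separated from the
rest of the strip. -/
theorem StOrdering.exists_leaving {N : Type*} {D : Digraph N} (S : StOrdering D) (hS : S.IsGood)
    {i a b j : Fin S.length} (hia : i < a) (hab : a ≤ b) (hbj : b < j) :
    ∃ A B, D.Adj A B ∧ i ≤ S.index A ∧ S.index B ≤ j ∧
      ((a ≤ S.index A ∧ S.index A ≤ b) ↔ ¬ (a ≤ S.index B ∧ S.index B ≤ b)) := by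
  classical
  by_contra hno
  have hmid : ∀ x y, (S.strip i j).Adj x y →
      ((a ≤ S.index x.1 ∧ S.index x.1 ≤ b) ↔ (a ≤ S.index y.1 ∧ S.index y.1 ≤ b)) := by
    rintro x y ⟨-, h | h⟩
    · by_contra hc
      exact hno ⟨x.1, y.1, h, x.2.1, y.2.2, by tauto⟩
    · by_contra hc
      exact hno ⟨y.1, x.1, h, y.2.1, x.2.2, by tauto⟩
  have hreach : ∀ x y, (S.strip i j).Reachable x y →
      ((a ≤ S.index x.1 ∧ S.index x.1 ≤ b) ↔ (a ≤ S.index y.1 ∧ S.index y.1 ≤ b)) := by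
    intro x y h
    rw [SimpleGraph.reachable_iff_reflTransGen] at h
    induction h with
    | refl => rfl
    | tail _ h ih => exact ih.trans (hmid _ _ h)
  have : Finite N := Finite.of_equiv _ S.index.symm
  have : Fintype (S.strip i j).ConnectedComponent := Fintype.ofFinite _
  obtain ⟨hcard, htwo⟩ := hS i j (hia.trans (hab.trans_lt hbj))
  have h3 : ∀ c₁ c₂ c₃ : (S.strip i j).ConnectedComponent, c₁ ≠ c₂ → c₁ ≠ c₃ → c₂ ≠ c₃ →
      False := by
    intro c₁ c₂ c₃ h12 h13 h23
    have := Finset.card_le_univ {c₁, c₂, c₃}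
    rw [Finset.card_eq_three.2 ⟨c₁, c₂, c₃, h12, h13, h23, rfl⟩, ← Nat.card_eq_fintype_card] at this
    lia
  set xi : {A : N // i ≤ S.index A ∧ S.index A ≤ j} :=
    ⟨S.index.symm i, by simpa using (hia.trans (hab.trans_lt hbj)).le⟩
  set xa : {A : N // i ≤ S.index A ∧ S.index A ≤ j} :=
    ⟨S.index.symm a, by simpa using ⟨hia.le, (hab.trans_lt hbj).le⟩⟩
  set xj : {A : N // i ≤ S.index A ∧ S.index A ≤ j} :=
    ⟨S.index.symm j, by simpa using (hia.trans (hab.trans_lt hbj)).le⟩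
  have ii : S.index xi.1 = i := by simp [xi]
  have ia : S.index xa.1 = a := by simp [xa]
  have ij : S.index xj.1 = j := by simp [xj]
  set c := (S.strip i j).connectedComponentMk
  have hne : c xi ≠ c xa := fun h => by
    have := hreach _ _ (SimpleGraph.ConnectedComponent.exact h)
    rw [ii, ia] at this
    exact absurd (this.2 ⟨le_rfl, hab⟩).1 (not_le.2 hia)
  have hne' : c xj ≠ c xa := fun h => by
    have := hreach _ _ (SimpleGraph.ConnectedComponent.exact h)
    rw [ij, ia] at this
    exact absurd (this.2 ⟨le_rfl, hab⟩).2 (not_le.2 hbj)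
  -- A separated block would leave room for just one further component. That component contains both
  -- ends of the strip, so it neither precedes nor follows the block.
  have hij : c xi = c xj := by
    by_contra h
    exact h3 _ _ _ h hne hne'
  have hge : 2 ≤ Nat.card (S.strip i j).ConnectedComponent := by
    rw [Nat.card_eq_fintype_card, ← Finset.card_pair hne]
    exact Finset.card_le_univ _
  obtain ⟨C₁, C₂, hC, hlt⟩ := htwo (le_antisymm hcard hge)
  have hmem : ∀ x, c x = C₁ ∨ c x = C₂ := fun x => by
    by_contra! h
    exact h3 _ _ _ h.1 h.2 hC
  rcases hmem xi with h | h
  · have h' : c xa = C₂ := (hmem xa).resolve_left fun h' => hne (h.trans h'.symm)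
    have := hlt xj (hij.symm.trans h) xa h'
    rw [ij, ia] at this
    exact absurd (hab.trans_lt hbj) this.not_gt
  · have h' : c xa = C₁ := (hmem xa).resolve_right fun h' => hne (h.trans h'.symm)
    have := hlt xa h' xi h
    rw [ii, ia] at this
    exact absurd hia this.not_gt

section placement

variable {V : Type*} {X Y : V → ℤ}

theorem dist_gridPos_lt (u v w : V) :
    dist (gridPos X Y u) (gridPos X Y v) < dist (gridPos X Y w) (gridPos X Y v) ↔
      (X u - X v) ^ 2 + (Y u - Y v) ^ 2 < (X w - X v) ^ 2 + (Y w - Y v) ^ 2 := by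
  rw [EuclideanSpace.dist_eq, EuclideanSpace.dist_eq, Real.sqrt_lt_sqrt_iff (by positivity)]
  simp only [gridPos, Fin.sum_univ_two, Real.dist_eq, sq_abs, Matrix.cons_val_zero,
    Matrix.cons_val_one, Matrix.cons_val_fin_one]
  exact_mod_cast Iff.rfl

variable {H : RectRep V} {Sx : StOrdering H.Dx} {Sy : StOrdering H.Dy} {pos : V → Plane}

/-- Repeatedly move to a closer neighbour. The bound on the distances along the remaining walk shows
that no vertex is revisited. -/
theorem isGreedy_of_closer [Finite V] (hd : H.IsDrawing pos)
    (h : ∀ u v, u ≠ v → ∃ w, (layout H Sx Sy pos).Closer X Y v u w) :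
    IsGreedy H.graph (gridPos X Y) := by
  intro u v
  have key : ∀ u, ∃ p : H.graph.Walk u v, p.IsPath ∧ (∀ i < p.length,
      dist (gridPos X Y (p.getVert (i + 1))) (gridPos X Y v) <
        dist (gridPos X Y (p.getVert i)) (gridPos X Y v)) ∧
      ∀ z ∈ p.support, dist (gridPos X Y z) (gridPos X Y v) ≤
        dist (gridPos X Y u) (gridPos X Y v) := by
    refine Layout.climb (fun u => -dist (gridPos X Y u) (gridPos X Y v)) fun u ih => ?_
    by_cases huv : u = v
    · subst huv
      exact ⟨.nil, by simp, by simp, by simp⟩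
    · obtain ⟨w, hadj, hlt⟩ := h u v huv
      have hlt' := (dist_gridPos_lt w v u).2 hlt
      obtain ⟨p, hp, hdec, hsup⟩ := ih w (neg_lt_neg hlt')
      refine ⟨.cons ((adj_iff hd u w).2 hadj) p, ?_, ?_, ?_⟩
      · rw [SimpleGraph.Walk.cons_isPath_iff]
        exact ⟨hp, fun hu => (hsup u hu).not_gt hlt'⟩
      · rintro (_ | i) hi
        · simpa using hlt'
        · simpa using hdec i (by simpa using hi)
      · intro z hz
        rw [SimpleGraph.Walk.support_cons, List.mem_cons] at hz
        rcases hz with rfl | hz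
        · exact le_rfl
        · exact (hsup z hz).trans hlt'.le
  obtain ⟨p, hp, hdec, -⟩ := key u
  exact ⟨p, hp, hdec⟩

theorem reflTransGen_of_isGreedy (hd : H.IsDrawing pos) (h : IsGreedy H.graph (gridPos X Y))
    (u v : V) : ReflTransGen ((layout H Sx Sy pos).Closer X Y v) u v := by
  obtain ⟨p, -, hp⟩ := h u v
  induction p with
  | nil => exact .refl
  | @cons u w v huw p ih =>
    refine .head ⟨(adj_iff hd u w).1 huw, ?_⟩ (ih fun i hi => ?_)
    · have := hp 0 (by simp)
      rw [dist_gridPos_lt] at this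
      simpa using this
    · simpa using hp (i + 1) (by simpa using hi)

/-- Planarity depends only on the orders of the columns and rows. Perpendicular edges that meet also
cross in the orders, where `exists_common` applies; parallel edges that meet belong to one chain. -/
theorem isDrawing_of_adapted [Finite V] (hc : H.IsConvexDrawing pos) (hconn : H.graph.Connected)
    (hX : Adapted (layout H Sx Sy pos).E (layout H Sx Sy pos).f X)
    (hY : Adapted (layout H Sx Sy pos).N (layout H Sx Sy pos).g Y) :
    H.IsDrawing (gridPos X Y) := by
  have hC := layout_valid (Sx := Sx) (Sy := Sy) hc hconn
  have hE : ∀ u v, H.nbr u .east = some v → gridPos X Y u 0 < gridPos X Y v 0 ∧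
      gridPos X Y u 1 = gridPos X Y v 1 := fun u v h =>
    ⟨Int.cast_lt.2 ((hX.mono u v).2 (hC.E_f h)),
      congrArg (Int.cast (R := ℝ)) ((hY.eq_iff u v).2 (hC.E_g h))⟩
  have hN : ∀ u v, H.nbr u .north = some v → gridPos X Y u 0 = gridPos X Y v 0 ∧
      gridPos X Y u 1 < gridPos X Y v 1 := fun u v h =>
    ⟨congrArg (Int.cast (R := ℝ)) ((hX.eq_iff u v).2 (hC.N_f h)),
      Int.cast_lt.2 ((hY.mono u v).2 (hC.N_g h))⟩
  have segE : ∀ {u v}, H.nbr u .east = some v → ∀ p,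
      p ∈ segment ℝ (gridPos X Y u) (gridPos X Y v) → p 1 = Y u ∧ (X u : ℝ) ≤ p 0 ∧ p 0 ≤ X v :=
    fun {u v} h p hp => (mem_segment_of_eq (by decide) (hE u v h).2 (hE u v h).1.le).1 hp
  have segN : ∀ {u v}, H.nbr u .north = some v → ∀ p,
      p ∈ segment ℝ (gridPos X Y u) (gridPos X Y v) → p 0 = X u ∧ (Y u : ℝ) ≤ p 1 ∧ p 1 ≤ Y v :=
    fun {u v} h p hp => (mem_segment_of_eq (by decide) (hN u v h).1 (hN u v h).2.le).1 hp
  have oriented : ∀ u v, H.graph.Adj u v → ∃ a b, s(a, b) = s(u, v) ∧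
      segment ℝ (gridPos X Y a) (gridPos X Y b) = segment ℝ (gridPos X Y u) (gridPos X Y v) ∧
      (H.nbr a .east = some b ∨ H.nbr a .north = some b) := by
    intro u v h
    rcases (adj_iff hc.isDrawing u v).1 h with h | h | h | h
    · exact ⟨u, v, rfl, rfl, .inl h⟩
    · exact ⟨v, u, Sym2.eq_swap, segment_symm ℝ _ _, .inl h⟩
    · exact ⟨u, v, rfl, rfl, .inr h⟩
    · exact ⟨v, u, Sym2.eq_swap, segment_symm ℝ _ _, .inr h⟩
  have cross : ∀ {u w a b}, H.nbr u .east = some w → H.nbr a .north = some b → ∀ p,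
      p ∈ segment ℝ (gridPos X Y u) (gridPos X Y w) →
      p ∈ segment ℝ (gridPos X Y a) (gridPos X Y b) →
      ∃ z, (z = u ∨ z = w) ∧ (z = a ∨ z = b) ∧ (X z : ℝ) = p 0 ∧ (Y z : ℝ) = p 1 := by
    intro u w a b h h' p hp hp'
    obtain ⟨i1, i2, i3⟩ := segE h p hp
    obtain ⟨j1, j2, j3⟩ := segN h' p hp'
    rw [j1] at i2 i3
    rw [i1] at j2 j3
    obtain ⟨z, hz, hz', e1, e2⟩ := hC.meet_of_cross hX hY h h' (Int.cast_le.1 i2)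
      (Int.cast_le.1 i3) (Int.cast_le.1 j2) (Int.cast_le.1 j3)
    exact ⟨z, hz, hz', by rw [e1, j1], by rw [e2, i1]⟩
  refine ⟨fun u v h => ?_, hE, hN, fun u v u₁ v₁ h h₁ hne p hp => ?_⟩
  · have h0 : (X u : ℝ) = X v := congrArg (fun p : Plane => p 0) h
    have h1 : (Y u : ℝ) = Y v := congrArg (fun p : Plane => p 1) h
    exact hC.injective_of ((hX.eq_iff _ _).1 (by exact_mod_cast h0))
      ((hY.eq_iff _ _).1 (by exact_mod_cast h1))
  · obtain ⟨a, b, e, hs, hab⟩ := oriented u v h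
    obtain ⟨a₁, b₁, e₁, hs₁, hab₁⟩ := oriented u₁ v₁ h₁
    rw [← hs, ← hs₁] at hp
    rw [← e, ← e₁] at hne
    have key : ∃ z, (z = a ∨ z = b) ∧ (z = a₁ ∨ z = b₁) ∧ (X z : ℝ) = p 0 ∧ (Y z : ℝ) = p 1 := by
      rcases hab with hab | hab <;> rcases hab₁ with hab₁ | hab₁
      · obtain ⟨i1, i2, i3⟩ := segE hab p hp.1
        obtain ⟨j1, j2, j3⟩ := segE hab₁ p hp.2
        obtain ⟨z, hz, hz', h1, h2⟩ := hC.meet_of_row hX hY hab hab₁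
          (fun h => hne (by subst h; rw [hC.E_fun hab hab₁])) (Int.cast_injective (i1.symm.trans j1))
          i2 i3 j2 j3
        exact ⟨z, hz, hz', h1, by rw [h2, i1]⟩
      · exact cross hab hab₁ p hp.1 hp.2
      · obtain ⟨z, hz, hz', h⟩ := cross hab₁ hab p hp.2 hp.1
        exact ⟨z, hz', hz, h⟩
      · obtain ⟨i1, i2, i3⟩ := segN hab p hp.1
        obtain ⟨j1, j2, j3⟩ := segN hab₁ p hp.2
        obtain ⟨z, hz, hz', h1, h2⟩ := hC.transpose.meet_of_row hY hX hab hab₁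
          (fun h => hne (by subst h; rw [hC.N_fun hab hab₁])) (Int.cast_injective (i1.symm.trans j1))
          i2 i3 j2 j3
        exact ⟨z, hz, hz', by rw [h2, i1], h1⟩
    obtain ⟨z, hz, hz', h1, h2⟩ := key
    refine ⟨z, ?_, ?_, ?_⟩
    · rw [← Sym2.mem_iff, ← e, Sym2.mem_iff]; exact hz
    · rw [← Sym2.mem_iff, ← e₁, Sym2.mem_iff]; exact hz'
    · ext i
      fin_cases i
      exacts [h1.symm, h2.symm]

end placement

end GreedyRect

/-! ### The system of gaps and its least solution -/

namespace GreedyRect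

open Finset

/-- The gap after column `k` required by the current coordinates `P`, where `ρ k` is the nearest
right neighbour of column `k` and `l (k + 1)` the nearest left neighbour of column `k + 1`. -/
noncomputable def gap (ρ l P : ℤ → ℤ) (k : ℤ) : ℤ := 1 + max (P (ρ k) - P (k + 1)) (P k - P (l (k + 1)))

/-- Coordinates realizing the gaps required by `P`. -/
noncomputable def nextPos (ρ l P : ℤ → ℤ) (k : ℤ) : ℤ := ∑ j ∈ Ico 0 k, gap ρ l P j

/-- The coordinates after `t` rounds. -/
noncomputable def posAfter (ρ l : ℤ → ℤ) (t : ℕ) : ℤ → ℤ := (nextPos ρ l)^[t] fun _ => 0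

theorem nextPos_zero (ρ l P : ℤ → ℤ) : nextPos ρ l P 0 = 0 := by simp [nextPos]

theorem nextPos_succ (ρ l P : ℤ → ℤ) {k : ℤ} (hk : 0 ≤ k) :
    nextPos ρ l P (k + 1) = nextPos ρ l P k + gap ρ l P k := by
  have : Ico 0 (k + 1) = insert k (Ico 0 k) := by
    ext j; simp only [mem_insert, mem_Ico]; lia
  rw [nextPos, nextPos, this, sum_insert (by simp), add_comm]

theorem posAfter_succ (ρ l : ℤ → ℤ) (t : ℕ) :
    posAfter ρ l (t + 1) = nextPos ρ l (posAfter ρ l t) :=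
  Function.iterate_succ_apply' _ _ _

theorem sub_le_sub_of_steps {P P' : ℤ → ℤ} {a b : ℤ} (hab : a ≤ b)
    (h : ∀ j, a ≤ j → j < b → P (j + 1) - P j ≤ P' (j + 1) - P' j) : P b - P a ≤ P' b - P' a := by
  induction b, hab using Int.leInduction with
  | base => simp
  | succ b hb ih =>
    have := ih fun j h1 h2 => h j h1 (by lia)
    have := h b hb (by lia)
    lia

/-- Neighbours for which the gaps do not depend on each other cyclically. -/
structure GapSystem (M : ℤ) (ρ l : ℤ → ℤ) : Prop where
  right : ∀ k, 0 ≤ k → k < M → k + 1 ≤ ρ k ∧ ρ k ≤ M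
  left : ∀ k, 0 ≤ k → k < M → 0 ≤ l (k + 1) ∧ l (k + 1) ≤ k
  acyclic : ∀ k k', 0 ≤ k → k < k' → k' < M → k' < ρ k → k < l (k' + 1)

namespace GapSystem

variable {M : ℤ} {ρ l : ℤ → ℤ}

/-- In each set of gaps there is one that does not depend on the others. -/
theorem exists_independent (h : GapSystem M ρ l) {U : Finset ℤ} (hU : U ⊆ Ico 0 M)
    (hne : U.Nonempty) : ∃ k ∈ U, ∀ j ∈ U, (k < j → ρ k ≤ j) ∧ (j < k → j < l (k + 1)) := by
  by_contra! hno
  have hrange : ∀ k ∈ U, 0 ≤ k ∧ k < M := fun k hk => mem_Ico.1 (hU hk)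
  -- Suppose every gap in `U` depends on another one in `U`. Then `W`, the gaps depending on a later
  -- one, contains the least element of `U`. Let `k` be the last element of `W` and `s` its
  -- successor in `U`: then `k` depends on `s`, while `s` is not in `W` and so depends on an earlier
  -- gap, which is at most `k`. This contradicts acyclicity.
  set W := U.filter fun k => ∃ j ∈ U, k < j ∧ j < ρ k with hW
  have hWne : W.Nonempty := by
    refine ⟨U.min' hne, mem_filter.2 ⟨U.min'_mem hne, ?_⟩⟩
    obtain ⟨j, hj, hj'⟩ := hno _ (U.min'_mem hne)
    have := U.min'_le j hj
    by_contra! hcon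
    have := hcon j hj
    obtain ⟨h1, -⟩ := hj' (fun hlt => hcon j hj hlt)
    lia
  obtain ⟨hkU, j, hjU, hkj, hjρ⟩ := mem_filter.1 (W.max'_mem hWne)
  set k := W.max' hWne
  have hne' : (U.filter fun j => k < j).Nonempty := ⟨j, mem_filter.2 ⟨hjU, hkj⟩⟩
  obtain ⟨hsU, hks⟩ := mem_filter.1 ((U.filter fun j => k < j).min'_mem hne')
  have hmin : ∀ i ∈ U, k < i → (U.filter fun j => k < j).min' hne' ≤ i := fun i hi hki =>
    (U.filter fun j => k < j).min'_le i (mem_filter.2 ⟨hi, hki⟩)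
  set s := (U.filter fun j => k < j).min' hne'
  have hsρ : s < ρ k := (hmin j hjU hkj).trans_lt hjρ
  have hac := h.acyclic k s (hrange k hkU).1 hks (hrange s hsU).2 hsρ
  obtain ⟨i, hi, hi'⟩ := hno s hsU
  by_cases hsi : s < i ∧ i < ρ s
  · have := W.le_max' s (mem_filter.2 ⟨hsU, i, hi, hsi⟩)
    lia
  · obtain ⟨h1, h2⟩ := hi' (fun hlt => not_lt.1 fun h' => hsi ⟨hlt, h'⟩)
    have : i ≤ k := by
      by_contra! hki
      have := hmin i hi hki
      lia
    lia

/-- Both distances in the definition of `gap` are sums of steps, so the required gap is monotone in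
those steps and depends on no others. -/
theorem gap_le_gap (h : GapSystem M ρ l) {P P' : ℤ → ℤ} {k : ℤ} (h0 : 0 ≤ k) (hk : k < M)
    (hstep : ∀ j, 0 ≤ j → j < M → (k < j ∧ j < ρ k ∨ l (k + 1) ≤ j ∧ j < k) →
      P (j + 1) - P j ≤ P' (j + 1) - P' j) : gap ρ l P k ≤ gap ρ l P' k := by
  obtain ⟨h1, h2⟩ := h.right k h0 hk
  obtain ⟨h3, h4⟩ := h.left k h0 hk
  refine add_le_add_right (max_le_max ?_ ?_) 1
  · exact sub_le_sub_of_steps h1 fun j i1 i2 => hstep j (by lia) (by lia) (by lia)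
  · exact sub_le_sub_of_steps h4 fun j i1 i2 => hstep j (by lia) (by lia) (by lia)

/-- Each round settles at least one new gap: among those not yet settled there is one that depends
only on settled gaps. -/
theorem exists_stable (h : GapSystem M ρ l) (t : ℕ) :
    ∃ T ⊆ Ico 0 M, (T = Ico 0 M ∨ t ≤ T.card) ∧
      ∀ k ∈ T, ∀ s ≥ t, gap ρ l (posAfter ρ l s) k = gap ρ l (posAfter ρ l t) k := by
  induction t with
  | zero => exact ⟨∅, by simp, by simp, by simp⟩
  | succ t ih =>
    obtain ⟨T, hT, hcard, hst⟩ := ih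
    have hst' : ∀ k ∈ T, ∀ s ≥ t + 1,
        gap ρ l (posAfter ρ l s) k = gap ρ l (posAfter ρ l (t + 1)) k := fun k hk s hs =>
      (hst k hk s (by lia)).trans (hst k hk (t + 1) (by lia)).symm
    by_cases hall : T = Ico 0 M
    · exact ⟨T, hT, .inl hall, hst'⟩
    have hne : (Ico 0 M \ T).Nonempty := by
      rw [sdiff_nonempty]
      exact fun hsub => hall (hT.antisymm hsub)
    obtain ⟨k, hk, hind⟩ := h.exists_independent sdiff_subset hne
    obtain ⟨hkM, hkT⟩ := mem_sdiff.1 hk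
    obtain ⟨hk0, hkM⟩ := mem_Ico.1 hkM
    have hmem : ∀ j, 0 ≤ j → j < M → (k < j ∧ j < ρ k ∨ l (k + 1) ≤ j ∧ j < k) → j ∈ T := by
      intro j h1 h2 h3
      by_contra hj
      have := hind j (mem_sdiff.2 ⟨mem_Ico.2 ⟨h1, h2⟩, hj⟩)
      lia
    have hstep : ∀ s ≥ t + 1, ∀ j, 0 ≤ j → j < M →
        (k < j ∧ j < ρ k ∨ l (k + 1) ≤ j ∧ j < k) →
        posAfter ρ l s (j + 1) - posAfter ρ l s j = gap ρ l (posAfter ρ l t) j := by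
      intro s hs j h1 h2 h3
      obtain ⟨s, rfl⟩ : ∃ s', s = s' + 1 := ⟨s - 1, by lia⟩
      rw [posAfter_succ, nextPos_succ _ _ _ h1, add_sub_cancel_left]
      exact hst j (hmem j h1 h2 h3) s (by lia)
    refine ⟨insert k T, insert_subset (mem_Ico.2 ⟨hk0, hkM⟩) hT, .inr ?_, ?_⟩
    · rw [card_insert_of_notMem hkT]
      have := hcard.resolve_left hall
      lia
    · intro i hi s hs
      rcases mem_insert.1 hi with rfl | hi
      · refine le_antisymm (h.gap_le_gap hk0 hkM fun j h1 h2 h3 => ?_)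
          (h.gap_le_gap hk0 hkM fun j h1 h2 h3 => ?_)
        · rw [hstep s hs j h1 h2 h3, hstep (t + 1) le_rfl j h1 h2 h3]
        · rw [hstep s hs j h1 h2 h3, hstep (t + 1) le_rfl j h1 h2 h3]
      · exact hst' i hi s hs

/-- After as many rounds as there are columns, the required gaps are realized. -/
theorem posAfter_sub (h : GapSystem M ρ l) {n : ℕ} (hn : M < n) {k : ℤ} (hk : 0 ≤ k)
    (hkM : k < M) : posAfter ρ l n (k + 1) - posAfter ρ l n k = gap ρ l (posAfter ρ l n) k := by
  -- After `t = n - 1 ≥ M` rounds all `M` gaps are settled, so the last round realizes gaps that no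
  -- longer change.
  obtain ⟨t, rfl⟩ : ∃ t, n = t + 1 := ⟨n - 1, by lia⟩
  obtain ⟨T, hT, hcard, hst⟩ := h.exists_stable t
  have hT' : T = Ico 0 M := by
    rcases hcard with hcard | hcard
    · exact hcard
    · refine eq_of_subset_of_card_le hT ?_
      simp only [Int.card_Ico]
      lia
  rw [hst k (hT' ▸ mem_Ico.2 ⟨hk, hkM⟩) (t + 1) (by lia), posAfter_succ, nextPos_succ _ _ _ hk,
    add_sub_cancel_left]

variable {P : ℤ → ℤ}

theorem one_le (h : GapSystem M ρ l)
    (hP : ∀ k, 0 ≤ k → k < M → P (k + 1) - P k = gap ρ l P k) :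
    ∀ k, 0 ≤ k → k < M → 1 ≤ P (k + 1) - P k := by
  by_contra! hno
  obtain ⟨k, h0, hk, hlt⟩ := hno
  obtain ⟨k, hk, hind⟩ := h.exists_independent
    (U := (Ico 0 M).filter fun k => P (k + 1) - P k < 1) (filter_subset _ _)
    ⟨k, mem_filter.2 ⟨mem_Ico.2 ⟨h0, hk⟩, hlt⟩⟩
  obtain ⟨hkM, hlt⟩ := mem_filter.1 hk
  obtain ⟨hk0, hkM⟩ := mem_Ico.1 hkM
  -- Comparison with zero steps: a step below 1 that depends only on nonnegative steps would still
  -- have to be at least 1.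
  have := h.gap_le_gap (P := fun _ => 0) (P' := P) hk0 hkM fun j h1 h2 h3 => by
    by_contra! hj
    have := hind j (mem_filter.2 ⟨mem_Ico.2 ⟨h1, h2⟩, by lia⟩)
    lia
  rw [← hP k hk0 hkM] at this
  simp [gap] at this
  lia

/-- Coordinates that realize exactly the required gaps have the smallest gaps. -/
theorem le_of_gap_le (h : GapSystem M ρ l)
    (hP : ∀ k, 0 ≤ k → k < M → P (k + 1) - P k = gap ρ l P k) {P' : ℤ → ℤ}
    (hP' : ∀ k, 0 ≤ k → k < M → gap ρ l P' k ≤ P' (k + 1) - P' k) :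
    ∀ k, 0 ≤ k → k < M → P (k + 1) - P k ≤ P' (k + 1) - P' k := by
  by_contra! hno
  obtain ⟨k, h0, hk, hlt⟩ := hno
  obtain ⟨k, hk, hind⟩ := h.exists_independent
    (U := (Ico 0 M).filter fun k => P' (k + 1) - P' k < P (k + 1) - P k) (filter_subset _ _)
    ⟨k, mem_filter.2 ⟨mem_Ico.2 ⟨h0, hk⟩, hlt⟩⟩
  obtain ⟨hkM, hlt⟩ := mem_filter.1 hk
  obtain ⟨hk0, hkM⟩ := mem_Ico.1 hkM
  have := h.gap_le_gap (P := P) (P' := P') hk0 hkM fun j h1 h2 h3 => by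
    by_contra! hj
    have := hind j (mem_filter.2 ⟨mem_Ico.2 ⟨h1, h2⟩, hj⟩)
    lia
  have := hP k hk0 hkM
  have := hP' k hk0 hkM
  lia

end GapSystem

end GreedyRect

/-! ### The program and its running time -/

namespace GreedyRect

namespace RAM

/-- The memory after the assignment `a[i] := x`. -/
def Store.set (s : Store) (a : ℕ) (i x : ℤ) : Store :=
  Function.update s a (Function.update (s a) i x)

theorem Store.set_apply (s : Store) (a : ℕ) (i x : ℤ) (b : ℕ) (j : ℤ) :
    s.set a i x b j = if b = a ∧ j = i then x else s b j := by
  simp only [Store.set, Function.update_apply]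
  split_ifs <;> simp_all

theorem Store.set_of_ne (s : Store) {a b : ℕ} (i x : ℤ) (h : b ≠ a) : s.set a i x b = s b :=
  Function.update_of_ne h _ _

/-- Programs without loops. -/
def Cmd.LoopFree : Cmd → Prop
  | .skip => True
  | .write _ _ _ => True
  | .seq c d => c.LoopFree ∧ d.LoopFree
  | .ifLe _ _ c d => c.LoopFree ∧ d.LoopFree
  | .whileLe _ _ _ => False

/-- The memory after running a program without loops. -/
def Cmd.run : Cmd → Store → Store
  | .skip, s => s
  | .write a i e, s => s.set a (i.eval s) (e.eval s)
  | .seq c d, s => d.run (c.run s)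
  | .ifLe e f c d, s => if e.eval s ≤ f.eval s then c.run s else d.run s
  | .whileLe _ _ _, s => s

/-- An upper bound for the number of steps of a program without loops. -/
def Cmd.cost : Cmd → ℕ
  | .skip => 1
  | .write _ i e => i.cost + e.cost + 1
  | .seq c d => c.cost + d.cost
  | .ifLe e f c d => e.cost + f.cost + 1 + (c.cost + d.cost)
  | .whileLe _ _ _ => 0

theorem Cmd.exec_run {c : Cmd} (hc : c.LoopFree) (s : Store) :
    ∃ t ≤ c.cost, Exec c s t (c.run s) := by
  induction c generalizing s with
  | skip => exact ⟨1, le_rfl, .skip s⟩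
  | write a i e => exact ⟨_, le_rfl, .write a i e s⟩
  | seq c d ihc ihd =>
    obtain ⟨t, ht, h⟩ := ihc hc.1 s
    obtain ⟨t', ht', h'⟩ := ihd hc.2 (c.run s)
    exact ⟨t + t', add_le_add ht ht', .seq h h'⟩
  | ifLe e f c d ihc ihd =>
    by_cases hef : e.eval s ≤ f.eval s
    · obtain ⟨t, ht, h⟩ := ihc hc.1 s
      refine ⟨e.cost + f.cost + 1 + t, by simp only [Cmd.cost]; lia, ?_⟩
      rw [Cmd.run, if_pos hef]
      exact .if_true hef h
    · obtain ⟨t, ht, h⟩ := ihd hc.2 s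
      refine ⟨e.cost + f.cost + 1 + t, by simp only [Cmd.cost]; lia, ?_⟩
      rw [Cmd.run, if_neg hef]
      exact .if_false hef h
  | whileLe => exact hc.elim

/-- The value of the counter stored in array `c`. -/
def counter (c : ℕ) : Expr := .read c (.const 0)

/-- `for c = 0, …, n - 1 do body`, where `n` is stored in array `0`. -/
def forLoop (c : ℕ) (body : Cmd) : Cmd :=
  .seq (.write c (.const 0) (.const 0))
    (.whileLe (.add (counter c) (.const 1)) (counter 0)
      (.seq body (.write c (.const 0) (.add (counter c) (.const 1)))))

/-- The invariant must survive changes of the counter. The test costs 7 and the increment 6, which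
gives 13 per iteration; initialization costs 3 and the final test 7. -/
theorem exec_forLoop {c : ℕ} {body : Cmd} {n T : ℕ} {Inv : ℕ → Store → Prop}
    (hstab : ∀ i s x, Inv i s → Inv i (s.set c 0 x))
    (hn : ∀ i s, Inv i s → s 0 0 = n)
    (hbody : ∀ i < n, ∀ s, Inv i s → s c 0 = i →
      ∃ t ≤ T, ∃ s', Exec body s t s' ∧ Inv (i + 1) s' ∧ s' c 0 = i)
    (s : Store) (hs : Inv 0 s) :
    ∃ t ≤ (T + 13) * n + 10, ∃ s', Exec (forLoop c body) s t s' ∧ Inv n s' := by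
  have key : ∀ k i, i + k = n → ∀ s, Inv i s → s c 0 = i →
      ∃ t ≤ (T + 13) * k + 7, ∃ s', Exec (.whileLe (.add (counter c) (.const 1)) (counter 0)
        (.seq body (.write c (.const 0) (.add (counter c) (.const 1))))) s t s' ∧ Inv n s' := by
    intro k
    induction k with
    | zero =>
      intro i hi s hs hc
      refine ⟨7, by simp, s, .while_false ?_, by rwa [← hi]⟩
      simp only [Expr.eval, counter, hc, hn i s hs]
      lia
    | succ k ih =>
      intro i hi s hs hc
      obtain ⟨t, ht, s', hex, hinv, hc'⟩ := hbody i (by lia) s hs hc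
      obtain ⟨t', ht', s'', hex', hinv'⟩ := ih (i + 1) (by lia) (s'.set c 0 (i + 1))
        (hstab _ _ _ hinv) (by simp [Store.set_apply])
      have he : (Expr.add (counter c) (.const 1)).eval s' = (i : ℤ) + 1 := by
        simp [Expr.eval, counter, hc']
      rw [← he] at hex'
      refine ⟨_, ?_, s'', Exec.while_true ?_ (.seq hex (.write _ _ _ _)) hex', hinv'⟩
      · simp only [Expr.cost, counter]
        lia
      · simp only [Expr.eval, counter, hc, hn i s hs]
        lia
  obtain ⟨t, ht, s', hex, hinv⟩ := key n 0 (by simp) (s.set c 0 0) (hstab _ _ _ hs)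
    (by simp [Store.set_apply])
  refine ⟨_, ?_, s', .seq (.write _ _ _ _) hex, hinv⟩
  simp only [Expr.cost]
  lia

/-- The assignment `a[i] := max a[i] e`. -/
def maxAt (a : ℕ) (i e : Expr) : Cmd := .ifLe e (.read a i) .skip (.write a i e)

theorem run_maxAt (a : ℕ) (i e : Expr) (s : Store) :
    (maxAt a i e).run s = s.set a (i.eval s) (max (s a (i.eval s)) (e.eval s)) := by
  by_cases h : e.eval s ≤ s a (i.eval s)
  · rw [max_eq_left h, Store.set, Function.update_eq_self, Function.update_eq_self]
    exact if_pos h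
  · rw [max_eq_right (not_le.1 h).le]
    exact if_neg h

/-- Record an edge from left to right: array `r` stores `n` minus the number of the nearest right
neighbour of each column, array `l` the number of its nearest left neighbour. -/
def nearestBody (e q r l : ℕ) : Cmd :=
  let v := counter 9
  let w := Expr.read e v
  .ifLe (.const 0) w
    -- Subtracting from `n` turns the minimum for right neighbours into a maximum, so
    -- zero-initialized cells serve as default in both arrays.
    (.seq (maxAt r (.read q v) (.sub (counter 0) (.read q w))) (maxAt l (.read q w) (.read q v)))
    .skip

/-- Array `11` stores the gaps required by the coordinates in array `p`. -/
def gapBody (r l p : ℕ) : Cmd :=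
  let k := counter 9
  let k' := Expr.add k (.const 1)
  let a := Expr.sub (.read p (.sub (counter 0) (.read r k))) (.read p k')
  let b := Expr.sub (.read p k) (.read p (.read l k'))
  .ifLe a b (.write 11 k (.add (.const 1) b)) (.write 11 k (.add (.const 1) a))

/-- Array `p` stores the coordinates with the gaps in array `11`. -/
def sumBody (p : ℕ) : Cmd :=
  .write p (.add (counter 9) (.const 1)) (.add (.read p (counter 9)) (.read 11 (counter 9)))

/-- The coordinate of each vertex is that of its column. -/
def outBody (q p o : ℕ) : Cmd := .write o (counter 9) (.read p (.read q (counter 9)))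

/-- Coordinates for one axis: `e` contains the right neighbours of the vertices, `q` the numbers of
their columns, and the coordinates are written to `o`. -/
def axisProg (e q o r l p : ℕ) : Cmd :=
  .seq (forLoop 9 (nearestBody e q r l))
    (.seq (forLoop 10 (.seq (forLoop 9 (gapBody r l p)) (forLoop 9 (sumBody p))))
      (forLoop 9 (outBody q p o)))

/-- The arrays used by `axisProg` are different. -/
structure Distinct (e q o r l p : ℕ) : Prop where
  he : 0 < e
  heq : e < q
  hqo : q < o
  ho : o < 9
  hr : 11 < r
  hrl : r < l
  hlp : l < p

/-- What `nearestBody` has achieved after treating the vertices below `i`. -/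
structure Nearest (n : ℕ) (e q : ℤ → ℤ) (i : ℕ) (r l : ℤ → ℤ) : Prop where
  bound : ∀ v : ℤ, 0 ≤ v → v < i → 0 ≤ e v → n - q (e v) ≤ r (q v) ∧ q v ≤ l (q (e v))
  right : ∀ k, r k = 0 ∨ ∃ v : ℤ, 0 ≤ v ∧ v < i ∧ 0 ≤ e v ∧ q v = k ∧ r k = n - q (e v)
  left : ∀ k, l k = 0 ∨ ∃ v : ℤ, 0 ≤ v ∧ v < i ∧ 0 ≤ e v ∧ q (e v) = k ∧ l k = q v

section axis

variable {e q o r l p : ℕ} (hD : Distinct e q o r l p) {n : ℕ}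
include hD

theorem exec_nearest (s₀ : Store) (hn : s₀ 0 0 = n) (hr : ∀ k, s₀ r k = 0)
    (hl : ∀ k, s₀ l k = 0) :
    ∃ t ≤ ((nearestBody e q r l).cost + 13) * n + 10, ∃ s,
      Exec (forLoop 9 (nearestBody e q r l)) s₀ t s ∧
      (∀ a, a ≠ 9 → a ≠ r → a ≠ l → s a = s₀ a) ∧ Nearest n (s₀ e) (s₀ q) n (s r) (s l) := by
  obtain ⟨h1, h2, h3, h4, h5, h6, h7⟩ := hD
  refine exec_forLoop (Inv := fun i s => (∀ a, a ≠ 9 → a ≠ r → a ≠ l → s a = s₀ a) ∧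
    Nearest n (s₀ e) (s₀ q) i (s r) (s l)) ?_ ?_ ?_ s₀ ?_
  · rintro i s x ⟨hf, hN⟩
    refine ⟨fun a i1 i2 i3 => ?_, ?_⟩
    · rw [s.set_of_ne _ _ i1, hf a i1 i2 i3]
    · rwa [s.set_of_ne _ _ (by lia : r ≠ 9), s.set_of_ne _ _ (by lia : l ≠ 9)]
  · rintro i s ⟨hf, -⟩
    rw [hf 0 (by lia) (by lia) (by lia), hn]
  · rintro i hi s ⟨hf, hb, hri, hle⟩ hc
    obtain ⟨t, ht, hex⟩ := Cmd.exec_run (c := nearestBody e q r l)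
      (by simp [nearestBody, maxAt, Cmd.LoopFree]) s
    have e0 := hf 0 (by lia) (by lia) (by lia)
    have ee := hf e (by lia) (by lia) (by lia)
    have eq' := hf q (by lia) (by lia) (by lia)
    have hrun : (nearestBody e q r l).run s = if 0 ≤ s₀ e i then
        (s.set r (s₀ q i) (max (s r (s₀ q i)) (n - s₀ q (s₀ e i)))).set l (s₀ q (s₀ e i))
          (max (s l (s₀ q (s₀ e i))) (s₀ q i)) else s := by
      simp only [nearestBody, Cmd.run, run_maxAt, Expr.eval, counter, hc, e0, hn, ee, eq',
        Store.set_of_ne _ _ _ (by lia : q ≠ r), Store.set_of_ne _ _ _ (by lia : e ≠ r),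
        Store.set_of_ne _ _ _ (by lia : 9 ≠ r), Store.set_of_ne _ _ _ (by lia : l ≠ r)]
    refine ⟨t, ht, _, hex, ?_⟩
    rw [hrun]
    split_ifs with hi0
    · set s' := (s.set r (s₀ q i) (max (s r (s₀ q i)) (n - s₀ q (s₀ e i)))).set l (s₀ q (s₀ e i))
          (max (s l (s₀ q (s₀ e i))) (s₀ q i)) with hs'
      have hr' : ∀ k, s' r k = if k = s₀ q i then max (s r k) (n - s₀ q (s₀ e i)) else s r k := by
        intro k
        rw [hs', Store.set_of_ne _ _ _ (by lia : r ≠ l), Store.set_apply]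
        split_ifs <;> simp_all
      have hl' : ∀ k, s' l k = if k = s₀ q (s₀ e i) then max (s l k) (s₀ q i) else s l k := by
        intro k
        rw [hs', Store.set_apply, Store.set_of_ne _ _ _ (by lia : l ≠ r)]
        split_ifs <;> simp_all
      refine ⟨⟨fun a i1 i2 i3 => ?_, fun v hv hvi hev => ?_, fun k => ?_, fun k => ?_⟩, ?_⟩
      · rw [hs', Store.set_of_ne _ _ _ i3, Store.set_of_ne _ _ _ i2, hf a i1 i2 i3]
      · rw [hr', hl']
        rcases (by lia : v < i ∨ v = i) with h | rfl
        · have := hb v hv h hev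
          constructor <;> split_ifs <;> lia
        · constructor <;> split_ifs <;> lia
      · rw [hr']
        split_ifs with hk
        · rcases le_total (s r k) (n - s₀ q (s₀ e i)) with h | h
          · rw [max_eq_right h]
            exact .inr ⟨i, by lia, by lia, hi0, hk.symm, rfl⟩
          · rw [max_eq_left h]
            exact (hri k).imp_right fun ⟨v, i1, i2, i3⟩ => ⟨v, i1, by lia, i3⟩
        · exact (hri k).imp_right fun ⟨v, i1, i2, i3⟩ => ⟨v, i1, by lia, i3⟩
      · rw [hl']
        split_ifs with hk
        · rcases le_total (s l k) (s₀ q i) with h | h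
          · rw [max_eq_right h]
            exact .inr ⟨i, by lia, by lia, hi0, hk.symm, rfl⟩
          · rw [max_eq_left h]
            exact (hle k).imp_right fun ⟨v, i1, i2, i3⟩ => ⟨v, i1, by lia, i3⟩
        · exact (hle k).imp_right fun ⟨v, i1, i2, i3⟩ => ⟨v, i1, by lia, i3⟩
      · rw [hs', Store.set_of_ne _ _ _ (by lia : 9 ≠ l), Store.set_of_ne _ _ _ (by lia : 9 ≠ r), hc]
    · refine ⟨⟨hf, fun v hv hvi hev => hb v hv ?_ hev, fun k => ?_, fun k => ?_⟩, hc⟩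
      · rcases (by lia : v < i ∨ v = i) with h | rfl
        · exact h
        · exact absurd hev hi0
      · exact (hri k).imp_right fun ⟨v, i1, i2, i3⟩ => ⟨v, i1, by lia, i3⟩
      · exact (hle k).imp_right fun ⟨v, i1, i2, i3⟩ => ⟨v, i1, by lia, i3⟩
  · exact ⟨fun _ _ _ _ => rfl, ⟨fun v h h' => by lia, fun k => .inl (hr k), fun k => .inl (hl k)⟩⟩

theorem exec_gap (s₀ : Store) (hn : s₀ 0 0 = n) :
    ∃ t ≤ ((gapBody r l p).cost + 13) * n + 10, ∃ s,
      Exec (forLoop 9 (gapBody r l p)) s₀ t s ∧ (∀ a, a ≠ 9 → a ≠ 11 → s a = s₀ a) ∧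
      ∀ k : ℤ, 0 ≤ k → k < n → s 11 k = gap (fun k => n - s₀ r k) (s₀ l) (s₀ p) k := by
  obtain ⟨h1, h2, h3, h4, h5, h6, h7⟩ := hD
  refine exec_forLoop (Inv := fun i s => (∀ a, a ≠ 9 → a ≠ 11 → s a = s₀ a) ∧
    ∀ k : ℤ, 0 ≤ k → k < i → s 11 k = gap (fun k => n - s₀ r k) (s₀ l) (s₀ p) k) ?_ ?_ ?_ s₀ ?_
  · rintro i s x ⟨hf, hN⟩
    refine ⟨fun a i1 i2 => ?_, ?_⟩
    · rw [s.set_of_ne _ _ i1, hf a i1 i2]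
    · rwa [s.set_of_ne _ _ (by lia : 11 ≠ 9)]
  · rintro i s ⟨hf, -⟩
    rw [hf 0 (by lia) (by lia), hn]
  · rintro i hi s ⟨hf, hg⟩ hc
    obtain ⟨t, ht, hex⟩ := Cmd.exec_run (c := gapBody r l p) (by simp [gapBody, Cmd.LoopFree]) s
    have hrun : (gapBody r l p).run s =
        s.set 11 i (gap (fun k => n - s₀ r k) (s₀ l) (s₀ p) i) := by
      simp only [gapBody, Cmd.run, Expr.eval, counter, hc, hf 0 (by lia) (by lia), hn,
        hf r (by lia) (by lia), hf l (by lia) (by lia), hf p (by lia) (by lia), gap]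
      split_ifs with h
      · rw [max_eq_right h]
      · rw [max_eq_left (not_le.1 h).le]
    refine ⟨t, ht, _, hex, ?_⟩
    rw [hrun]
    refine ⟨⟨fun a i1 i2 => ?_, fun k hk hki => ?_⟩, ?_⟩
    · rw [Store.set_of_ne _ _ _ i2, hf a i1 i2]
    · rw [Store.set_apply]
      split_ifs with h
      · rw [h.2]
      · exact hg k hk (by lia)
    · rw [Store.set_of_ne _ _ _ (by lia : 9 ≠ 11), hc]
  · exact ⟨fun _ _ _ => rfl, fun v h h' => by lia⟩

theorem exec_sum (s₀ : Store) (hn : s₀ 0 0 = n) :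
    ∃ t ≤ ((sumBody p).cost + 13) * n + 10, ∃ s,
      Exec (forLoop 9 (sumBody p)) s₀ t s ∧ (∀ a, a ≠ 9 → a ≠ p → s a = s₀ a) ∧
      s p 0 = s₀ p 0 ∧ ∀ k : ℤ, 0 ≤ k → k < n → s p (k + 1) = s p k + s₀ 11 k := by
  obtain ⟨h1, h2, h3, h4, h5, h6, h7⟩ := hD
  refine exec_forLoop (Inv := fun i s => (∀ a, a ≠ 9 → a ≠ p → s a = s₀ a) ∧
    s p 0 = s₀ p 0 ∧ ∀ k : ℤ, 0 ≤ k → k < i → s p (k + 1) = s p k + s₀ 11 k) ?_ ?_ ?_ s₀ ?_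
  · rintro i s x ⟨hf, hN⟩
    refine ⟨fun a i1 i2 => ?_, ?_⟩
    · rw [s.set_of_ne _ _ i1, hf a i1 i2]
    · rwa [s.set_of_ne _ _ (by lia : p ≠ 9)]
  · rintro i s ⟨hf, -⟩
    rw [hf 0 (by lia) (by lia), hn]
  · rintro i hi s ⟨hf, h0, hg⟩ hc
    obtain ⟨t, ht, hex⟩ := Cmd.exec_run (c := sumBody p) (by simp [sumBody, Cmd.LoopFree]) s
    have hrun : (sumBody p).run s = s.set p (i + 1) (s p i + s₀ 11 i) := by
      simp only [sumBody, Cmd.run, Expr.eval, counter, hc, hf 11 (by lia) (by lia)]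
    refine ⟨t, ht, _, hex, ?_⟩
    rw [hrun]
    refine ⟨⟨fun a i1 i2 => ?_, ?_, fun k hk hki => ?_⟩, ?_⟩
    · rw [Store.set_of_ne _ _ _ i2, hf a i1 i2]
    · rw [Store.set_apply, if_neg (by lia), h0]
    · rw [Store.set_apply, Store.set_apply, if_neg (by lia : ¬ (p = p ∧ k = i + 1))]
      split_ifs with h
      · rw [(by lia : k = i)]
      · exact hg k hk (by lia)
    · rw [Store.set_of_ne _ _ _ (by lia : 9 ≠ p), hc]
  · exact ⟨fun _ _ _ => rfl, rfl, fun v h h' => by lia⟩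

theorem exec_out (s₀ : Store) (hn : s₀ 0 0 = n) :
    ∃ t ≤ ((outBody q p o).cost + 13) * n + 10, ∃ s,
      Exec (forLoop 9 (outBody q p o)) s₀ t s ∧ (∀ a, a ≠ 9 → a ≠ o → s a = s₀ a) ∧
      ∀ k : ℤ, 0 ≤ k → k < n → s o k = s₀ p (s₀ q k) := by
  obtain ⟨h1, h2, h3, h4, h5, h6, h7⟩ := hD
  refine exec_forLoop (Inv := fun i s => (∀ a, a ≠ 9 → a ≠ o → s a = s₀ a) ∧
    ∀ k : ℤ, 0 ≤ k → k < i → s o k = s₀ p (s₀ q k)) ?_ ?_ ?_ s₀ ?_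
  · rintro i s x ⟨hf, hN⟩
    refine ⟨fun a i1 i2 => ?_, ?_⟩
    · rw [s.set_of_ne _ _ i1, hf a i1 i2]
    · rwa [s.set_of_ne _ _ (by lia : o ≠ 9)]
  · rintro i s ⟨hf, -⟩
    rw [hf 0 (by lia) (by lia), hn]
  · rintro i hi s ⟨hf, hg⟩ hc
    obtain ⟨t, ht, hex⟩ := Cmd.exec_run (c := outBody q p o) (by simp [outBody, Cmd.LoopFree]) s
    have hrun : (outBody q p o).run s = s.set o i (s₀ p (s₀ q i)) := by
      simp only [outBody, Cmd.run, Expr.eval, counter, hc, hf p (by lia) (by lia),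
        hf q (by lia) (by lia)]
    refine ⟨t, ht, _, hex, ?_⟩
    rw [hrun]
    refine ⟨⟨fun a i1 i2 => ?_, fun k hk hki => ?_⟩, ?_⟩
    · rw [Store.set_of_ne _ _ _ i2, hf a i1 i2]
    · rw [Store.set_apply]
      split_ifs with h
      · rw [h.2]
      · exact hg k hk (by lia)
    · rw [Store.set_of_ne _ _ _ (by lia : 9 ≠ o), hc]
  · exact ⟨fun _ _ _ => rfl, fun v h h' => by lia⟩

/-- Every round makes one pass for the gaps and one for their partial sums, which together apply
`nextPos`. The bounds on `r` and `l` keep all addresses read from `p` within `0, …, n`, where its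
content is known. -/
theorem exec_rounds (s₀ : Store) (hn : s₀ 0 0 = n) (hr : ∀ k, 0 ≤ s₀ r k ∧ s₀ r k ≤ n)
    (hl : ∀ k, 0 ≤ s₀ l k ∧ s₀ l k ≤ n) (hp : ∀ k, s₀ p k = 0) :
    ∃ t ≤ (((gapBody r l p).cost + 13) * n + 10 + (((sumBody p).cost + 13) * n + 10) + 13) * n + 10,
      ∃ s, Exec (forLoop 10 (.seq (forLoop 9 (gapBody r l p)) (forLoop 9 (sumBody p)))) s₀ t s ∧
      (∀ a, a ≠ 9 → a ≠ 10 → a ≠ 11 → a ≠ p → s a = s₀ a) ∧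
      ∀ k : ℤ, 0 ≤ k → k ≤ n → s p k = posAfter (fun k => n - s₀ r k) (s₀ l) n k := by
  have hD' := hD
  obtain ⟨h1, h2, h3, h4, h5, h6, h7⟩ := hD
  refine exec_forLoop (Inv := fun i s => (∀ a, a ≠ 9 → a ≠ 10 → a ≠ 11 → a ≠ p → s a = s₀ a) ∧
    ∀ k : ℤ, 0 ≤ k → k ≤ n → s p k = posAfter (fun k => n - s₀ r k) (s₀ l) i k) ?_ ?_ ?_ s₀ ?_
  · rintro i s x ⟨hf, hN⟩
    refine ⟨fun a i1 i2 i3 i4 => ?_, ?_⟩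
    · rw [s.set_of_ne _ _ i2, hf a i1 i2 i3 i4]
    · rwa [s.set_of_ne _ _ (by lia : p ≠ 10)]
  · rintro i s ⟨hf, -⟩
    rw [hf 0 (by lia) (by lia) (by lia) (by lia), hn]
  · rintro i hi s ⟨hf, hg⟩ hc
    obtain ⟨t, ht, s', hex, hf', hg'⟩ := exec_gap (n := n) hD' s
      (by rw [hf 0 (by lia) (by lia) (by lia) (by lia), hn])
    obtain ⟨t', ht', s'', hex', hf'', h0, hg''⟩ := exec_sum (n := n) hD' s'
      (by rw [hf' 0 (by lia) (by lia), hf 0 (by lia) (by lia) (by lia) (by lia), hn])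
    refine ⟨t + t', add_le_add ht ht', s'', .seq hex hex', ⟨fun a i1 i2 i3 i4 => ?_, ?_⟩, ?_⟩
    · rw [hf'' a i1 i4, hf' a i1 i3, hf a i1 i2 i3 i4]
    · rw [hf r (by lia) (by lia) (by lia) (by lia), hf l (by lia) (by lia) (by lia) (by lia)] at hg'
      have hgap : ∀ k : ℤ, 0 ≤ k → k < n → s' 11 k =
          gap (fun k => n - s₀ r k) (s₀ l) (posAfter (fun k => n - s₀ r k) (s₀ l) i) k := by
        intro k hk hkn
        have := hr k
        have := hl (k + 1)
        rw [hg' k hk hkn, gap, gap, hg _ (by lia) (by lia), hg _ (by lia) (by lia),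
          hg _ (by lia) (by lia), hg _ (by lia) (by lia)]
      intro k hk
      induction k, hk using Int.leInduction with
      | base =>
        intro _
        rw [posAfter_succ, nextPos_zero, h0, hf' p (by lia) (by lia), hg 0 le_rfl (by lia)]
        cases i with
        | zero => rfl
        | succ i => rw [posAfter_succ, nextPos_zero]
      | succ k hk ih =>
        intro hkn
        rw [hg'' k hk (by lia), ih (by lia), hgap k hk (by lia), posAfter_succ,
          nextPos_succ _ _ _ hk]
    · rw [hf'' 10 (by lia) (by lia), hf' 10 (by lia) (by lia), hc]
  · exact ⟨fun _ _ _ _ _ => rfl, fun k _ _ => hp k⟩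

theorem exec_axisProg : ∃ K : ℕ, ∀ (n : ℕ) (s₀ : Store), s₀ 0 0 = n → (∀ k, s₀ r k = 0) →
    (∀ k, s₀ l k = 0) → (∀ k, s₀ p k = 0) →
    (∀ v : ℤ, 0 ≤ v → v < n → s₀ e v < n ∧ 0 ≤ s₀ q v ∧ s₀ q v < n) →
    ∃ t ≤ K * (n ^ 2 + 1), ∃ s, Exec (axisProg e q o r l p) s₀ t s ∧
      (∀ a, a ≠ 9 → a ≠ 10 → a ≠ 11 → a ≠ r → a ≠ l → a ≠ p → a ≠ o → s a = s₀ a) ∧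
      ∃ r' l', Nearest n (s₀ e) (s₀ q) n r' l' ∧
        ∀ v : ℤ, 0 ≤ v → v < n → s o v = posAfter (fun k => n - r' k) l' n (s₀ q v) := by
  have hD' := hD
  obtain ⟨h1, h2, h3, h4, h5, h6, h7⟩ := hD
  set A := (nearestBody e q r l).cost
  set B := (gapBody r l p).cost
  set D := (sumBody p).cost
  set F := (outBody q p o).cost
  refine ⟨A + B + D + F + 100, fun n s₀ hn hr hl hp hq => ?_⟩
  obtain ⟨t, ht, s, hex, hf, hN⟩ := exec_nearest (n := n) hD' s₀ hn hr hl
  have hn' : s 0 0 = n := by rw [hf 0 (by lia) (by lia) (by lia), hn]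
  obtain ⟨t', ht', s', hex', hf', hP⟩ := exec_rounds (n := n) hD' s hn'
    (fun k => by
      rcases hN.right k with h | ⟨v, i1, i2, i3, i4, i5⟩
      · lia
      · have := hq _ i3 (hq v i1 i2).1
        lia)
    (fun k => by
      rcases hN.left k with h | ⟨v, i1, i2, i3, i4, i5⟩
      · lia
      · have := hq v i1 i2
        lia)
    (fun k => by rw [hf p (by lia) (by lia) (by lia), hp])
  obtain ⟨t'', ht'', s'', hex'', hf'', ho⟩ := exec_out (n := n) hD' s'
    (by rw [hf' 0 (by lia) (by lia) (by lia) (by lia), hn'])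
  refine ⟨t + (t' + t''), ?_, s'', .seq hex (.seq hex' hex''), ?_, s r, s l, hN, ?_⟩
  · have := Nat.zero_le (n ^ 2)
    have hn2 : n ≤ n ^ 2 := Nat.le_self_pow two_ne_zero n
    calc t + (t' + t'') ≤ ((A + 13) * n + 10) +
          (((B + 13) * n + 10 + ((D + 13) * n + 10) + 13) * n + 10 + ((F + 13) * n + 10)) :=
          add_le_add ht (add_le_add ht' ht'')
      _ = (B + D + 26) * n ^ 2 + (A + F + 59) * n + 30 := by ring
      _ ≤ (B + D + 26) * n ^ 2 + (A + F + 59) * n ^ 2 + 30 := by gcongr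
      _ ≤ (A + B + D + F + 100) * (n ^ 2 + 1) := by nlinarith
  · intro a i1 i2 i3 i4 i5 i6 i7
    rw [hf'' a i1 i7, hf' a i1 i2 i3 i6, hf a i1 i4 i5]
  · intro v hv hvn
    have := hq v hv hvn
    have eq' : s' q = s₀ q := by
      rw [hf' q (by lia) (by lia) (by lia) (by lia), hf q (by lia) (by lia) (by lia)]
    rw [ho v hv hvn, eq', hP _ (by lia) (by lia)]

end axis

end RAM

end GreedyRect

/-! ### Correctness and minimality of the output -/

namespace GreedyRect

open Relation

section axis

variable {n : ℕ} {C : Layout (Fin n)} {m : ℤ} {e q r l : ℤ → ℤ}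

/-- The coordinates computed for one axis are adapted to the ordering, and all distances between
columns are as small as possible. -/
theorem Layout.Valid.adapted_posAfter (hC : C.Valid) (hm : m ≤ n)
    (hrange : ∀ v, 0 ≤ C.f v ∧ C.f v < m) (hsurj : ∀ k, 0 ≤ k → k < m → ∃ v, C.f v = k)
    (hgood : ∀ p q i a b j, C.f p ≤ i → i < a → a ≤ b → b < j → j ≤ C.f q →
      ∃ u w, C.E u w ∧ i ≤ C.f u ∧ C.f w ≤ j ∧
        ((a ≤ C.f u ∧ C.f u ≤ b) ↔ ¬ (a ≤ C.f w ∧ C.f w ≤ b)))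
    (hq : ∀ v : Fin n, q v.val = C.f v) (he : ∀ v w, C.E v w → e v.val = w.val)
    (he' : ∀ v : Fin n, 0 ≤ e v.val → ∃ w, C.E v w) (hN : RAM.Nearest n e q n r l) :
    Adapted C.E C.f (fun v => posAfter (fun k => n - r k) l n (C.f v)) ∧
      ∀ X' : Fin n → ℤ, Adapted C.E C.f X' → ∀ u v, C.f u ≤ C.f v →
        posAfter (fun k => n - r k) l n (C.f v) - posAfter (fun k => n - r k) l n (C.f u) ≤
          X' v - X' u := by
  set ρ : ℤ → ℤ := fun k => n - r k with hρ
  have edge : ∀ v : ℤ, 0 ≤ v → v < n → 0 ≤ e v → ∃ z w, C.E z w ∧ q v = C.f z ∧ q (e v) = C.f w := by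
    intro v h0 hv hev
    obtain ⟨w, hw⟩ := he' ⟨v.toNat, by lia⟩ (by rwa [Int.toNat_of_nonneg h0])
    have h1 := he _ _ hw
    have h2 := hq ⟨v.toNat, by lia⟩
    simp only [Int.toNat_of_nonneg h0] at h1 h2
    exact ⟨_, w, hw, h2, by rw [h1, hq]⟩
  have bound : ∀ z w, C.E z w → ρ (C.f z) ≤ C.f w ∧ C.f z ≤ l (C.f w) := by
    intro z w h
    have := hN.bound z.val (by lia) (by have := z.isLt; lia) (by rw [he z w h]; lia)
    rw [he z w h, hq, hq] at this
    exact ⟨by simp only [hρ]; lia, this.2⟩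
  have right : ∀ k, 0 ≤ k → k < m - 1 → ∃ z w, C.f z = k ∧ C.E z w ∧ ρ k = C.f w := by
    intro k h0 hk
    obtain ⟨a, ha⟩ := hsurj k h0 (by lia)
    obtain ⟨b, hb⟩ := hsurj (k + 1) (by lia) (by lia)
    obtain ⟨z, w, hz, hzw⟩ := hC.exists_right (k := a) (v := b) (by lia)
    have h1 := (bound z w hzw).1
    rw [hz, ha] at h1
    have h2 := hrange w
    -- The default `r k = 0` would mean `ρ k = n`, which is beyond every column, but column `k` has
    -- an edge to the right.
    rcases hN.right k with h | ⟨v, i1, i2, i3, i4, i5⟩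
    · simp only [hρ] at h1
      lia
    · obtain ⟨z', w', hzw', e1, e2⟩ := edge v i1 i2 i3
      exact ⟨z', w', by rw [← e1, i4], hzw', by simp only [hρ]; lia⟩
  have left : ∀ k, 0 ≤ k → k < m - 1 → ∃ z w, C.f w = k + 1 ∧ C.E z w ∧ l (k + 1) = C.f z := by
    intro k h0 hk
    obtain ⟨a, ha⟩ := hsurj k h0 (by lia)
    obtain ⟨b, hb⟩ := hsurj (k + 1) (by lia) (by lia)
    obtain ⟨w, z, hw, hzw⟩ := hC.reflect.exists_right (k := b) (v := a)
      (show -C.f b < -C.f a by lia)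
    replace hw : C.f w = C.f b := neg_injective hw
    replace hzw : C.E z w := hzw
    have h1 := (bound z w hzw).2
    rw [hw, hb] at h1
    have h2 := hrange z
    -- The default `0` for `l` is harmless: by `bound` the left neighbour found is then itself in
    -- column 0.
    rcases hN.left (k + 1) with h | ⟨v, i1, i2, i3, i4, i5⟩
    · exact ⟨z, w, by lia, hzw, by lia⟩
    · obtain ⟨z', w', hzw', e1, e2⟩ := edge v i1 i2 i3
      exact ⟨z', w', by rw [← e2, i4], hzw', by rw [i5, e1]⟩
  have hG : GapSystem (m - 1) ρ l := by
    refine ⟨fun k h0 hk => ?_, fun k h0 hk => ?_, fun k k' h0 hk hk' hlt => ?_⟩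
    · obtain ⟨z, w, hz, hzw, h⟩ := right k h0 hk
      have := hC.E_f hzw
      have := hrange w
      lia
    · obtain ⟨z, w, hz, hzw, h⟩ := left k h0 hk
      have := hC.E_f hzw
      have := hrange z
      lia
    -- If the gaps after `k` and `k'` depended on each other, no edge inside the strip from `k` to
    -- `k' + 1` would join the block `k + 1, …, k'` to either end, against goodness.
    · by_contra! hle
      obtain ⟨p, hp⟩ := hsurj k h0 (by lia)
      obtain ⟨p', hp'⟩ := hsurj (k' + 1) (by lia) (by lia)
      obtain ⟨u, w, huw, i1, i2, i3⟩ := hgood p p' k (k + 1) k' (k' + 1) (by lia) (by lia) (by lia)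
        (by lia) (by lia)
      have hb := bound u w huw
      have hlt' := hC.E_f huw
      by_cases hin : k + 1 ≤ C.f u ∧ C.f u ≤ k'
      · have hout := i3.1 hin
        have h1 : C.f w = k' + 1 := by lia
        rw [h1] at hb
        lia
      · have hin' := not_not.1 (mt i3.2 hin)
        have h1 : C.f u = k := by lia
        rw [h1] at hb
        lia
  set P := posAfter ρ l n
  have hP : ∀ k, 0 ≤ k → k < m - 1 → P (k + 1) - P k = gap ρ l P k := fun k h0 hk =>
    hG.posAfter_sub (by lia) h0 hk
  have hmono : ∀ u v, C.f u ≤ C.f v → C.f v - C.f u ≤ P (C.f v) - P (C.f u) := fun u v h =>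
    sub_le_sub_of_steps (P := fun k => k) h fun j h1 h2 => by
      have h3 := hrange u
      have h4 := hrange v
      have := hG.one_le hP j (by lia) (by lia)
      simpa using this
  refine ⟨⟨fun u v => ?_, fun u v k h1 h2 => ?_, hgood, fun a b hab => ?_, fun a b hab => ?_⟩,
    fun X' hX' u v huv => ?_⟩
  · rcases lt_or_ge (C.f u) (C.f v) with h | h
    · have := hmono u v h.le
      lia
    · have := hmono v u h
      lia
  · have h3 := hrange u
    have h4 := hrange v
    exact hsurj k (by lia) (by lia)
  · have h3 := hrange a
    have h4 := hrange b
    obtain ⟨z, w, hz, hzw, h⟩ := right (C.f a) (by lia) (by lia)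
    have h5 := hP (C.f a) (by lia) (by lia)
    have h6 := le_max_left (P (ρ (C.f a)) - P (C.f a + 1)) (P (C.f a) - P (l (C.f a + 1)))
    refine ⟨z, w, hz, hzw, ?_⟩
    simp only [gap] at h5
    rw [hab, ← h]
    lia
  · have h3 := hrange a
    have h4 := hrange b
    obtain ⟨z, w, hz, hzw, h⟩ := left (C.f a) (by lia) (by lia)
    have h5 := hP (C.f a) (by lia) (by lia)
    have h6 := le_max_right (P (ρ (C.f a)) - P (C.f a + 1)) (P (C.f a) - P (l (C.f a + 1)))
    refine ⟨z, w, by lia, hzw, ?_⟩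
    simp only [gap] at h5
    rw [hab, ← h]
    lia
  -- Adapted coordinates are constant on columns, so they are functions of the column number and can
  -- be compared with the least solution. Their gap condition holds for some neighbour, hence for
  -- the nearest one.
  · obtain ⟨P', hP'⟩ : ∃ P' : ℤ → ℤ, ∀ v, P' (C.f v) = X' v := by
      classical
      refine ⟨fun k => if h : ∃ v, C.f v = k then X' h.choose else 0, fun v => ?_⟩
      have hex : ∃ w, C.f w = C.f v := ⟨v, rfl⟩
      simp only [dif_pos hex]
      exact (hX'.eq_iff _ _).2 hex.choose_spec
    rw [← hP', ← hP']
    refine sub_le_sub_of_steps huv fun j h1 h2 => ?_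
    have h3 := hrange u
    have h4 := hrange v
    refine hG.le_of_gap_le hP (fun k h0 hk => ?_) j (by lia) (by lia)
    obtain ⟨a, ha⟩ := hsurj k h0 (by lia)
    obtain ⟨b, hb⟩ := hsurj (k + 1) (by lia) (by lia)
    have hr : P' (ρ k) - P' (k + 1) < P' (k + 1) - P' k := by
      obtain ⟨z, w, hz, hzw, h⟩ := right k h0 hk
      obtain ⟨z', w', hz', hzw', hlt⟩ := hX'.right a b (by lia)
      have h5 := (bound z' w' hzw').1
      rw [hz', ha, h] at h5
      have h6 := (hX'.le_iff w w').2 h5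
      rw [h, ← hb, ← ha, hP', hP', hP']
      lia
    have hl : P' k - P' (l (k + 1)) < P' (k + 1) - P' k := by
      obtain ⟨z, w, hz, hzw, h⟩ := left k h0 hk
      obtain ⟨z', w', hz', hzw', hlt⟩ := hX'.left a b (by lia)
      have h5 := (bound z' w' hzw').2
      rw [hz', hb, h] at h5
      have h6 := (hX'.le_iff z' z).2 h5
      rw [h, ← hb, ← ha, hP', hP', hP']
      lia
    have := max_lt hr hl
    simp only [gap]
    lia

end axis

theorem exists_edge_of_isGood {V : Type*} {H : RectRep V} {c d : Dir} (S : StOrdering (H.dag c d))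
    (hS : S.IsGood) {f : V → ℤ}
    (hf : ∀ v, f v = (S.index (Quotient.mk (H.pathSetoid c) v)).val) (p q : V) (i a b j : ℤ)
    (hi : f p ≤ i) (hia : i < a) (hab : a ≤ b) (hbj : b < j) (hj : j ≤ f q) :
    ∃ u w, H.nbr u d = some w ∧ i ≤ f u ∧ f w ≤ j ∧
      ((a ≤ f u ∧ f u ≤ b) ↔ ¬ (a ≤ f w ∧ f w ≤ b)) := by
  have h0 : 0 ≤ f p := by
    rw [hf]
    exact Int.natCast_nonneg _
  have hlt : f q < S.length := by
    rw [hf]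
    exact Int.ofNat_lt.2 (S.index _).isLt
  have le_index : ∀ v (k : ℤ) (hk : k.toNat < S.length),
      ⟨k.toNat, hk⟩ ≤ S.index (Quotient.mk (H.pathSetoid c) v) ↔ k ≤ f v := fun v k hk => by
    rw [hf]
    exact Int.toNat_le
  have index_le : ∀ v (k : ℤ) (hk : k.toNat < S.length), 0 ≤ k →
      (S.index (Quotient.mk (H.pathSetoid c) v) ≤ ⟨k.toNat, hk⟩ ↔ f v ≤ k) := fun v k hk hk0 => by
    rw [hf]
    exact Int.le_toNat hk0
  obtain ⟨A, B, ⟨u, w, hu, hw, huw⟩, h1, h2, h3⟩ := S.exists_leaving hS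
    (i := ⟨i.toNat, by lia⟩) (a := ⟨a.toNat, by lia⟩) (b := ⟨b.toNat, by lia⟩)
    (j := ⟨j.toNat, by lia⟩) (Fin.mk_lt_mk.2 (by lia)) (Fin.mk_le_mk.2 (by lia))
    (Fin.mk_lt_mk.2 (by lia))
  subst hu hw
  refine ⟨u, w, huw, (le_index _ _ _).1 h1, (index_le _ _ _ (by lia)).1 h2, ?_⟩
  rw [← le_index u a (by lia), ← le_index w a (by lia), ← index_le u b (by lia) (by lia),
    ← index_le w b (by lia) (by lia)]
  exact h3

/-- Every column contains a vertex; hence there are at most `n` columns, and `n` rounds suffice. -/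
theorem index_range {n : ℕ} {H : RectRep (Fin n)} {c d : Dir} (S : StOrdering (H.dag c d)) :
    S.length ≤ n ∧ ∀ k : ℤ, 0 ≤ k → k < S.length →
      ∃ v, ((S.index (Quotient.mk (H.pathSetoid c) v)).val : ℤ) = k := by
  have hsurj : Function.Surjective fun v => S.index (Quotient.mk (H.pathSetoid c) v) :=
    S.index.surjective.comp Quotient.mk_surjective
  refine ⟨by simpa using Fintype.card_le_of_surjective _ hsurj, fun k h0 hk => ?_⟩
  obtain ⟨v, hv⟩ := hsurj ⟨k.toNat, by lia⟩
  refine ⟨v, ?_⟩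
  dsimp only at hv
  rw [hv]
  simp [h0]

theorem cells_coe {n : ℕ} (f : Fin n → ℤ) (v : Fin n) : cells f v.val = f v := by
  simp [cells]

section final

variable {n : ℕ} {H : RectRep (Fin n)} {Sx : StOrdering H.Dx} {Sy : StOrdering H.Dy}
  {pos : Fin n → Plane} {X Y : Fin n → ℤ}

theorem Layout.Valid.adapted_of_path {V : Type*} {C : Layout V} (hC : C.Valid) {X Y : V → ℤ}
    (hcontig : ∀ u v k, C.f u ≤ k → k ≤ C.f v → ∃ z, C.f z = k)
    (hgood : ∀ p q i a b j, C.f p ≤ i → i < a → a ≤ b → b < j → j ≤ C.f q →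
      ∃ u w, C.E u w ∧ i ≤ C.f u ∧ C.f w ≤ j ∧
        ((a ≤ C.f u ∧ C.f u ≤ b) ↔ ¬ (a ≤ C.f w ∧ C.f w ≤ b)))
    (hX : ∀ u v, X u < X v ↔ C.f u < C.f v) (hY : ∀ u v, Y u < Y v ↔ C.g u < C.g v)
    (hpath : ∀ u v, ReflTransGen (C.Closer X Y v) u v) : Adapted C.E C.f X where
  mono := hX
  contig := hcontig
  good := hgood
  right a b hab := hC.gap_of_path hX hY hab (hpath a b)
  left a b hab := by
    obtain ⟨z, w, h1, h2, h3⟩ := hC.reflect.gap_of_path (X := fun v => -X v) (Y := Y) (a := b)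
      (b := a) (fun u v => by simp only [Layout.reflect, neg_lt_neg_iff, hX]) hY
      (show -C.f a = -C.f b + 1 by lia)
      (ReflTransGen.mono (fun _ _ h => closer_reflect h) b a (hpath b a))
    exact ⟨w, z, neg_injective h1, h2, by lia⟩

/-- The extent of `X` is attained at two vertices, and those two are at least as far apart in `X'`.
-/
theorem extent_le {V : Type*} [Finite V] [Nonempty V] {f X X' : V → ℤ}
    (hX : ∀ u v, X u ≤ X v ↔ f u ≤ f v) (h : ∀ u v, f u ≤ f v → X v - X u ≤ X' v - X' u) :
    0 ≤ (⨆ v, X v) - ⨅ v, X v ∧ (⨆ v, X v) - ⨅ v, X v ≤ (⨆ v, X' v) - ⨅ v, X' v := by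
  obtain ⟨u, hu⟩ := exists_eq_ciSup_of_finite (f := X)
  obtain ⟨v, hv⟩ := exists_eq_ciInf_of_finite (f := X)
  have h1 : X v ≤ X u := hv ▸ ciInf_le (Set.finite_range X).bddBelow u
  have h2 := h v u ((hX v u).1 h1)
  have h3 : X' u ≤ ⨆ v, X' v := le_ciSup (Set.finite_range X').bddAbove u
  have h4 : ⨅ v, X' v ≤ X' v := ciInf_le (Set.finite_range X').bddBelow v
  lia

theorem exists_right_pointer (v : Fin n) (d : Dir) (h : 0 ≤ pointer (H.nbr v d)) :
    ∃ w, H.nbr v d = some w := by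
  cases hv : H.nbr v d with
  | none => simp [hv, pointer] at h
  | some w => exact ⟨w, rfl⟩

/-- Sufficiency of the gap condition makes the computed placement a greedy drawing. Necessity makes
every competitor adapted on both axes, so its width and height are separately at least as large. -/
theorem isMinArea_of_nearest (hbic : IsBiconnected H.graph) (hconv : H.IsConvex)
    (hSx : Sx.IsGood) (hSy : Sy.IsGood) {r l r' l' : ℤ → ℤ}
    (hN : RAM.Nearest n (cells fun v => pointer (H.nbr v .east))
      (cells fun v => ((Sx.index (H.cx v)).val : ℤ)) n r l)
    (hN' : RAM.Nearest n (cells fun v => pointer (H.nbr v .north))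
      (cells fun v => ((Sy.index (H.cy v)).val : ℤ)) n r' l')
    (hX : ∀ v, X v = posAfter (fun k => n - r k) l n (Sx.index (H.cx v)).val)
    (hY : ∀ v, Y v = posAfter (fun k => n - r' k) l' n (Sy.index (H.cy v)).val) :
    IsMinAreaGreedyGridDrawing H Sx Sy X Y := by
  obtain ⟨pos, hc⟩ := hconv
  have hconn := hbic.1
  have hne : Nonempty (Fin n) := hconn.nonempty
  have hC := layout_valid (Sx := Sx) (Sy := Sy) hc hconn
  set C := layout H Sx Sy pos with hCdef
  obtain ⟨hmx, hsx⟩ := index_range Sx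
  obtain ⟨hmy, hsy⟩ := index_range Sy
  have hgx := exists_edge_of_isGood Sx hSx (f := C.f) fun _ => rfl
  have hgy := exists_edge_of_isGood Sy hSy (f := C.g) fun _ => rfl
  have rx : ∀ v, 0 ≤ C.f v ∧ C.f v < Sx.length := fun v =>
    ⟨Int.natCast_nonneg _, Int.ofNat_lt.2 (Sx.index (H.cx v)).isLt⟩
  have ry : ∀ v, 0 ≤ C.g v ∧ C.g v < Sy.length := fun v =>
    ⟨Int.natCast_nonneg _, Int.ofNat_lt.2 (Sy.index (H.cy v)).isLt⟩
  obtain ⟨aX, minX⟩ := hC.adapted_posAfter (m := Sx.length) (by lia) rx hsx hgx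
    (fun v => cells_coe _ v)
    (fun v w h => by rw [cells_coe, (show H.nbr v .east = some w from h), pointer])
    (fun v h => exists_right_pointer v .east (by rwa [cells_coe] at h)) hN
  obtain ⟨aY, minY⟩ := hC.transpose.adapted_posAfter (m := Sy.length) (by lia) ry hsy hgy
    (fun v => cells_coe _ v)
    (fun v w h => by rw [cells_coe, (show H.nbr v .north = some w from h), pointer])
    (fun v h => exists_right_pointer v .north (by rwa [cells_coe] at h)) hN'
  have eX : X = fun v => posAfter (fun k => n - r k) l n (C.f v) := funext hX
  have eY : Y = fun v => posAfter (fun k => n - r' k) l' n (C.transpose.f v) := funext hY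
  rw [← eX] at aX
  rw [← eY] at aY
  have ifx : ∀ u w, C.f u < C.f w ↔ Sx.index (H.cx u) < Sx.index (H.cx w) := fun u w =>
    Int.ofNat_lt
  have ify : ∀ u w, C.g u < C.g w ↔ Sy.index (H.cy u) < Sy.index (H.cy w) := fun u w =>
    Int.ofNat_lt
  refine ⟨⟨isDrawing_of_adapted hc hconn aX aY,
    isGreedy_of_closer hc.isDrawing fun u v huv => hC.exists_closer aX aY huv,
    fun u w => ⟨?_, ?_⟩⟩, ?_⟩
  · rw [← ifx, ← aX.mono]
    exact Int.cast_lt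
  · rw [← ify]
    exact Int.cast_lt.trans (aY.mono u w)
  · rintro X₁ Y₁ ⟨hd₁, hg₁, hr₁⟩
    have mX : ∀ u v, X₁ u < X₁ v ↔ C.f u < C.f v := fun u v => by
      rw [ifx, ← (hr₁ u v).1]
      exact Int.cast_lt.symm
    have mY : ∀ u v, Y₁ u < Y₁ v ↔ C.g u < C.g v := fun u v => by
      rw [ify, ← (hr₁ u v).2]
      exact Int.cast_lt.symm
    have hpath : ∀ u v, ReflTransGen (C.Closer X₁ Y₁ v) u v :=
      reflTransGen_of_isGreedy hc.isDrawing hg₁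
    have aX₁ := hC.adapted_of_path aX.contig aX.good mX mY hpath
    have aY₁ := hC.transpose.adapted_of_path aY.contig aY.good mY mX fun u v =>
      ReflTransGen.mono (fun _ _ h => Layout.closer_transpose h) u v (hpath u v)
    obtain ⟨x0, x1⟩ := extent_le aX.le_iff (X' := X₁) (by rw [eX]; exact minX X₁ aX₁)
    obtain ⟨y0, y1⟩ := extent_le aY.le_iff (X' := Y₁) (by rw [eY]; exact minY Y₁ aY₁)
    exact mul_le_mul x1 y1 y0 (x0.trans x1)

end final

end GreedyRect

theorem mainTheorem6 :
    ∃ (P : RAM.Cmd) (C : ℕ), ∀ (n : ℕ) (H : RectRep (Fin n)),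
      IsBiconnected H.graph → H.IsConvex →
      ∀ (Sx : StOrdering H.Dx) (Sy : StOrdering H.Dy), Sx.IsGood → Sy.IsGood →
        ∃ (t : ℕ) (s : RAM.Store), RAM.Exec P (inputStore H Sx Sy) t s ∧ t ≤ C * n ^ 2 ∧
          IsMinAreaGreedyGridDrawing H Sx Sy (outputX s) (outputY s) := by
  -- Each axis has its own work arrays `r`, `l`, `p`, so the second run also finds them filled with
  -- zeros.
  obtain ⟨K, hK⟩ := RAM.exec_axisProg (e := 1) (q := 5) (o := 7) (r := 12) (l := 13) (p := 14)
    (by constructor <;> decide)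
  obtain ⟨K', hK'⟩ := RAM.exec_axisProg (e := 2) (q := 6) (o := 8) (r := 15) (l := 16) (p := 17)
    (by constructor <;> decide)
  refine ⟨.seq (RAM.axisProg 1 5 7 12 13 14) (RAM.axisProg 2 6 8 15 16 17), 2 * (K + K'),
    fun n H hbic hconv Sx Sy hSx hSy => ?_⟩
  have hn : 0 < n := Fin.pos_iff_nonempty.2 hbic.1.nonempty
  have hptr : ∀ (d : Dir) (v : Fin n), pointer (H.nbr v d) < n := fun d v => by
    cases H.nbr v d with
    | none => simp only [pointer]; lia
    | some w => exact Int.ofNat_lt.2 w.isLt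
  have hcell : ∀ (F : Fin n → ℤ) (v : ℤ), 0 ≤ v → v < n → ∃ w : Fin n, cells F v = F w := by
    intro F v h0 hv
    have := cells_coe F ⟨v.toNat, by lia⟩
    simp only [Int.toNat_of_nonneg h0] at this
    exact ⟨_, this⟩
  obtain ⟨t, ht, s, hex, hf, r, l, hN, hX⟩ := hK n (inputStore H Sx Sy) rfl (fun _ => rfl)
    (fun _ => rfl) (fun _ => rfl) fun v h0 hv => by
      obtain ⟨w, hw⟩ := hcell (fun v => pointer (H.nbr v .east)) v h0 hv
      obtain ⟨w', hw'⟩ := hcell (fun v => ((Sx.index (H.cx v)).val : ℤ)) v h0 hv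
      simp only [inputStore, hw, hw']
      exact ⟨hptr _ _, Int.natCast_nonneg _,
        Int.ofNat_lt.2 ((Sx.index (H.cx w')).isLt.trans_le (index_range Sx).1)⟩
  have hs : ∀ a, a ≠ 9 → a ≠ 10 → a ≠ 11 → a ≠ 12 → a ≠ 13 → a ≠ 14 → a ≠ 7 →
    s a = inputStore H Sx Sy a := hf
  obtain ⟨t', ht', s', hex', hf', r', l', hN', hY⟩ := hK' n s
    (by rw [hs 0 (by decide) (by decide) (by decide) (by decide) (by decide) (by decide)
      (by decide)]; rfl)
    (fun _ => by rw [hs 15 (by decide) (by decide) (by decide) (by decide) (by decide) (by decide)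
      (by decide)]; rfl)
    (fun _ => by rw [hs 16 (by decide) (by decide) (by decide) (by decide) (by decide) (by decide)
      (by decide)]; rfl)
    (fun _ => by rw [hs 17 (by decide) (by decide) (by decide) (by decide) (by decide) (by decide)
      (by decide)]; rfl)
    fun v h0 hv => by
      obtain ⟨w, hw⟩ := hcell (fun v => pointer (H.nbr v .north)) v h0 hv
      obtain ⟨w', hw'⟩ := hcell (fun v => ((Sy.index (H.cy v)).val : ℤ)) v h0 hv
      rw [hs 2 (by decide) (by decide) (by decide) (by decide) (by decide) (by decide) (by decide),
        hs 6 (by decide) (by decide) (by decide) (by decide) (by decide) (by decide) (by decide)]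
      simp only [inputStore, hw, hw']
      exact ⟨hptr _ _, Int.natCast_nonneg _,
        Int.ofNat_lt.2 ((Sy.index (H.cy w')).isLt.trans_le (index_range Sy).1)⟩
  rw [hs 2 (by decide) (by decide) (by decide) (by decide) (by decide) (by decide) (by decide),
    hs 6 (by decide) (by decide) (by decide) (by decide) (by decide) (by decide) (by decide)] at hN'
  rw [hs 6 (by decide) (by decide) (by decide) (by decide) (by decide) (by decide) (by decide)]
    at hY
  refine ⟨t + t', s', .seq hex hex', ?_, isMinArea_of_nearest hbic hconv hSx hSy hN hN'
    (fun v => ?_) fun v => ?_⟩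
  -- A connected graph has a vertex, so the additive constant is absorbed by `n ^ 2`.
  · have h1 : 1 ≤ n ^ 2 := Nat.one_le_pow _ _ hn
    calc t + t' ≤ K * (n ^ 2 + 1) + K' * (n ^ 2 + 1) := add_le_add ht ht'
      _ = (K + K') * (n ^ 2 + 1) := by ring
      _ ≤ (K + K') * (n ^ 2 + n ^ 2) := by gcongr
      _ = 2 * (K + K') * n ^ 2 := by ring
  · rw [outputX, hf' 7 (by decide) (by decide) (by decide) (by decide) (by decide) (by decide)
      (by decide), hX v.val (by lia) (Int.ofNat_lt.2 v.isLt)]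
    simp only [inputStore, cells_coe]
  · rw [outputY, hY v.val (by lia) (Int.ofNat_lt.2 v.isLt)]
    simp only [inputStore, cells_coe]
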